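/- Let $\mathscr H=\mathbb R^4\times\mathbb R^3$ be the quaternionic Heisenberg group with the multiplication $(x,t)\cdot(y,s)=(x+y,\;t+s+2B(x,y))$, $B=(B^1,B^2,B^3)$, $B^\beta(x,y)=\sum_{l,m}B^\beta_{lm}x_ly_m$, where $$B^1=\begin{pmatrix}0&1&0&0\\-1&0&0&0\\0&0&0&-1\\0&0&1&0\end{pmatrix},\quad B^2=\begin{pmatrix}0&0&1&0\\0&0&0&1\\-1&0&0&0\\0&-1&0&0\end{pmatrix},\quad B^3=\begin{pmatrix}0&0&0&1\\0&0&-1&0\\0&1&0&0\\-1&0&0&0\end{pmatrix},$$ with Lebesgue measure $dy\,ds$ and the left-invariant vector fields $Y_j=\partial_{y_j}+2\sum_{\beta}\sum_{l}B^\beta_{lj}y_l\,\partial_{s_\beta}$, $j=1,\dots,4$. Put $$\begin{pmatrix}Z_0^{0'}&Z_0^{1'}\\Z_1^{0'}&Z_1^{1'}\end{pmatrix}=\begin{pmatrix}-Y_3-iY_4&-Y_1-iY_2\\Y_1-iY_2&-Y_3+iY_4\end{pmatrix}.$$ For an integer $k\ge1$ the tangential $k$-Cauchy–Fueter operator $\mathscr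 D_b$ maps $f=(f_0,\dots,f_k)$ to the $\mathbb C^{2k}$-valued $\big(Z_A^{0'}f_i+Z_A^{1'}f_{i+1}\big)_{0\le i\le k-1,\;A=0,1}$, and $f$ is called $k$-CF if $\mathscr D_bf=0$ in the sense of distributions. Let $P$ (the Szegő projection) be the orthogonal projection of $L^2(\mathscr H,\mathbb C^{k+1})$ onto its closed subspace of $k$-CF functions. For $\tau=(\tau_1,\tau_2,\tau_3)\in S^2$ let $P^\tau$ be the orthogonal projection of $\mathbb C^{k+1}$ onto the line spanned by the unit vector $$e_1^\tau=\frac1\gamma\Big((1+\tau_1)^{k-j}(i\tau_2-\tau_3)^{j}\Big)_{j=0,\dots,k},\qquad \gamma=\Big(\sum_{j=0}^k(1+\tau_1)^{2k-j}(1-\tau_1)^j\Big)^{1/2},$$ if $\tau\ne(-1,0,0)$, and $e_1^\tau=(0,\dots,0,1)^t$ if $\tau=(-1,0,0)$. For $a>0$ and $s\in\mathbb R^3$ put $$I(a,s)=\frac{2^7\cdot3}{(2\pi)^5}\int_{S^2}\frac{P^\tau}{(a-i\tau\cdot s)^5}\,d\tau,$$ where $d\tau$ is the surface measure of $S^2$.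 **Theorem.** The Szegő projection $P$ has the $\mathrm{End}(\mathbb C^{k+1})$-valued kernel $$S(y,s)=I(|y|^2,s)=\frac{2^7\cdot3}{(2\pi)^5}\int_{S^2}\frac{P^\tau}{(|y|^2-i\tau\cdot s)^5}\,d\tau\qquad(y\ne0),$$ the integral being absolutely convergent. It extends to a $C^\infty$ function on $\mathscr H\setminus\{(0,0)\}$, homogeneous of degree $-10$: $S(ry,r^2s)=r^{-10}S(y,s)$ for $r>0$. It is the kernel of $P$ in the following senses, for every $g\in L^2(\mathscr H,\mathbb C^{k+1})$. 1. If $g=0$ almost everywhere on an open set $U$, then for almost every $h\in U$ $$Pg(h)=\int_{\mathscr H}S(w^{-1}h)\,g(w)\,dw,$$ with an absolutely convergent integral. 2. $Pg=g*S$ globally, as a boundary value: with $S_\varepsilon(y,s)=I(|y|^2+\varepsilon,s)$, for every $\varepsilon>0$ the integral $g*S_\varepsilon(h)=\int_{\mathscr H} S_\varepsilon(w^{-1}h)\,g(w)\,dw$ converges absolutely for every $h\in\mathscr H$ and defines an $L^2$ function of $h$, and $g*S_\varepsilon\to Pg$ in $L^2$ as $\varepsilon\to0^+$. -/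

import Mathlib

open MeasureTheory Filter Topology Complex
open scoped ContDiff InnerProductSpace

noncomputable section

namespace QHeis

/-- The horizontal layer `ℝ⁴`. -/
abbrev E4 := EuclideanSpace ℝ (Fin 4)

/-- The centre `ℝ³`. -/
abbrev E3 := EuclideanSpace ℝ (Fin 3)

/-- The underlying space `ℝ⁴ × ℝ³` of the quaternionic Heisenberg group, with Lebesgue measure
`dy ds` (which is a two-sided Haar measure for the group law `gmul` below). -/
abbrev H := E4 × E3

/-- The target space `ℂ^{k+1}` with its standard Hermitian inner product. -/
abbrev V (k : ℕ) := EuclideanSpace ℂ (Fin (k + 1))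

/-- The Hilbert space `L²(H, ℂ^{k+1})`. -/
abbrev L2H (k : ℕ) := Lp (V k) 2 (volume : Measure H)

/-- The structure matrices `B¹, B², B³`. -/
def Bmat : Fin 3 → Matrix (Fin 4) (Fin 4) ℝ :=
  ![!![0, 1, 0, 0; -1, 0, 0, 0; 0, 0, 0, -1; 0, 0, 1, 0],
    !![0, 0, 1, 0; 0, 0, 0, 1; -1, 0, 0, 0; 0, -1, 0, 0],
    !![0, 0, 0, 1; 0, 0, -1, 0; 0, 1, 0, 0; -1, 0, 0, 0]]

/-- The skew-symmetric map `B(x, y) = (B¹(x, y), B²(x, y), B³(x, y))`, with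
`B^β(x, y) = ∑_{l, m} B^β_{lm} x_l y_m`. -/
def B (x y : E4) : E3 :=
  WithLp.toLp 2 fun β => ∑ l, ∑ m, Bmat β l m * x l * y m

/-- The group law `(x, t) · (y, s) = (x + y, t + s + 2 B(x, y))`. -/
def gmul (p q : H) : H := (p.1 + q.1, p.2 + q.2 + (2 : ℝ) • B p.1 q.1)

/-- The group inverse `(x, t)⁻¹ = (-x, -t)`. -/
def ginv (p : H) : H := (-p.1, -p.2)

theorem gmul_assoc (p q r : H) : gmul (gmul p q) r = gmul p (gmul q r) := by
  ext i
  · simp [gmul, add_assoc]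
  · simp only [gmul, B, PiLp.add_apply, PiLp.smul_apply, smul_eq_mul, Fin.sum_univ_four]
    ring

theorem gmul_zero (p : H) : gmul p 0 = p := by
  ext i <;> simp [gmul, B]

theorem zero_gmul (p : H) : gmul 0 p = p := by
  ext i <;> simp [gmul, B]

theorem ginv_gmul (p : H) : gmul (ginv p) p = 0 := by
  ext i
  · simp [gmul, ginv]
  · fin_cases i <;> simp [gmul, ginv, B, Bmat, Fin.sum_univ_four] <;> ring

/-- The left invariant vector field
`Y_j = ∂_{y_j} + 2 ∑_β ∑_l B^β_{lj} y_l ∂_{s_β}` acting on a function `φ`. -/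
def Y (j : Fin 4) (φ : H → ℂ) (h : H) : ℂ :=
  fderiv ℝ φ h (EuclideanSpace.single j 1, (2 : ℝ) • B h.1 (EuclideanSpace.single j 1))

/-- The complex horizontal vector fields `Z_A^{A'}`, `A, A' ∈ {0, 1}`:
written with the indices `0, 1, 2, 3` for the four horizontal fields, i.e. the
matrix `[[-Y₂ - i Y₃, -Y₀ - i Y₁], [Y₀ - i Y₁, -Y₂ + i Y₃]]`
(row index `A`, column index `A'`). -/
def Z (A A' : Fin 2) (φ : H → ℂ) (h : H) : ℂ :=
  !![-Y 2 φ h - I * Y 3 φ h, -Y 0 φ h - I * Y 1 φ h;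
     Y 0 φ h - I * Y 1 φ h, -Y 2 φ h + I * Y 3 φ h] A A'

/-- A smooth compactly supported complex-valued test function. -/
structure IsTest (φ : H → ℂ) : Prop where
  smooth : ContDiff ℝ ∞ φ
  compact : HasCompactSupport φ

/-- The tangential `k`-Cauchy-Fueter operator is the operator from `ℂ^{k+1}`-valued to
`ℂ^{2k}`-valued functions whose components, indexed by `i = 0, …, k-1` and `A = 0, 1`, are
`(D f)_{i, A} = Z_A^{0'} f_i + Z_A^{1'} f_{i+1}`.
This is the value of the distribution `(D f)_{i, A}` on the test function `φ`. Every `Y_j` is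
divergence free, so the transpose of `Z_A^{A'}` is `-Z_A^{A'}`. -/
def pairing {k : ℕ} (f : H → V k) (i : Fin k) (A : Fin 2) (φ : H → ℂ) : ℂ :=
  -∫ h, (f h i.castSucc * Z A 0 φ h + f h i.succ * Z A 1 φ h)

/-- `f` is `k`-CF: `D f = 0` in the sense of distributions. -/
def IsKCF {k : ℕ} (f : H → V k) : Prop :=
  ∀ φ : H → ℂ, IsTest φ → ∀ (i : Fin k) (A : Fin 2), pairing f i A φ = 0

theorem IsTest.Y {φ : H → ℂ} (hφ : IsTest φ) (j : Fin 4) :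
    Continuous (Y j φ) ∧ HasCompactSupport (Y j φ) := by
  constructor
  · have h1 : Continuous (fderiv ℝ φ) := hφ.smooth.continuous_fderiv (by simp)
    have h2 : Continuous fun h : H =>
        ((EuclideanSpace.single j 1, (2 : ℝ) • B h.1 (EuclideanSpace.single j 1)) : H) := by
      have h3 : Continuous fun h : H => B h.1 (EuclideanSpace.single j 1) := by
        refine (PiLp.continuous_toLp 2 _).comp ?_
        fun_prop
      exact continuous_const.prodMk (h3.const_smul (2 : ℝ))
    exact h1.clm_apply h2
  · refine (hφ.compact.fderiv (𝕜 := ℝ)).mono ?_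
    intro h hh h0
    apply hh
    simp [QHeis.Y, h0]

theorem IsTest.Z {φ : H → ℂ} (hφ : IsTest φ) (A A' : Fin 2) :
    Continuous (Z A A' φ) ∧ HasCompactSupport (Z A A' φ) := by
  have hY := fun j => hφ.Y j
  have key : ∀ (j l : Fin 4) (a b : ℂ),
      Continuous (fun h => a * QHeis.Y j φ h + b * QHeis.Y l φ h) ∧
        HasCompactSupport (fun h => a * QHeis.Y j φ h + b * QHeis.Y l φ h) := fun j l a b =>
    ⟨(continuous_const.mul (hY j).1).add (continuous_const.mul (hY l).1),
      ((hY j).2.mul_left).add ((hY l).2.mul_left)⟩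
  fin_cases A <;> fin_cases A'
  · convert key 2 3 (-1) (-I) using 2 <;> (try ext h) <;> simp [QHeis.Z] <;> ring
  · convert key 0 1 (-1) (-I) using 2 <;> (try ext h) <;> simp [QHeis.Z] <;> ring
  · convert key 0 1 1 (-I) using 2 <;> (try ext h) <;> simp [QHeis.Z] <;> ring
  · convert key 2 3 (-1) I using 2 <;> (try ext h) <;> simp [QHeis.Z]

/-- The `L²` function representing the (conjugate of the) pairing functional. -/
theorem exists_representer {k : ℕ} {φ : H → ℂ} (hφ : IsTest φ) (i : Fin k) (A : Fin 2) :
    ∃ Ψ : L2H k, ∀ f : L2H k, pairing (f : H → V k) i A φ = inner ℂ Ψ f := by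
  let ψ : H → V k := fun h =>
    -((starRingEnd ℂ (Z A 0 φ h)) • EuclideanSpace.single i.castSucc (1 : ℂ) +
      (starRingEnd ℂ (Z A 1 φ h)) • EuclideanSpace.single i.succ (1 : ℂ))
  have hc : Continuous ψ :=
    (((continuous_conj.comp (hφ.Z A 0).1).smul continuous_const).add
      ((continuous_conj.comp (hφ.Z A 1).1).smul continuous_const)).neg
  have hs : HasCompactSupport ψ := by
    have h1 : HasCompactSupport fun h => ‖Z A 0 φ h‖ + ‖Z A 1 φ h‖ :=
      (hφ.Z A 0).2.norm.add (hφ.Z A 1).2.norm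
    refine h1.mono ?_
    intro h hh h0
    apply hh
    have h2 : Z A 0 φ h = 0 ∧ Z A 1 φ h = 0 := by
      have h3 := norm_nonneg (Z A 0 φ h)
      have h4 := norm_nonneg (Z A 1 φ h)
      constructor <;> apply norm_eq_zero.1 <;> simp only at h0 <;> linarith
    simp only [ψ, h2.1, h2.2, map_zero, zero_smul, add_zero, neg_zero]
  have hm : MemLp ψ 2 (volume : Measure H) := hc.memLp_of_hasCompactSupport hs
  refine ⟨hm.toLp ψ, fun f => ?_⟩
  rw [L2.inner_def, pairing, ← integral_neg]
  refine integral_congr_ae ?_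
  filter_upwards [hm.coeFn_toLp] with h hh
  rw [hh]
  simp only [ψ, inner_neg_left, inner_add_left, inner_smul_left, EuclideanSpace.inner_single_left,
    Complex.conj_conj, map_one, one_mul]
  ring

/-- The closed subspace of all `k`-CF functions in `L²(H, ℂ^{k+1})`. -/
def kCF (k : ℕ) : Submodule ℂ (L2H k) where
  carrier := {f | IsKCF (f : H → V k)}
  zero_mem' := fun φ hφ i A => by
    obtain ⟨Ψ, hΨ⟩ := exists_representer hφ i A
    rw [hΨ, inner_zero_right]
  add_mem' := fun {f g} hf hg φ hφ i A => by
    obtain ⟨Ψ, hΨ⟩ := exists_representer hφ i A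
    rw [hΨ, inner_add_right, ← hΨ, ← hΨ, hf φ hφ i A, hg φ hφ i A, add_zero]
  smul_mem' := fun c f hf φ hφ i A => by
    obtain ⟨Ψ, hΨ⟩ := exists_representer hφ i A
    rw [hΨ, inner_smul_right, ← hΨ, hf φ hφ i A, mul_zero]

theorem isClosed_kCF (k : ℕ) : IsClosed (kCF k : Set (L2H k)) := by
  have : (kCF k : Set (L2H k)) =
      ⋂ (φ : H → ℂ) (_ : IsTest φ) (i : Fin k) (A : Fin 2),
        {f : L2H k | pairing (f : H → V k) i A φ = 0} := by
    ext f
    simp only [Set.mem_iInter]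
    exact Iff.rfl
  rw [this]
  refine isClosed_iInter fun φ => isClosed_iInter fun hφ => isClosed_iInter fun i =>
    isClosed_iInter fun A => ?_
  obtain ⟨Ψ, hΨ⟩ := exists_representer hφ i A
  simp only [hΨ]
  exact isClosed_eq (continuous_const.inner continuous_id) continuous_const

instance (k : ℕ) : CompleteSpace (kCF k) := (isClosed_kCF k).completeSpace_coe

/-- The Szegő projection: the orthogonal projection of `L²(H, ℂ^{k+1})` onto the subspace of
`k`-CF functions. -/
def szegoProjection (k : ℕ) : L2H k →L[ℂ] L2H k := (kCF k).starProjection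

/-- The unit vector `e₁^τ ∈ ℂ^{k+1}`, `τ ∈ S²`; the coordinates `τ 0, τ 1, τ 2` stand for
`τ₁, τ₂, τ₃`. -/
def e1 (k : ℕ) (τ : E3) : V k :=
  open Classical in
  if τ = EuclideanSpace.single 0 (-1) then EuclideanSpace.single (Fin.last k) 1
  else
    (((√(∑ j ∈ Finset.range (k + 1), (1 + τ 0) ^ (2 * k - j) * (1 - τ 0) ^ j))⁻¹ : ℝ) : ℂ) •
      WithLp.toLp 2 fun j : Fin (k + 1) =>
        (1 + (τ 0 : ℂ)) ^ (k - (j : ℕ)) * (I * (τ 1 : ℂ) - (τ 2 : ℂ)) ^ (j : ℕ)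

/-- `P^τ`: the orthogonal projection of `ℂ^{k+1}` onto the line spanned by `e₁^τ`. -/
def Pτ (k : ℕ) (τ : E3) : V k →L[ℂ] V k := (ℂ ∙ e1 k τ).starProjection

/-- The standard surface measure on the unit sphere `S² ⊂ ℝ³` (of total mass `4π`). -/
def sphereMeasure : Measure (Metric.sphere (0 : E3) 1) := (volume : Measure E3).toSphere

/-- The integrand `P^τ / (a - i τ·s)⁵`. -/
def kernelIntegrand (k : ℕ) (a : ℝ) (s : E3) (τ : Metric.sphere (0 : E3) 1) : V k →L[ℂ] V k :=
  (((a : ℂ) - I * ((⟪(τ : E3), s⟫_ℝ : ℝ) : ℂ)) ^ 5)⁻¹ • Pτ k τ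

/-- `(2⁷·3 / (2π)⁵) ∫_{S²} P^τ / (a - i τ·s)⁵ dτ`. The kernel formula is the case `a = |y|²`. -/
def kernelIntegral (k : ℕ) (a : ℝ) (s : E3) : V k →L[ℂ] V k :=
  (((2 ^ 7 * 3 / (2 * Real.pi) ^ 5 : ℝ)) : ℂ) • ∫ τ, kernelIntegrand k a s τ ∂sphereMeasure

/-- The group convolution `(g * K)(h) = ∫ K(w⁻¹ h) g(w) dw` with an `End(ℂ^{k+1})`-valued
kernel. -/
def conv {k : ℕ} (g : H → V k) (K : H → V k →L[ℂ] V k) (h : H) : V k :=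
  ∫ w, K (gmul (ginv w) h) (g w)

/-- The group convolution integral converges absolutely at `h`. -/
def ConvAt {k : ℕ} (g : H → V k) (K : H → V k →L[ℂ] V k) (h : H) : Prop :=
  Integrable fun w => K (gmul (ginv w) h) (g w)

end QHeis

end

open QHeis

/-!
The singular kernel is understood through the superpositions of plane waves `I_m[Q](a, s) = ∫_{S²}
Q(τ) (a - i τ·s)⁻ᵐ dτ`. For `a > 0` they are smooth, but the kernel is needed up to `a = 0`, where
the phase vanishes on a great circle. Integration by parts on the sphere (`sphInt_deriv`)
expresses `(‖s‖² + a²) I_{m+1}` through integrals with less singular profiles, down to the profile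
`z log z`, which is continuous. So `I_m[Q]` extends continuously to the closed half space without
the origin (`planeInt`), and homogeneity turns this into decay (`planeInt_bound`). Derivatives of
`I_m[Q]` are of the same form, which gives the smoothness of the boundary kernel off the origin
(`contDiffOn_planeInt_radial`). The matrix entries of `P^τ` are restrictions to the sphere of
smooth functions (`ent`, `Pτ_apply`), so all of this applies to the kernel `S_ε` and to its limit
`S`.

It remains to see that convolution with `S_ε` converges to the projection. Let `f ∈ L²` be `k`-CF.
The weak equation may be tested against the functions `z̄ · I_5[g](b ‖y‖² + ε, -s)`, with `z̄` a
linear form in `y`. If `(g₀, g₁)` is a left eigenvector of `((τ₁, q̄), (q, -τ₁))`, `q = iτ₂ - τ₃`,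
for the eigenvalue `σ = ±1`, this yields a differential equation in the width `b`: the pairing of
two adjacent components of `f` with `I_5[g₀]` and `I_5[g₁]` is proportional to `(b + σ)⁻²`
(`IsKCF.pairK_const`). For `σ = -1` the pairing must vanish, being finite at `b = 1`
(`IsKCF.pairK_null`); this allows densities to be moved between the components of `f`, and moves
all entries of row `l` of `P^τ` to the `l`-th component, with scalar densities that add up to `1`
(`IsKCF.pairN_ent`). For `σ = 1` the result is a scaling law in `b` for each component
(`IsKCF.pairK_scale`). Together they replace the matrix kernel at `b = 1` by `(1 + b)² / 4` times
the scalar kernel at any width `b` (`IsKCF.sum_pairK_ent`).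

As `b → ∞` the scalar kernel, multiplied by `(1 + b)² / 4`, concentrates on the centre `y = 0`. It
is not integrable itself, but the difference of the kernels for two parameters `ε` and `N` is, and
its limit is the difference of the Poisson kernels of `ℝ³` of widths `ε` and `N`
(`eq_of_kone_sub_const`); the constant `2⁷·3 / (2π)⁵` is the one that normalizes this limit
(`kconst_mul`). As `N → ∞` the terms with `N` tend to zero, since translations along the centre
move every `L²` function weakly to zero (`tendsto_inner_rtr`). Hence `f * S_ε` is the mean of `f`
over central translations for the Poisson kernel of width `ε` (`IsKCF.conv_regK_ae_eq`), which
converges to `f` in `L²` (`tendsto_poisMean`).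

On the other hand the adjoint rows of `S_ε` are `k`-CF themselves (`isKCF_rowFn`), so convolution
with `S_ε` annihilates the orthogonal complement of the `k`-CF functions, and `g * S_ε = (Pg) *
S_ε` (`conv_regK_szegoProjection`). This gives the convergence of `g * S_ε` to `Pg` in `L²`. On an
open set where `g` vanishes the limit `ε → 0` may be taken under the integral (`conv_boundary`),
and an almost everywhere convergent subsequence identifies the result with `Pg`
(`szegoProjection_eq_conv`).
-/

namespace QHeis

/-! ### Integration by parts on the sphere -/

instance : IsFiniteMeasure sphereMeasure := by unfold sphereMeasure; infer_instance

/-- A linear isometry of `ℝ³`, restricted to the unit sphere. -/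
noncomputable def sphereMap (R : E3 ≃ₗᵢ[ℝ] E3) (τ : Metric.sphere (0 : E3) 1) :
    Metric.sphere (0 : E3) 1 :=
  ⟨R τ, by simp⟩

theorem continuous_sphereMap (R : E3 ≃ₗᵢ[ℝ] E3) : Continuous (sphereMap R) :=
  (R.continuous.comp continuous_subtype_val).subtype_mk _

open scoped Pointwise in
theorem measurePreserving_sphereMap (R : E3 ≃ₗᵢ[ℝ] E3) :
    MeasurePreserving (sphereMap R) sphereMeasure sphereMeasure := by
  refine ⟨(continuous_sphereMap R).measurable, ?_⟩
  ext t ht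
  rw [Measure.map_apply (continuous_sphereMap R).measurable ht, sphereMeasure,
    Measure.toSphere_apply' _ ht,
    Measure.toSphere_apply' _ ((continuous_sphereMap R).measurable ht)]
  congr 1
  have h1 : Set.Ioo (0 : ℝ) 1 • ((↑) '' (sphereMap R ⁻¹' t) : Set E3) =
      R ⁻¹' (Set.Ioo (0 : ℝ) 1 • ((↑) '' t : Set E3)) := by
    ext x
    simp only [Set.mem_smul, Set.mem_image, Set.mem_preimage, Subtype.exists, exists_and_right,
      exists_eq_right]
    constructor
    · rintro ⟨r, hr, y, ⟨hy, hyt⟩, rfl⟩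
      exact ⟨r, hr, R y, ⟨by simpa using hy, hyt⟩, by simp⟩
    · rintro ⟨r, hr, y, ⟨hy, hyt⟩, hx⟩
      refine ⟨r, hr, R.symm y, ⟨by simpa using hy, ?_⟩, ?_⟩
      · simpa [sphereMap] using hyt
      · apply R.injective
        simp [hx]
  rw [h1]
  exact R.measurePreserving.measure_preimage_emb R.toHomeomorph.measurableEmbedding _

/-- The generator of the rotations of `ℝ³` in the coordinate plane `(i, j)`. -/
noncomputable def rotGen (i j : Fin 3) (x : E3) : E3 :=
  x i • EuclideanSpace.single j 1 - x j • EuclideanSpace.single i 1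

/-- The rotation of `ℝ³` by the angle `t` in the coordinate plane `(i, j)`, as a linear map. -/
noncomputable def rotLin (i j : Fin 3) (t : ℝ) : E3 →ₗ[ℝ] E3 where
  toFun x := x + ((Real.cos t - 1) * x i - Real.sin t * x j) • EuclideanSpace.single i (1 : ℝ) +
    ((Real.cos t - 1) * x j + Real.sin t * x i) • EuclideanSpace.single j (1 : ℝ)
  map_add' x y := by
    ext l
    simp only [PiLp.add_apply, PiLp.smul_apply, smul_eq_mul]
    ring
  map_smul' c x := by
    ext l
    simp only [PiLp.add_apply, PiLp.smul_apply, smul_eq_mul, RingHom.id_apply]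
    ring

theorem norm_rotLin {i j : Fin 3} (hij : i ≠ j) (t : ℝ) (x : E3) : ‖rotLin i j t x‖ = ‖x‖ := by
  rw [← sq_eq_sq₀ (norm_nonneg _) (norm_nonneg _), EuclideanSpace.norm_sq_eq,
    EuclideanSpace.norm_sq_eq]
  simp only [Real.norm_eq_abs, sq_abs, Fin.sum_univ_three]
  have h := Real.sin_sq_add_cos_sq t
  fin_cases i <;> fin_cases j <;> simp_all [rotLin] <;>
    · rw [← sub_eq_zero]
      ring_nf
      rw [Real.sin_sq]
      ring

/-- The rotation of `ℝ³` by the angle `t` in the coordinate plane `(i, j)`. -/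
noncomputable def rot {i j : Fin 3} (hij : i ≠ j) (t : ℝ) : E3 ≃ₗᵢ[ℝ] E3 :=
  LinearIsometry.toLinearIsometryEquiv ⟨rotLin i j t, norm_rotLin hij t⟩ rfl

theorem hasDerivAt_rot {i j : Fin 3} (hij : i ≠ j) (t : ℝ) (x : E3) :
    HasDerivAt (fun t => rot hij t x)
      ((-Real.sin t * x i - Real.cos t * x j) • EuclideanSpace.single i (1 : ℝ) +
        (-Real.sin t * x j + Real.cos t * x i) • EuclideanSpace.single j (1 : ℝ)) t := by
  have hc := (Real.hasDerivAt_cos t).sub_const 1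
  have hs := Real.hasDerivAt_sin t
  have := ((((hc.mul_const (x i)).sub (hs.mul_const (x j))).smul_const
    (EuclideanSpace.single i (1 : ℝ) : E3)).const_add x).add
    (((hc.mul_const (x j)).add (hs.mul_const (x i))).smul_const
      (EuclideanSpace.single j (1 : ℝ) : E3))
  exact this

/-- The field `rotGen` is divergence free on the sphere: the surface measure is invariant under the
rotations it generates, so the integral of `F` along the flow has derivative zero. -/
theorem integral_rotGen {i j : Fin 3} (hij : i ≠ j) {F : E3 → ℂ} (hF : ContDiff ℝ 1 F) :
    ∫ τ : Metric.sphere (0 : E3) 1, fderiv ℝ F τ (rotGen i j τ) ∂sphereMeasure = 0 := by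
  have hF' : Continuous (fderiv ℝ F) := hF.continuous_fderiv one_ne_zero
  obtain ⟨C, hC⟩ : ∃ C, ∀ x ∈ Metric.sphere (0 : E3) 1, ‖fderiv ℝ F x‖ ≤ C :=
    (isCompact_sphere _ _).exists_bound_of_continuousOn hF'.continuousOn
  -- The velocity of the rotation: `V t x = (d/dt) (rot t x)`, and `V 0 x = rotGen i j x`.
  let V : ℝ → E3 → E3 := fun t x =>
    (-Real.sin t * x i - Real.cos t * x j) • EuclideanSpace.single i (1 : ℝ) +
        (-Real.sin t * x j + Real.cos t * x i) • EuclideanSpace.single j (1 : ℝ)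
  have hV : ∀ t x, x ∈ Metric.sphere (0 : E3) 1 → ‖V t x‖ ≤ 4 := by
    intro t x hx
    have h1 : ∀ l, |x l| ≤ 1 := fun l => by
      simpa using (PiLp.norm_apply_le x l).trans_eq (by simpa using hx)
    have hs := Real.abs_sin_le_one t
    have hc := Real.abs_cos_le_one t
    have hm : ∀ a b : ℝ, |a| ≤ 1 → |b| ≤ 1 → |a * b| ≤ 1 := fun a b ha hb => by
      rw [abs_mul]; exact mul_le_one₀ ha (abs_nonneg _) hb
    have hA : |-Real.sin t * x i - Real.cos t * x j| ≤ 2 := by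
      refine (abs_sub _ _).trans ?_
      have := hm _ _ (by rwa [abs_neg] : |-Real.sin t| ≤ 1) (h1 i)
      have := hm _ _ hc (h1 j)
      linarith
    have hB : |-Real.sin t * x j + Real.cos t * x i| ≤ 2 := by
      refine (abs_add_le _ _).trans ?_
      have := hm _ _ (by rwa [abs_neg] : |-Real.sin t| ≤ 1) (h1 j)
      have := hm _ _ hc (h1 i)
      linarith
    refine (norm_add_le _ _).trans ?_
    rw [norm_smul, norm_smul]
    simp only [PiLp.norm_single, Real.norm_eq_abs, norm_one, mul_one]
    linarith
  have hd := hasDerivAt_integral_of_dominated_loc_of_deriv_le (μ := sphereMeasure)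
    (F := fun t τ => F (rot hij t τ)) (F' := fun t τ => fderiv ℝ F (rot hij t τ) (V t τ))
    (x₀ := (0 : ℝ)) (s := Set.univ) (bound := fun _ => C * 4) univ_mem
    (Eventually.of_forall fun t => (hF.continuous.comp ((rot hij t).continuous.comp
      continuous_subtype_val)).aestronglyMeasurable)
    ((hF.continuous.comp ((rot hij 0).continuous.comp
      continuous_subtype_val)).integrable_of_hasCompactSupport (HasCompactSupport.of_compactSpace _))
    (Continuous.aestronglyMeasurable <| (hF'.comp ((rot hij 0).continuous.comp
      continuous_subtype_val)).clm_apply (by fun_prop))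
    (Eventually.of_forall fun τ t _ => by
      refine (ContinuousLinearMap.le_opNorm _ _).trans ?_
      have h0 : rot hij t τ ∈ Metric.sphere (0 : E3) 1 := by simp
      exact mul_le_mul (hC _ h0) (hV t τ τ.2) (norm_nonneg _) ((norm_nonneg _).trans (hC _ h0)))
    (integrable_const _)
    (Eventually.of_forall fun τ t _ =>
      ((hF.differentiable one_ne_zero _).hasFDerivAt).comp_hasDerivAt t (hasDerivAt_rot hij t τ))
  have hconst : (fun t => ∫ τ : Metric.sphere (0 : E3) 1, F (rot hij t τ) ∂sphereMeasure) =
      fun _ => ∫ τ : Metric.sphere (0 : E3) 1, F τ ∂sphereMeasure := by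
    ext t
    exact (measurePreserving_sphereMap (rot hij t)).integral_comp'
      (f := ⟨⟨sphereMap (rot hij t), sphereMap (rot hij t).symm,
        fun x => by simp [sphereMap], fun x => by simp [sphereMap]⟩,
        (continuous_sphereMap _).measurable, (continuous_sphereMap _).measurable⟩)
      (fun τ => F τ)
  have h1 := hd.2
  rw [hconst] at h1
  have h2 := h1.unique (hasDerivAt_const (0 : ℝ) _)
  have h3 : ∀ x, rot hij 0 x = x := fun x => by
    change rotLin i j 0 x = x
    simp [rotLin]
  simp only [h3] at h2
  rw [← h2]
  refine integral_congr_ae (Eventually.of_forall fun τ => ?_)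
  simp only [V, rotGen, Real.sin_zero, Real.cos_zero]
  congr 1
  module

theorem sphere_sum_sq (τ : Metric.sphere (0 : E3) 1) :
    (τ : E3) 0 ^ 2 + (τ : E3) 1 ^ 2 + (τ : E3) 2 ^ 2 = 1 := by
  have h := EuclideanSpace.norm_sq_eq (τ : E3)
  simpa [Fin.sum_univ_three] using h.symm

/-- The divergence theorem on the sphere for the tangential part `s - (τ·s) τ` of a constant
field `s`, whose divergence is `-2 τ·s`. -/
theorem integral_sphere_tangential {F : E3 → ℂ} (hF : ContDiff ℝ 1 F) (s : E3) :
    ∫ τ : Metric.sphere (0 : E3) 1, (fderiv ℝ F τ (s - ⟪(τ : E3), s⟫_ℝ • (τ : E3)) -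
      2 * (⟪(τ : E3), s⟫_ℝ : ℂ) * F τ) ∂sphereMeasure = 0 := by
  have hF' : Continuous (fderiv ℝ F) := hF.continuous_fderiv one_ne_zero
  -- On the sphere `s - (τ·s) τ = ∑_{i<j} c i j τ • rotGen i j τ`, where the `c i j` are
  -- linear forms.
  let c : Fin 3 → Fin 3 → E3 →L[ℝ] ℝ := fun i j =>
    s j • EuclideanSpace.proj i - s i • EuclideanSpace.proj j
  have hc : ∀ i j x, c i j x = s j * x i - s i * x j := fun i j x => by simp [c]
  have key : ∀ i j : Fin 3, i ≠ j → Integrable (fun τ : Metric.sphere (0 : E3) 1 =>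
      ((c i j τ : ℝ) : ℂ) * fderiv ℝ F τ (rotGen i j τ) +
        (c i j (rotGen i j τ) : ℂ) * F τ) sphereMeasure ∧
      ∫ τ : Metric.sphere (0 : E3) 1, (((c i j τ : ℝ) : ℂ) * fderiv ℝ F τ (rotGen i j τ) +
        (c i j (rotGen i j τ) : ℂ) * F τ) ∂sphereMeasure = 0 := by
    intro i j hij
    constructor
    · refine Continuous.integrable_of_hasCompactSupport ?_ (HasCompactSupport.of_compactSpace _)
      have h1 : Continuous fun τ : Metric.sphere (0 : E3) 1 => rotGen i j τ := by
        unfold rotGen; fun_prop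
      have h2 := (hF'.comp continuous_subtype_val).clm_apply h1
      have h3 : Continuous fun τ : Metric.sphere (0 : E3) 1 => F τ :=
        hF.continuous.comp continuous_subtype_val
      fun_prop
    · have hG : ContDiff ℝ 1 fun x => ((c i j x : ℝ) : ℂ) * F x :=
        (ofRealCLM.contDiff.comp (c i j).contDiff).mul hF
      rw [← integral_rotGen hij hG]
      refine integral_congr_ae (Eventually.of_forall fun τ => ?_)
      have h1 : HasFDerivAt (fun x => ((c i j x : ℝ) : ℂ)) (ofRealCLM.comp (c i j)) (τ : E3) :=
        (ofRealCLM.comp (c i j)).hasFDerivAt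
      have h2 : HasFDerivAt (fun x => ((c i j x : ℝ) : ℂ) * F x) _ (τ : E3) :=
        h1.mul (hF.differentiable one_ne_zero (τ : E3)).hasFDerivAt
      dsimp only
      rw [h2.fderiv]
      simp
      ring
  have h01 := key 0 1 (by decide)
  have h02 := key 0 2 (by decide)
  have h12 := key 1 2 (by decide)
  have hsum := integral_add (h01.1.add h02.1) h12.1
  rw [h12.2, add_zero] at hsum
  simp only [Pi.add_apply] at hsum
  rw [integral_add h01.1 h02.1, h01.2, h02.2, add_zero] at hsum
  rw [← hsum]
  refine integral_congr_ae (Eventually.of_forall fun τ => ?_)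
  have hτ := sphere_sum_sq τ
  have hin : ⟪(τ : E3), s⟫_ℝ = (τ : E3) 0 * s 0 + (τ : E3) 1 * s 1 + (τ : E3) 2 * s 2 := by
    simp [PiLp.inner_apply, Fin.sum_univ_three, mul_comm]
  have hvec : s - ⟪(τ : E3), s⟫_ℝ • (τ : E3) = c 0 1 τ • rotGen 0 1 τ + c 0 2 τ • rotGen 0 2 τ +
      c 1 2 τ • rotGen 1 2 τ := by
    rw [hin]
    simp only [hc]
    ext l
    fin_cases l
    · simp [rotGen]
      linear_combination (-s 0) * hτ
    · simp [rotGen]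
      linear_combination (-s 1) * hτ
    · simp [rotGen]
      linear_combination (-s 2) * hτ
  simp only
  rw [hvec, hin]
  simp only [map_add, map_smul, hc, rotGen]
  simp
  ring

end QHeis

namespace QHeis

/-! ### Superpositions of plane waves over the sphere -/

/-- The open half space `a > 0` in the variables `(a, s) ∈ ℝ × ℝ³`. -/
def upper : Set (ℝ × E3) := {p | 0 < p.1}

theorem mem_upper {p : ℝ × E3} : p ∈ upper ↔ 0 < p.1 := Iff.rfl

theorem isOpen_upper : IsOpen upper := isOpen_lt continuous_const continuous_fst

/-- The phase `a - i τ·s`. -/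
noncomputable def phase (p : ℝ × E3) (τ : E3) : ℂ := (p.1 : ℂ) - I * ((⟪τ, p.2⟫_ℝ : ℝ) : ℂ)

theorem phase_re (p : ℝ × E3) (τ : E3) : (phase p τ).re = p.1 := by simp [phase]

theorem phase_mem {p : ℝ × E3} (hp : p ∈ upper) (τ : E3) : phase p τ ∈ {z : ℂ | 0 < z.re} := by
  change 0 < (phase p τ).re
  rwa [phase_re]

theorem phase_ne_zero {p : ℝ × E3} (hp : p ∈ upper) (τ : E3) : phase p τ ≠ 0 := fun h => by
  have := phase_re p τ
  rw [h] at this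
  exact (ne_of_gt hp) this.symm

theorem le_norm_phase (p : ℝ × E3) (τ : E3) : p.1 ≤ ‖phase p τ‖ :=
  (phase_re p τ).symm.le.trans (re_le_norm _)

@[fun_prop]
theorem contDiff_phase {E : Type*} [NormedAddCommGroup E] [NormedSpace ℝ E] {n : WithTop ℕ∞}
    {f : E → ℝ × E3} {g : E → E3} (hf : ContDiff ℝ n f) (hg : ContDiff ℝ n g) :
    ContDiff ℝ n fun x => phase (f x) (g x) := by
  unfold phase
  exact (ofRealCLM.contDiff.comp hf.fst).sub
    (contDiff_const.mul (ofRealCLM.contDiff.comp (hg.inner ℝ hf.snd)))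

@[fun_prop]
theorem continuous_phase {E : Type*} [TopologicalSpace E]
    {f : E → ℝ × E3} {g : E → E3} (hf : Continuous f) (hg : Continuous g) :
    Continuous fun x => phase (f x) (g x) := by
  unfold phase
  fun_prop

/-- The superposition `∫ Q(τ) G(a - i τ·s) dτ` of plane waves with profile `G` and density `Q`. -/
noncomputable def sphInt (G : ℂ → ℂ) (Q : E3 → ℂ) (p : ℝ × E3) : ℂ :=
  ∫ τ : Metric.sphere (0 : E3) 1, Q τ * G (phase p τ) ∂sphereMeasure

theorem integrable_sphere {F : Type*} [NormedAddCommGroup F] {f : Metric.sphere (0 : E3) 1 → F}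
    (hf : Continuous f) : Integrable f sphereMeasure :=
  hf.integrable_of_hasCompactSupport (HasCompactSupport.of_compactSpace _)

theorem continuous_comp_phase {G : ℂ → ℂ} (hG : ContinuousOn G {z | 0 < z.re}) {p : ℝ × E3}
    (hp : p ∈ upper) : Continuous fun τ : Metric.sphere (0 : E3) 1 => G (phase p τ) :=
  hG.comp_continuous (by fun_prop) fun τ => phase_mem hp τ

theorem integrable_sphInt {G : ℂ → ℂ} (hG : ContinuousOn G {z | 0 < z.re}) {Q : E3 → ℂ}
    (hQ : Continuous Q) {p : ℝ × E3} (hp : p ∈ upper) :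
    Integrable (fun τ : Metric.sphere (0 : E3) 1 => Q τ * G (phase p τ)) sphereMeasure :=
  integrable_sphere ((hQ.comp continuous_subtype_val).mul (continuous_comp_phase hG hp))

theorem sphInt_congr {G G' : ℂ → ℂ} (h : ∀ z : ℂ, 0 < z.re → G z = G' z) {Q Q' : E3 → ℂ}
    (hQ : ∀ τ : Metric.sphere (0 : E3) 1, Q τ = Q' τ) {p : ℝ × E3} (hp : p ∈ upper) :
    sphInt G Q p = sphInt G' Q' p := by
  unfold sphInt
  congr 1
  ext τ
  rw [h _ (by rw [phase_re]; exact hp), hQ]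

/-- The density `(∂_j Q)^{tan} - 2 τ_j Q` produced by integration by parts on the sphere. -/
noncomputable def tanDiv (j : Fin 3) (Q : E3 → ℂ) (x : E3) : ℂ :=
  fderiv ℝ Q x (EuclideanSpace.single j 1 - x j • x) - 2 * (x j : ℂ) * Q x

theorem contDiff_tanDiv (j : Fin 3) {Q : E3 → ℂ} (hQ : ContDiff ℝ ∞ Q) :
    ContDiff ℝ ∞ (tanDiv j Q) := by
  have h1 : ContDiff ℝ ∞ (fderiv ℝ Q) := hQ.fderiv_right (m := ∞) (by simp)
  have h2 : ContDiff ℝ ∞ fun x : E3 => (x j : ℝ) := contDiff_piLp_apply 2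
  exact (h1.clm_apply (contDiff_const.sub (h2.smul contDiff_id))).sub
    ((contDiff_const.mul (ofRealCLM.contDiff.comp h2)).mul hQ)

theorem inner_eq_sum (x s : E3) : ⟪x, s⟫_ℝ = ∑ j, s j * x j := by
  simp [PiLp.inner_apply]

/-- Integration by parts on the sphere for plane wave superpositions: it expresses the
superposition with profile `G'`, whose singularity is stronger than that of `G`, through less
singular ones; the coefficient `‖s‖² + a²` vanishes only at the origin. -/
theorem sphInt_deriv {G : ℂ → ℂ} (hG : DifferentiableOn ℂ G {z | 0 < z.re}) {Q : E3 → ℂ}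
    (hQ : ContDiff ℝ ∞ Q) {p : ℝ × E3} (hp : p ∈ upper) :
    ((‖p.2‖ ^ 2 + p.1 ^ 2 : ℝ) : ℂ) * sphInt (deriv G) Q p =
      2 * p.1 * sphInt (fun z => z * deriv G z) Q p - sphInt (fun z => z ^ 2 * deriv G z) Q p
        - I * ∑ j, (p.2 j : ℂ) * sphInt G (tanDiv j Q) p := by
  have ho : IsOpen {z : ℂ | 0 < z.re} := isOpen_lt continuous_const continuous_re
  have hG' : ContinuousOn (deriv G) {z | 0 < z.re} := (hG.deriv ho).continuousOn
  have hre : ∀ τ, phase p τ ∈ {z : ℂ | 0 < z.re} := phase_mem hp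
  have hF : ContDiff ℝ 1 fun x => Q x * G (phase p x) := by
    refine (hQ.of_le (by simp)).mul ?_
    have h1 : ContDiffOn ℝ 1 G {z | 0 < z.re} := (hG.contDiffOn ho).restrict_scalars ℝ
    exact h1.comp_contDiff (by fun_prop) hre
  have key := integral_sphere_tangential hF p.2
  have i1 := (integrable_sphInt hG' hQ.continuous hp).const_mul ((‖p.2‖ ^ 2 + p.1 ^ 2 : ℝ) : ℂ)
  have i2 := (integrable_sphInt (G := fun z => z * deriv G z) (continuousOn_id.mul hG')
    hQ.continuous hp).const_mul (2 * (p.1 : ℂ))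
  have i3 := integrable_sphInt (G := fun z => z ^ 2 * deriv G z)
    ((continuousOn_id.pow 2).mul hG') hQ.continuous hp
  have i4 := fun j => (integrable_sphInt hG.continuousOn (contDiff_tanDiv j hQ).continuous
    hp).const_mul (p.2 j : ℂ)
  have i4' := (integrable_finsetSum Finset.univ fun j _ => i4 j).const_mul I
  unfold sphInt
  rw [← integral_const_mul, ← integral_const_mul]
  simp_rw [← integral_const_mul]
  rw [← integral_finsetSum _ fun j _ => i4 j, ← integral_const_mul]
  have e1 := integral_sub (i2.sub i3) i4'
  have e2 := integral_sub i1 ((i2.sub i3).sub i4')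
  simp only [Pi.sub_apply] at e1 e2
  rw [← integral_sub i2 i3, ← e1, ← sub_eq_zero, ← e2,
    ← mul_right_inj' (neg_ne_zero.2 I_ne_zero), mul_zero, ← key, ← integral_const_mul]
  refine integral_congr_ae (Eventually.of_forall fun τ => ?_)
  have hX : HasFDerivAt (fun x => phase p x) (-(I • ofRealCLM.comp (innerSL ℝ p.2))) (τ : E3) := by
    have h1 : HasFDerivAt (fun x : E3 => ((⟪x, p.2⟫_ℝ : ℝ) : ℂ)) (ofRealCLM.comp (innerSL ℝ p.2))
        (τ : E3) := by
      have : (fun x : E3 => ((⟪x, p.2⟫_ℝ : ℝ) : ℂ)) = ofRealCLM.comp (innerSL ℝ p.2) := by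
        ext x; simp [real_inner_comm]
      rw [this]
      exact ContinuousLinearMap.hasFDerivAt _
    have := (h1.const_mul I).const_sub (p.1 : ℂ)
    exact this
  have hGX := ((hG.differentiableAt (ho.mem_nhds (hre τ))).hasDerivAt).comp_hasFDerivAt (τ : E3) hX
  have hQx := (hQ.differentiable (by simp) (τ : E3)).hasFDerivAt
  have hm : HasFDerivAt (fun x => Q x * G (phase p x)) _ (τ : E3) := hQx.mul hGX
  have hss : ⟪p.2, p.2⟫_ℝ = ‖p.2‖ ^ 2 := real_inner_self_eq_norm_sq _
  have hph : I * ((⟪(τ : E3), p.2⟫_ℝ : ℝ) : ℂ) = p.1 - phase p τ := by simp [phase]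
  have hsum : ∑ j, (p.2 j : ℂ) * (tanDiv j Q τ * G (phase p τ)) =
      (fderiv ℝ Q τ (p.2 - ⟪(τ : E3), p.2⟫_ℝ • (τ : E3)) -
        2 * (⟪(τ : E3), p.2⟫_ℝ : ℂ) * Q τ) * G (phase p τ) := by
    have hv : p.2 = ∑ j, p.2 j • (EuclideanSpace.single j 1 : E3) := by
      ext l; fin_cases l <;> simp [Fin.sum_univ_three]
    have hin : ⟪(τ : E3), p.2⟫_ℝ = ∑ j, p.2 j * (τ : E3) j := inner_eq_sum _ _
    have hv' : p.2 - ⟪(τ : E3), p.2⟫_ℝ • (τ : E3) =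
        ∑ j, p.2 j • (EuclideanSpace.single j 1 - (τ : E3) j • (τ : E3)) := by
      rw [hin]
      conv_lhs => rw [hv]
      simp only [Fin.sum_univ_three, PiLp.add_apply, PiLp.smul_apply]
      simp
      module
    rw [hv', hin, map_sum]
    simp only [map_smul, tanDiv, Fin.sum_univ_three]
    push_cast
    simp only [real_smul]
    ring
  dsimp only
  rw [hsum, hm.fderiv]
  have hw : ⟪p.2, p.2 - ⟪(τ : E3), p.2⟫_ℝ • (τ : E3)⟫_ℝ = ‖p.2‖ ^ 2 - ⟪(τ : E3), p.2⟫_ℝ ^ 2 := by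
    rw [inner_sub_right, inner_smul_right, hss, real_inner_comm p.2 (τ : E3)]
    ring
  simp only [add_apply, smul_apply, neg_apply, ContinuousLinearMap.comp_apply,
    innerSL_apply_apply, ofRealCLM_apply, smul_eq_mul, hw]
  generalize fderiv ℝ Q τ _ = d
  push_cast
  have hu : ((⟪(τ : E3), p.2⟫_ℝ : ℝ) : ℂ) = I * (phase p τ - p.1) := by
    linear_combination (-I) * hph + ((⟪(τ : E3), p.2⟫_ℝ : ℝ) : ℂ) * I_mul_I
  simp only [hu, mul_pow, I_sq]
  linear_combination (-(d - 2 * (I * (phase p τ - p.1)) * Q τ) * G (phase p τ)) * I_mul_I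

end QHeis

namespace QHeis

/-! ### Boundary values of plane wave superpositions -/

/-- The closed half space `a ≥ 0` without the origin. -/
def bdUpper : Set (ℝ × E3) := {p | 0 ≤ p.1 ∧ p ≠ 0}

theorem mem_bdUpper {p : ℝ × E3} : p ∈ bdUpper ↔ 0 ≤ p.1 ∧ p ≠ 0 := Iff.rfl

theorem upper_subset_bdUpper : upper ⊆ bdUpper := fun p hp => by
  rw [mem_upper] at hp
  refine mem_bdUpper.2 ⟨hp.le, fun h => ?_⟩
  simp [h] at hp

theorem closure_upper : closure upper = {p : ℝ × E3 | 0 ≤ p.1} := by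
  have : upper = Prod.fst ⁻¹' Set.Ioi (0 : ℝ) := rfl
  rw [this, ← isOpenMap_fst.preimage_closure_eq_closure_preimage continuous_fst, closure_Ioi]
  rfl

theorem bdUpper_subset_closure : bdUpper ⊆ closure upper := fun p hp => by
  rw [closure_upper]; exact hp.1

/-- All superpositions with profile `G` and a smooth density have limits at the points of the closed
half space other than the origin. The content lies in the boundary points `(0, s)`, `s ≠ 0`, where
the phase vanishes on a great circle. -/
def HasBoundaryLimits (G : ℂ → ℂ) : Prop :=
  ∀ Q : E3 → ℂ, ContDiff ℝ ∞ Q → ∀ x ∈ bdUpper, ∃ y, Tendsto (sphInt G Q) (𝓝[upper] x) (𝓝 y)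

theorem HasBoundaryLimits.congr {G G' : ℂ → ℂ} (h : HasBoundaryLimits G)
    (hG : ∀ z : ℂ, 0 < z.re → G z = G' z) : HasBoundaryLimits G' := fun Q hQ x hx => by
  obtain ⟨y, hy⟩ := h Q hQ x hx
  refine ⟨y, hy.congr' ?_⟩
  filter_upwards [self_mem_nhdsWithin] with p hp
  exact sphInt_congr hG (fun _ => rfl) hp

theorem HasBoundaryLimits.const_mul {G : ℂ → ℂ} (h : HasBoundaryLimits G) (c : ℂ) :
    HasBoundaryLimits fun z => c * G z := fun Q hQ x hx => by
  obtain ⟨y, hy⟩ := h Q hQ x hx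
  refine ⟨c * y, (hy.const_mul c).congr fun p => ?_⟩
  unfold sphInt
  rw [← integral_const_mul]
  congr 1
  ext τ
  ring

theorem hasBoundaryLimits_of_continuous {G : ℂ → ℂ} (hG : Continuous G) : HasBoundaryLimits G := by
  intro Q hQ x _
  have h1 : Continuous (sphInt G Q) := by
    have := continuous_parametric_integral_of_continuous (μ := sphereMeasure)
      (f := fun (p : ℝ × E3) (τ : Metric.sphere (0 : E3) 1) => Q τ * G (phase p τ))
      (by
        have h1 : Continuous fun q : (ℝ × E3) × Metric.sphere (0 : E3) 1 => Q q.2 :=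
          hQ.continuous.comp (by fun_prop)
        have h2 : Continuous fun q : (ℝ × E3) × Metric.sphere (0 : E3) 1 => G (phase q.1 q.2) :=
          hG.comp (by fun_prop)
        exact h1.mul h2) isCompact_univ
    simp only [Measure.restrict_univ] at this
    exact this
  exact ⟨_, h1.continuousWithinAt⟩

/-- The step that lowers the regularity of the profile: by `sphInt_deriv` the superpositions with
profile `G'` are combinations of those with the profiles `G`, `z G'` and `z² G'`. -/
theorem HasBoundaryLimits.deriv_profile {G : ℂ → ℂ} (hG : DifferentiableOn ℂ G {z | 0 < z.re})
    (h0 : HasBoundaryLimits G) (h1 : HasBoundaryLimits fun z => z * deriv G z)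
    (h2 : HasBoundaryLimits fun z => z ^ 2 * deriv G z) : HasBoundaryLimits (deriv G) := by
  intro Q hQ x hx
  obtain ⟨y1, hy1⟩ := h1 Q hQ x hx
  obtain ⟨y2, hy2⟩ := h2 Q hQ x hx
  choose y0 hy0 using fun j => h0 _ (contDiff_tanDiv j hQ) x hx
  have hden : ((‖x.2‖ ^ 2 + x.1 ^ 2 : ℝ) : ℂ) ≠ 0 := by
    rw [ofReal_ne_zero]
    intro h
    refine hx.2 (Prod.ext ?_ ?_)
    · exact pow_eq_zero_iff two_ne_zero |>.1 (by nlinarith [sq_nonneg x.1, sq_nonneg ‖x.2‖])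
    · exact norm_eq_zero.1
        (pow_eq_zero_iff two_ne_zero |>.1 (by nlinarith [sq_nonneg x.1, sq_nonneg ‖x.2‖]))
  have c1 : Tendsto (fun p : ℝ × E3 => ((‖p.2‖ ^ 2 + p.1 ^ 2 : ℝ) : ℂ)) (𝓝[upper] x)
      (𝓝 ((‖x.2‖ ^ 2 + x.1 ^ 2 : ℝ) : ℂ)) :=
    (Continuous.continuousWithinAt (by fun_prop))
  have c2 : Tendsto (fun p : ℝ × E3 => 2 * (p.1 : ℂ)) (𝓝[upper] x) (𝓝 (2 * (x.1 : ℂ))) :=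
    (Continuous.continuousWithinAt (by fun_prop))
  have c3 : ∀ j, Tendsto (fun p : ℝ × E3 => (p.2 j : ℂ)) (𝓝[upper] x) (𝓝 (x.2 j : ℂ)) :=
    fun j => (Continuous.continuousWithinAt (by fun_prop))
  have hnum := ((c2.mul hy1).sub hy2).sub
    ((tendsto_finsetSum Finset.univ fun j _ => (c3 j).mul (hy0 j)).const_mul I)
  refine ⟨_, (hnum.div c1 hden).congr' ?_⟩
  filter_upwards [self_mem_nhdsWithin, c1.eventually_ne hden] with p hp hp'
  rw [Pi.div_apply, div_eq_iff hp', ← sphInt_deriv hG hQ hp, mul_comm]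

/-- The projection of `ℂ` to the closed right half plane. -/
noncomputable def toRight (z : ℂ) : ℂ := (max z.re 0 : ℝ) + z.im * I

theorem toRight_eq {z : ℂ} (hz : 0 < z.re) : toRight z = z := by
  rw [toRight, max_eq_left hz.le, re_add_im]

theorem continuous_toRight_mul_log : Continuous fun z => toRight z * log (toRight z) := by
  have h1 : Continuous toRight := by unfold toRight; fun_prop
  have hre : ∀ z, (toRight z).re = max z.re 0 := fun z => by simp [toRight]
  rw [continuous_iff_continuousAt]
  intro z
  by_cases hz : toRight z = 0
  · rw [ContinuousAt, hz, zero_mul]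
    have h2 : Tendsto toRight (𝓝 z) (𝓝 0) := by rw [← hz]; exact h1.continuousAt
    have h3 : Tendsto (fun w : ℂ => ‖w‖ * (|Real.log ‖w‖| + Real.pi)) (𝓝 0) (𝓝 0) := by
      have h4 : Continuous fun w : ℂ => |‖w‖ * Real.log ‖w‖| + ‖w‖ * Real.pi :=
        ((Real.continuous_mul_log.comp continuous_norm).abs).add (by fun_prop)
      have h5 := h4.tendsto 0
      simp only [norm_zero, zero_mul, abs_zero, add_zero] at h5
      refine h5.congr fun w => ?_
      rw [abs_mul, abs_norm]
      ring
    refine squeeze_zero_norm (fun w => ?_) (h3.comp h2)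
    rw [norm_mul]
    refine mul_le_mul_of_nonneg_left ?_ (norm_nonneg _)
    refine (norm_le_abs_re_add_abs_im _).trans ?_
    rw [log_re, log_im]
    exact add_le_add le_rfl (abs_arg_le_pi _)
  · refine h1.continuousAt.mul (h1.continuousAt.clog ?_)
    rw [mem_slitPlane_iff]
    rcases (le_max_right z.re 0).lt_or_eq with h | h
    · left; rw [hre]; exact h
    · right
      intro him
      exact hz (Complex.ext (by rw [hre, ← h]; rfl) him)

theorem re_pos_mem_slitPlane {z : ℂ} (hz : 0 < z.re) : z ∈ slitPlane := Or.inl hz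

/-- The logarithm is the derivative of `z log z - z`, which is continuous up to the boundary of the
right half plane. -/
theorem hasBoundaryLimits_log : HasBoundaryLimits log := by
  have hd : ∀ z : ℂ, 0 < z.re → HasDerivAt (fun z => z * log z - z) (log z) z := fun z hz => by
    have h1 := ((hasDerivAt_id z).mul (hasDerivAt_log (re_pos_mem_slitPlane hz))).sub
      (hasDerivAt_id z)
    have hz0 : z ≠ 0 := fun h => by simp [h] at hz
    convert! h1 using 1
    simp [hz0]
  have hd' : ∀ z : ℂ, 0 < z.re → log z = deriv (fun z => z * log z - z) z := fun z hz =>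
    (hd z hz).deriv.symm
  have h1 : Continuous toRight := by unfold toRight; fun_prop
  refine HasBoundaryLimits.congr (HasBoundaryLimits.deriv_profile
    (G := fun z => z * log z - z) ?_ ?_ ?_ ?_) fun z hz => (hd' z hz).symm
  · exact fun z hz => (hd z hz).differentiableAt.differentiableWithinAt
  · refine (hasBoundaryLimits_of_continuous (continuous_toRight_mul_log.sub h1)).congr fun z hz => ?_
    rw [Pi.sub_apply, toRight_eq hz]
  · refine (hasBoundaryLimits_of_continuous continuous_toRight_mul_log).congr fun z hz => ?_
    rw [toRight_eq hz, hd' z hz]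
  · refine (hasBoundaryLimits_of_continuous (h1.mul continuous_toRight_mul_log)).congr
      fun z hz => ?_
    rw [Pi.mul_apply, toRight_eq hz, hd' z hz]
    ring

theorem hasDerivAt_inv_pow (m : ℕ) {z : ℂ} (hz : z ≠ 0) :
    HasDerivAt (fun z : ℂ => (z ^ m)⁻¹) (-m * (z ^ (m + 1))⁻¹) z := by
  have h := (hasDerivAt_pow m z).inv (pow_ne_zero m hz)
  convert! h using 1
  rcases m with _ | m
  · simp
  · simp only [Nat.add_sub_cancel]
    field_simp
    ring

theorem re_pos_ne_zero {z : ℂ} (hz : 0 < z.re) : z ≠ 0 := fun h => by simp [h] at hz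

theorem differentiableOn_inv_pow (m : ℕ) :
    DifferentiableOn ℂ (fun z : ℂ => (z ^ m)⁻¹) {z | 0 < z.re} := fun _ hz =>
  (hasDerivAt_inv_pow m (re_pos_ne_zero hz)).differentiableAt.differentiableWithinAt

theorem deriv_inv_pow (m : ℕ) {z : ℂ} (hz : 0 < z.re) :
    deriv (fun z : ℂ => (z ^ m)⁻¹) z = -m * (z ^ (m + 1))⁻¹ :=
  (hasDerivAt_inv_pow m (re_pos_ne_zero hz)).deriv

/-- The negative powers are reached from the logarithm by repeated differentiation. -/
theorem hasBoundaryLimits_inv_pow (m : ℕ) : HasBoundaryLimits fun z => (z ^ m)⁻¹ := by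
  have h0 : HasBoundaryLimits fun z => (z ^ 0)⁻¹ := by
    simpa using hasBoundaryLimits_of_continuous (continuous_const (y := (1 : ℂ)))
  have h1 : HasBoundaryLimits fun z => (z ^ 1)⁻¹ := by
    refine HasBoundaryLimits.congr (HasBoundaryLimits.deriv_profile (G := log) ?_
      hasBoundaryLimits_log ?_ ?_) fun z hz => ?_
    · exact fun z hz => (differentiableAt_log (re_pos_mem_slitPlane hz)).differentiableWithinAt
    · refine (hasBoundaryLimits_of_continuous (continuous_const (y := (1 : ℂ)))).congr fun z hz => ?_
      rw [(hasDerivAt_log (re_pos_mem_slitPlane hz)).deriv, mul_inv_cancel₀ (re_pos_ne_zero hz)]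
    · refine (hasBoundaryLimits_of_continuous continuous_id).congr fun z hz => ?_
      have := re_pos_ne_zero hz
      rw [(hasDerivAt_log (re_pos_mem_slitPlane hz)).deriv, id]
      field_simp
    · rw [(hasDerivAt_log (re_pos_mem_slitPlane hz)).deriv, pow_one]
  suffices h : HasBoundaryLimits (fun z => (z ^ m)⁻¹) ∧ HasBoundaryLimits fun z => (z ^ (m + 1))⁻¹
    from h.1
  induction m with
  | zero => exact ⟨h0, h1⟩
  | succ m ih =>
    refine ⟨ih.2, ?_⟩
    have h2 := HasBoundaryLimits.deriv_profile (differentiableOn_inv_pow (m + 1)) ih.2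
      ((ih.2.const_mul (-((m + 1 : ℕ) : ℂ))).congr fun z hz => ?_)
      ((ih.1.const_mul (-((m + 1 : ℕ) : ℂ))).congr fun z hz => ?_)
    · refine (h2.const_mul (-((m + 1 : ℕ) : ℂ))⁻¹).congr fun z hz => ?_
      have hm : -((m + 1 : ℕ) : ℂ) ≠ 0 := neg_ne_zero.2 (Nat.cast_ne_zero.2 (by omega))
      rw [deriv_inv_pow _ hz, ← mul_assoc, inv_mul_cancel₀ hm, one_mul]
    · have := re_pos_ne_zero hz
      rw [deriv_inv_pow _ hz]
      field_simp
      ring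
    · have := re_pos_ne_zero hz
      rw [deriv_inv_pow _ hz]
      field_simp
      ring

/-- The superposition `∫ Q(τ) (a - i τ·s)⁻ᵐ dτ`, extended by continuity from `a > 0` to
`a ≥ 0`, `(a, s) ≠ (0, 0)`. -/
noncomputable def planeInt (m : ℕ) (Q : E3 → ℂ) : ℝ × E3 → ℂ :=
  extendFrom upper (sphInt (fun z => (z ^ m)⁻¹) Q)

theorem continuousOn_planeInt (m : ℕ) {Q : E3 → ℂ} (hQ : ContDiff ℝ ∞ Q) :
    ContinuousOn (planeInt m Q) bdUpper :=
  continuousOn_extendFrom bdUpper_subset_closure (hasBoundaryLimits_inv_pow m Q hQ)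

theorem continuousOn_sphInt {G : ℂ → ℂ} (hG : ContinuousOn G {z | 0 < z.re}) {Q : E3 → ℂ}
    (hQ : Continuous Q) : ContinuousOn (sphInt G Q) upper := by
  rw [continuousOn_iff_continuous_domRestrict]
  have : LocallyCompactSpace upper := isOpen_upper.locallyCompactSpace
  have := continuous_parametric_integral_of_continuous (μ := sphereMeasure)
    (f := fun (p : upper) (τ : Metric.sphere (0 : E3) 1) => Q τ * G (phase p τ))
    (by
      have h1 : Continuous fun q : upper × Metric.sphere (0 : E3) 1 => Q q.2 :=
        hQ.comp (by fun_prop)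
      have h2 : Continuous fun q : upper × Metric.sphere (0 : E3) 1 => G (phase q.1 q.2) :=
        hG.comp_continuous (by fun_prop) fun q => phase_mem q.1.2 _
      exact h1.mul h2) isCompact_univ
  simp only [Measure.restrict_univ] at this
  exact this

theorem planeInt_eq (m : ℕ) {Q : E3 → ℂ} (hQ : Continuous Q) {p : ℝ × E3} (hp : p ∈ upper) :
    planeInt m Q p =
      ∫ τ : Metric.sphere (0 : E3) 1, Q τ * (phase p τ ^ m)⁻¹ ∂sphereMeasure :=
  extendFrom_eq (subset_closure hp)
    (continuousOn_sphInt (differentiableOn_inv_pow m).continuousOn hQ p hp)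

/-- An identity between functions continuous on `bdUpper` extends from `upper`. -/
theorem eqOn_bdUpper {F : Type*} [TopologicalSpace F] [T2Space F] {f g : ℝ × E3 → F}
    (hf : ContinuousOn f bdUpper) (hg : ContinuousOn g bdUpper) (h : ∀ p ∈ upper, f p = g p) :
    ∀ p ∈ bdUpper, f p = g p := fun _ hp =>
  Set.EqOn.of_subset_closure (fun x hx => h x hx) hf hg upper_subset_bdUpper
    bdUpper_subset_closure hp

theorem planeInt_smul (m : ℕ) {Q : E3 → ℂ} (hQ : ContDiff ℝ ∞ Q) {t : ℝ} (ht : 0 < t)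
    {p : ℝ × E3} (hp : p ∈ bdUpper) :
    planeInt m Q (t • p) = ((t ^ m)⁻¹ : ℝ) * planeInt m Q p := by
  have hb : Set.MapsTo (fun p : ℝ × E3 => t • p) bdUpper bdUpper := fun _ hp =>
    mem_bdUpper.2 ⟨mul_nonneg ht.le hp.1, smul_ne_zero ht.ne' hp.2⟩
  refine eqOn_bdUpper (f := fun p => planeInt m Q (t • p))
    ((continuousOn_planeInt m hQ).comp (continuous_const_smul t).continuousOn hb)
    (g := fun p => ((t ^ m)⁻¹ : ℝ) * planeInt m Q p)
    (continuousOn_const.mul (continuousOn_planeInt m hQ)) (fun p hp => ?_) p hp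
  have htp : t • p ∈ upper := mem_upper.2 (mul_pos ht hp)
  rw [planeInt_eq m hQ.continuous hp, planeInt_eq m hQ.continuous htp, ← integral_const_mul]
  congr 1
  ext τ
  have : phase (t • p) τ = t * phase p τ := by
    simp [phase, inner_smul_right]
    ring
  rw [this, mul_pow, mul_inv]
  push_cast
  ring

/-- The bound follows from homogeneity and from continuity on the compact set `a + ‖s‖ = 1`, which
includes boundary points. -/
theorem planeInt_bound (m : ℕ) {Q : E3 → ℂ} (hQ : ContDiff ℝ ∞ Q) :
    ∃ C, 0 ≤ C ∧ ∀ p ∈ bdUpper, ‖planeInt m Q p‖ ≤ C * ((p.1 + ‖p.2‖) ^ m)⁻¹ := by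
  let K : Set (ℝ × E3) := {p | 0 ≤ p.1 ∧ p.1 + ‖p.2‖ = 1}
  have hK : IsCompact K := by
    refine Metric.isCompact_of_isClosed_isBounded ?_ ?_
    · exact (isClosed_le continuous_const continuous_fst).inter
        (isClosed_eq (by fun_prop) continuous_const)
    · refine (Metric.isBounded_closedBall (x := (0 : ℝ × E3)) (r := 1)).subset fun p hp => ?_
      have h1 : 0 ≤ p.1 := hp.1
      have h2 : p.1 + ‖p.2‖ = 1 := hp.2
      have h3 := norm_nonneg p.2
      rw [mem_closedBall_zero_iff, Prod.norm_def, Real.norm_eq_abs, abs_of_nonneg h1]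
      exact max_le (by linarith) (by linarith)
  have hKb : K ⊆ bdUpper := fun p hp => mem_bdUpper.2 ⟨hp.1, fun h => by
    have h2 : p.1 + ‖p.2‖ = 1 := hp.2
    simp [h] at h2⟩
  obtain ⟨C, hC⟩ := hK.exists_bound_of_continuousOn ((continuousOn_planeInt m hQ).mono hKb)
  refine ⟨max C 0, le_max_right _ _, fun p hp => ?_⟩
  have hr : 0 < p.1 + ‖p.2‖ := by
    rcases (add_nonneg hp.1 (norm_nonneg p.2)).lt_or_eq with h | h
    · exact h
    · have h1 := hp.1
      have h2 := norm_nonneg p.2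
      exact absurd (Prod.ext (by change p.1 = 0; linarith)
        (norm_eq_zero.1 (by linarith))) hp.2
  set r := p.1 + ‖p.2‖
  have hq : r⁻¹ • p ∈ K := by
    have hr' := inv_pos.2 hr
    refine ⟨mul_nonneg hr'.le hp.1, ?_⟩
    simp only [Prod.smul_fst, Prod.smul_snd, norm_smul, Real.norm_eq_abs, abs_of_pos hr',
      smul_eq_mul, ← mul_add]
    exact inv_mul_cancel₀ hr.ne'
  have h1 := planeInt_smul m hQ hr (hKb hq)
  rw [smul_inv_smul₀ hr.ne'] at h1
  rw [h1, norm_mul, mul_comm, norm_real, Real.norm_eq_abs, abs_of_pos (by positivity)]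
  gcongr
  exact (hC _ hq).trans (le_max_left _ _)

end QHeis

namespace QHeis

/-! ### Smoothness of plane wave superpositions -/

/-- The derivative of `planeInt m Q`; it is built from superpositions of the same kind. -/
noncomputable def planeDeriv (m : ℕ) (Q : E3 → ℂ) (p : ℝ × E3) : ℝ × E3 →L[ℝ] ℂ :=
  (-m * planeInt (m + 1) Q p) • ofRealCLM.comp (ContinuousLinearMap.fst ℝ ℝ E3) +
    ∑ j : Fin 3, (I * m * planeInt (m + 1) (fun τ => τ j * Q τ) p) •
      ofRealCLM.comp ((EuclideanSpace.proj j).comp (ContinuousLinearMap.snd ℝ ℝ E3))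

@[fun_prop]
theorem contDiff_coord_mul {n : WithTop ℕ∞} (j : Fin 3) {Q : E3 → ℂ} (hQ : ContDiff ℝ n Q) :
    ContDiff ℝ n fun τ : E3 => (τ j : ℂ) * Q τ :=
  (ofRealCLM.contDiff.comp (contDiff_piLp_apply 2)).mul hQ

theorem hasFDerivAt_planeInt (m : ℕ) {Q : E3 → ℂ} (hQ : ContDiff ℝ ∞ Q) {p : ℝ × E3}
    (hp : p ∈ upper) : HasFDerivAt (planeInt m Q) (planeDeriv m Q p) p := by
  -- `A τ` is the linear map `p ↦ phase p τ`.
  let A : E3 → ℝ × E3 →L[ℝ] ℂ := fun τ =>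
    ofRealCLM.comp (ContinuousLinearMap.fst ℝ ℝ E3) -
      I • ofRealCLM.comp ((innerSL ℝ τ).comp (ContinuousLinearMap.snd ℝ ℝ E3))
  have hA : Continuous A := by
    have h1 : Continuous fun τ : E3 => innerSL ℝ τ := (innerSL ℝ).continuous
    fun_prop
  have hphase : ∀ (τ : E3) (q : ℝ × E3), HasFDerivAt (fun q => phase q τ) (A τ) q := by
    intro τ q
    have : (fun q => phase q τ) = A τ := by
      ext q
      simp [phase, A]
    rw [this]
    exact (A τ).hasFDerivAt
  let F' : ℝ × E3 → E3 → ℝ × E3 →L[ℝ] ℂ := fun q τ =>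
    (Q τ * (-m * (phase q τ ^ (m + 1))⁻¹)) • A τ
  have hderiv : ∀ (τ : E3) (q : ℝ × E3), q ∈ upper →
      HasFDerivAt (fun q => Q τ * (phase q τ ^ m)⁻¹) (F' q τ) q := by
    intro τ q hq
    have h1 := (hasDerivAt_inv_pow m (phase_ne_zero hq τ)).comp_hasFDerivAt q (hphase τ q)
    have h2 := h1.const_mul (Q τ)
    rw [smul_smul] at h2
    exact h2
  have hF'c : ∀ q ∈ upper, Continuous fun τ : Metric.sphere (0 : E3) 1 => F' q τ := by
    intro q hq
    have h1 : Continuous fun τ : Metric.sphere (0 : E3) 1 => (phase q τ ^ (m + 1))⁻¹ :=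
      Continuous.inv₀ (by fun_prop) fun τ => pow_ne_zero _ (phase_ne_zero hq τ)
    have h2 : Continuous fun τ : Metric.sphere (0 : E3) 1 => Q τ :=
      hQ.continuous.comp continuous_subtype_val
    have h3 : Continuous fun τ : Metric.sphere (0 : E3) 1 => A τ := hA.comp continuous_subtype_val
    exact (h2.mul (continuous_const.mul h1)).smul h3
  obtain ⟨C, hC⟩ : ∃ C, ∀ x ∈ Metric.sphere (0 : E3) 1, ‖Q x‖ * ‖A x‖ ≤ C := by
    obtain ⟨C, hC⟩ := (isCompact_sphere (0 : E3) 1).exists_bound_of_continuousOn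
      (f := fun x => ‖Q x‖ * ‖A x‖)
      (hQ.continuous.norm.mul hA.norm).continuousOn
    exact ⟨C, fun x hx => (le_abs_self _).trans (hC x hx)⟩
  have hs : {q : ℝ × E3 | p.1 / 2 < q.1} ∈ 𝓝 p :=
    (isOpen_lt continuous_const continuous_fst).mem_nhds (half_lt_self (mem_upper.1 hp))
  have hsu : ∀ q ∈ {q : ℝ × E3 | p.1 / 2 < q.1}, q ∈ upper := fun q hq =>
    mem_upper.2 ((half_pos (mem_upper.1 hp)).trans hq)
  have hcont : ∀ q ∈ upper, Continuous fun τ : Metric.sphere (0 : E3) 1 =>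
      Q τ * (phase q τ ^ m)⁻¹ := fun q hq =>
    (hQ.continuous.comp continuous_subtype_val).mul
      (continuous_comp_phase (differentiableOn_inv_pow m).continuousOn hq)
  have key := hasFDerivAt_integral_of_dominated_of_fderiv_le (μ := sphereMeasure)
    (F := fun q (τ : Metric.sphere (0 : E3) 1) => Q τ * (phase q τ ^ m)⁻¹)
    (F' := fun q τ => F' q τ) (x₀ := p) (bound := fun _ => C * (m * ((p.1 / 2) ^ (m + 1))⁻¹)) hs
    (by
      filter_upwards [hs] with q hq
      exact (hcont q (hsu q hq)).aestronglyMeasurable)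
    (integrable_sphere (hcont p hp)) (hF'c p hp).aestronglyMeasurable
    (Eventually.of_forall fun τ q hq => by
      have h0 : 0 < p.1 / 2 := half_pos (mem_upper.1 hp)
      have h1 : (p.1 / 2) ^ (m + 1) ≤ ‖phase q τ‖ ^ (m + 1) :=
        pow_le_pow_left₀ h0.le ((le_of_lt hq).trans (le_norm_phase q τ)) _
      simp only [F', norm_smul, norm_mul, norm_neg, norm_natCast, norm_inv, norm_pow]
      calc ‖Q τ‖ * (m * (‖phase q τ‖ ^ (m + 1))⁻¹) * ‖A τ‖
          = ‖Q τ‖ * ‖A τ‖ * (m * (‖phase q τ‖ ^ (m + 1))⁻¹) := by ring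
        _ ≤ C * (m * ((p.1 / 2) ^ (m + 1))⁻¹) := by
          have := hC τ τ.2
          have h2 : 0 ≤ C := le_trans (by positivity) this
          gcongr)
    (integrable_const _)
    (Eventually.of_forall fun τ q hq => hderiv τ q (hsu q hq))
  have hint : ∫ τ : Metric.sphere (0 : E3) 1, F' p τ ∂sphereMeasure = planeDeriv m Q p := by
    refine ContinuousLinearMap.ext fun v => ?_
    rw [ContinuousLinearMap.integral_apply (integrable_sphere (hF'c p hp))]
    have i0 : Integrable (fun τ : Metric.sphere (0 : E3) 1 => Q τ * (phase p τ ^ (m + 1))⁻¹)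
      sphereMeasure := integrable_sphInt (differentiableOn_inv_pow (m + 1)).continuousOn
        hQ.continuous hp
    have i1 : ∀ j : Fin 3, Integrable (fun τ : Metric.sphere (0 : E3) 1 =>
        ((τ : E3) j * Q τ) * (phase p τ ^ (m + 1))⁻¹) sphereMeasure := fun j =>
      integrable_sphInt (Q := fun τ => τ j * Q τ) (differentiableOn_inv_pow (m + 1)).continuousOn
        (contDiff_coord_mul j hQ).continuous hp
    have e0 := integral_const_mul (μ := sphereMeasure) (-m * (v.1 : ℂ))
      (fun τ : Metric.sphere (0 : E3) 1 => Q τ * (phase p τ ^ (m + 1))⁻¹)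
    have e1 := fun j : Fin 3 => integral_const_mul (μ := sphereMeasure) (I * m * (v.2 j : ℂ))
      (fun τ : Metric.sphere (0 : E3) 1 => ((τ : E3) j * Q τ) * (phase p τ ^ (m + 1))⁻¹)
    have e2 := integral_finsetSum (μ := sphereMeasure) Finset.univ
      fun j _ => (i1 j).const_mul (I * m * (v.2 j : ℂ))
    have e3 := integral_add (i0.const_mul (-m * (v.1 : ℂ)))
      (integrable_finsetSum Finset.univ fun j _ => (i1 j).const_mul (I * m * (v.2 j : ℂ)))
    rw [e2, e0] at e3
    simp_rw [e1] at e3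
    have e4 : planeDeriv m Q p v = -m * (v.1 : ℂ) * planeInt (m + 1) Q p +
        ∑ j : Fin 3, I * m * (v.2 j : ℂ) * planeInt (m + 1) (fun τ => τ j * Q τ) p := by
      simp [planeDeriv, Fin.sum_univ_three]
      ring
    rw [e4, planeInt_eq _ hQ.continuous hp]
    simp_rw [fun j => planeInt_eq (m + 1) (contDiff_coord_mul j hQ).continuous hp]
    rw [← e3]
    refine integral_congr_ae (Eventually.of_forall fun τ => ?_)
    have hin : A τ v = v.1 - I * ∑ j, (v.2 j : ℂ) * (τ : E3) j := by
      simp [A, PiLp.inner_apply]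
    simp only [F', smul_apply, hin, smul_eq_mul, Fin.sum_univ_three]
    ring
  rw [← hint]
  refine key.congr_of_eventuallyEq ?_
  filter_upwards [isOpen_upper.mem_nhds hp] with q hq
  exact planeInt_eq m hQ.continuous hq

theorem contDiffOn_planeInt (m : ℕ) {Q : E3 → ℂ} (hQ : ContDiff ℝ ∞ Q) :
    ContDiffOn ℝ ∞ (planeInt m Q) upper := by
  rw [contDiffOn_infty]
  intro n
  induction n generalizing m Q with
  | zero =>
    exact contDiffOn_zero.2 ((continuousOn_planeInt m hQ).mono upper_subset_bdUpper)
  | succ n ih =>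
    rw [Nat.cast_add, Nat.cast_one, contDiffOn_succ_iff_fderiv_of_isOpen isOpen_upper]
    refine ⟨fun p hp => (hasFDerivAt_planeInt m hQ hp).differentiableAt.differentiableWithinAt,
      by simp, ?_⟩
    have h1 : ContDiffOn ℝ n (planeDeriv m Q) upper :=
      ((contDiffOn_const.mul (ih (m + 1) hQ)).smul contDiffOn_const).add
        (ContDiffOn.sum fun j _ =>
          (contDiffOn_const.mul (ih (m + 1) (contDiff_coord_mul j hQ))).smul contDiffOn_const)
    exact h1.congr fun p hp => (hasFDerivAt_planeInt m hQ hp).fderiv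

/-- A function on `H` that is continuous on an open set and continuously differentiable off the
centre `y = 0`, with a derivative that extends continuously across the centre, is differentiable
there too: the two half spaces `±y₀ > 0` are convex and their closures cover `H`. -/
theorem hasFDerivAt_of_off_centre {f : H → ℂ} {f' : H → H →L[ℝ] ℂ} {Ω : Set H} (hΩ : IsOpen Ω)
    (hf : ContinuousOn f Ω) (hf' : ContinuousOn f' Ω)
    (hd : ∀ h ∈ Ω, h.1 ≠ 0 → HasFDerivAt f (f' h) h) {x : H} (hx : x ∈ Ω) :
    HasFDerivAt f (f' x) x := by
  obtain ⟨δ, hδ, hball⟩ := Metric.nhds_basis_closedBall.mem_iff.1 (hΩ.mem_nhds hx)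
  let ℓ : H →L[ℝ] ℝ := (EuclideanSpace.proj (0 : Fin 4)).comp (ContinuousLinearMap.fst ℝ E4 E3)
  have hℓ : ∀ h, ℓ h ≠ 0 → h.1 ≠ 0 := fun h h1 h2 => h1 (by simp [ℓ, h2])
  have main : ∀ c : ℝ, c ≠ 0 → HasFDerivWithinAt f (f' x)
      (closure (Metric.ball x δ ∩ {h | 0 < c * ℓ h})) x := by
    intro c _
    have hsub : closure (Metric.ball x δ ∩ {h | 0 < c * ℓ h}) ⊆ Ω :=
      ((closure_mono Set.inter_subset_left).trans Metric.closure_ball_subset_closedBall).trans hball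
    have hd' : ∀ h ∈ Metric.ball x δ ∩ {h | 0 < c * ℓ h}, HasFDerivAt f (f' h) h := fun h hh =>
      hd h (hsub (subset_closure hh)) (hℓ h fun h0 => by
        have : 0 < c * ℓ h := hh.2
        rw [h0, mul_zero] at this
        exact lt_irrefl _ this)
    refine hasFDerivWithinAt_closure_of_tendsto_fderiv
      (fun h hh => (hd' h hh).differentiableAt.differentiableWithinAt) ?_ ?_ ?_ ?_
    · exact (convex_ball x δ).inter (convex_halfSpace_gt (c • ℓ).isLinear 0)
    · exact Metric.isOpen_ball.inter (isOpen_lt continuous_const (by fun_prop))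
    · exact fun y hy => (hf y (hsub hy)).mono (subset_closure.trans hsub)
    · refine ((hf' x hx).mono (subset_closure.trans hsub)).congr' ?_
      filter_upwards [self_mem_nhdsWithin] with h hh
      exact (hd' h hh).fderiv.symm
  have h1 := (main 1 one_ne_zero).union (main (-1) (neg_ne_zero.2 one_ne_zero))
  refine h1.hasFDerivAt (mem_of_superset (Metric.ball_mem_nhds x hδ) ?_)
  have hdense : Dense {h : H | ℓ h ≠ 0} := by
    have h2 : IsOpenMap ℓ := ℓ.isOpenMap fun t => ⟨(EuclideanSpace.single 0 t, 0), by simp [ℓ]⟩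
    exact (dense_compl_singleton (0 : ℝ)).preimage h2
  rw [← closure_union, ← Set.inter_union_distrib_left]
  have h3 : {h | 0 < 1 * ℓ h} ∪ {h | 0 < -1 * ℓ h} = {h : H | ℓ h ≠ 0} := by
    ext h
    change (0 < 1 * ℓ h ∨ 0 < -1 * ℓ h) ↔ ℓ h ≠ 0
    rw [one_mul, neg_one_mul, neg_pos, or_comm, ne_iff_lt_or_gt]
  rw [h3]
  refine fun y hy => Metric.isOpen_ball.inter_closure ⟨hy, ?_⟩
  rw [hdense.closure_eq]
  trivial

/-- The map `(y, s) ↦ (b ‖y‖² + ε, s)`. -/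
noncomputable def radial (b ε : ℝ) (h : H) : ℝ × E3 := (b * ‖h.1‖ ^ 2 + ε, h.2)

@[fun_prop]
theorem contDiff_radial (b ε : ℝ) {n : WithTop ℕ∞} : ContDiff ℝ n (radial b ε) :=
  ((contDiff_const.mul (contDiff_fst.norm_sq ℝ)).add contDiff_const).prodMk contDiff_snd

theorem radial_mem_bdUpper {h : H} (hh : h ≠ 0) : radial 1 0 h ∈ bdUpper :=
  mem_bdUpper.2 ⟨by unfold radial; positivity, fun h0 => hh (by
    have h1 := congrArg Prod.fst h0
    have h2 := congrArg Prod.snd h0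
    simp only [radial, one_mul, add_zero, Prod.fst_zero, Prod.snd_zero] at h1 h2
    exact Prod.ext (norm_eq_zero.1 (pow_eq_zero_iff two_ne_zero |>.1 h1)) h2)⟩

theorem radial_mem_upper {h : H} (hh : h.1 ≠ 0) : radial 1 0 h ∈ upper :=
  mem_upper.2 (by
    have := norm_pos_iff.2 hh
    unfold radial; positivity)

/-- The boundary kernels are smooth off the origin. On the centre `radial 1 0` touches the boundary
of the half space, and differentiability there comes from `hasFDerivAt_of_off_centre`. -/
theorem contDiffOn_planeInt_radial (m : ℕ) {Q : E3 → ℂ} (hQ : ContDiff ℝ ∞ Q) :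
    ContDiffOn ℝ ∞ (fun h : H => planeInt m Q (radial 1 0 h)) {0}ᶜ := by
  have ho : IsOpen ({0}ᶜ : Set H) := isOpen_compl_singleton
  have hrc : Continuous (radial 1 0) := (contDiff_radial 1 0 (n := 1)).continuous
  have hr : Set.MapsTo (radial 1 0) {0}ᶜ bdUpper := fun h hh => radial_mem_bdUpper hh
  have hc : ∀ (m : ℕ) {Q : E3 → ℂ}, ContDiff ℝ ∞ Q →
      ContinuousOn (fun h : H => planeInt m Q (radial 1 0 h)) {0}ᶜ := fun m Q hQ =>
    (continuousOn_planeInt m hQ).comp hrc.continuousOn hr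
  have hrd : ContDiff ℝ ∞ (fderiv ℝ (radial 1 0)) :=
    (contDiff_radial 1 0 (n := ∞)).fderiv_right (by simp)
  have hd : ∀ (m : ℕ) {Q : E3 → ℂ}, ContDiff ℝ ∞ Q → ∀ h ∈ ({0}ᶜ : Set H),
      HasFDerivAt (fun h : H => planeInt m Q (radial 1 0 h))
        ((planeDeriv m Q (radial 1 0 h)).comp (fderiv ℝ (radial 1 0) h)) h := by
    intro m Q hQ h hh
    refine hasFDerivAt_of_off_centre ho (hc m hQ)
      (f' := fun h => (planeDeriv m Q (radial 1 0 h)).comp (fderiv ℝ (radial 1 0) h)) ?_ ?_ hh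
    · refine ContinuousOn.clm_comp ?_ hrd.continuous.continuousOn
      exact ((continuousOn_const.mul (hc (m + 1) hQ)).smul continuousOn_const).add
        (continuousOn_finsetSum _ fun j _ =>
          (continuousOn_const.mul (hc (m + 1) (contDiff_coord_mul j hQ))).smul continuousOn_const)
    · intro h _ hy
      exact (hasFDerivAt_planeInt m hQ (radial_mem_upper hy)).comp h
        ((contDiff_radial 1 0 (n := 1)).differentiable one_ne_zero h).hasFDerivAt
  rw [contDiffOn_infty]
  intro n
  induction n generalizing m Q with
  | zero => exact contDiffOn_zero.2 (hc m hQ)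
  | succ n ih =>
    rw [Nat.cast_add, Nat.cast_one, contDiffOn_succ_iff_fderiv_of_isOpen ho]
    refine ⟨fun h hh => (hd m hQ h hh).differentiableAt.differentiableWithinAt, by simp, ?_⟩
    have h1 : ContDiffOn ℝ n (fun h => planeDeriv m Q (radial 1 0 h)) {0}ᶜ :=
      ((contDiffOn_const.mul (ih (m + 1) hQ)).smul contDiffOn_const).add
        (ContDiffOn.sum fun j _ =>
          (contDiffOn_const.mul (ih (m + 1) (contDiff_coord_mul j hQ))).smul contDiffOn_const)
    exact (h1.clm_comp (hrd.of_le (mod_cast le_top)).contDiffOn).congr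
      fun h hh => (hd m hQ h hh).fderiv

end QHeis

namespace QHeis

/-! ### The entries of the projections `P^τ` -/

/-- `1 + τ₁`. -/
noncomputable def pp (τ : E3) : ℂ := 1 + (τ 0 : ℂ)

/-- `1 - τ₁`. -/
noncomputable def mm (τ : E3) : ℂ := 1 - (τ 0 : ℂ)

/-- `i τ₂ - τ₃`. -/
noncomputable def qq (τ : E3) : ℂ := I * (τ 1 : ℂ) - (τ 2 : ℂ)

/-- The complex conjugate of `i τ₂ - τ₃`. -/
noncomputable def qb (τ : E3) : ℂ := -I * (τ 1 : ℂ) - (τ 2 : ℂ)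

@[fun_prop]
theorem contDiff_coord {n : WithTop ℕ∞} (j : Fin 3) : ContDiff ℝ n fun τ : E3 => (τ j : ℂ) :=
  ofRealCLM.contDiff.comp (contDiff_piLp_apply 2)

@[fun_prop] theorem contDiff_pp {n : WithTop ℕ∞} : ContDiff ℝ n pp := by
  unfold pp; fun_prop

@[fun_prop] theorem contDiff_mm {n : WithTop ℕ∞} : ContDiff ℝ n mm := by
  unfold mm; fun_prop

@[fun_prop] theorem contDiff_qq {n : WithTop ℕ∞} : ContDiff ℝ n qq := by
  unfold qq; fun_prop

@[fun_prop] theorem contDiff_qb {n : WithTop ℕ∞} : ContDiff ℝ n qb := by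
  unfold qb; fun_prop

theorem conj_pp (τ : E3) : (starRingEnd ℂ) (pp τ) = pp τ := by simp [pp]

theorem conj_mm (τ : E3) : (starRingEnd ℂ) (mm τ) = mm τ := by simp [mm]

theorem conj_qq (τ : E3) : (starRingEnd ℂ) (qq τ) = qb τ := by simp [qq, qb]

theorem conj_qb (τ : E3) : (starRingEnd ℂ) (qb τ) = qq τ := by simp [qq, qb]

theorem qq_mul_qb (τ : Metric.sphere (0 : E3) 1) : qq τ * qb τ = pp τ * mm τ := by
  have h : ((τ : E3) 0 : ℂ) ^ 2 + ((τ : E3) 1 : ℂ) ^ 2 + ((τ : E3) 2 : ℂ) ^ 2 = 1 := by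
    have := congrArg ofReal (sphere_sum_sq τ)
    push_cast at this
    exact this
  simp only [qq, qb, pp, mm]
  linear_combination h - ((τ : E3) 1 : ℂ) ^ 2 * I_sq

/-- The denominator `∑ (1 + τ₁)ᵏ⁻ʲ (1 - τ₁)ʲ` of the entries of `P^τ`. -/
noncomputable def den (k : ℕ) (τ : E3) : ℂ :=
  ∑ j ∈ Finset.range (k + 1), pp τ ^ (k - j) * mm τ ^ j

@[fun_prop] theorem contDiff_den {n : WithTop ℕ∞} (k : ℕ) : ContDiff ℝ n (den k) := by
  unfold den; fun_prop

/-- The denominator vanishes nowhere on `ℝ³`: it is a geometric sum for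
`(1 + τ₁)ᵏ⁺¹ - (1 - τ₁)ᵏ⁺¹`, and these two powers agree only if `τ₁ = 0`,
where the sum is `k + 1`. -/
theorem den_ne_zero (k : ℕ) (τ : E3) : den k τ ≠ 0 := by
  intro h0
  have h1 : (∑ j ∈ Finset.range (k + 1), (1 - τ 0) ^ j * (1 + τ 0) ^ (k - j)) = 0 := by
    have : ((∑ j ∈ Finset.range (k + 1), (1 - τ 0) ^ j * (1 + τ 0) ^ (k - j) : ℝ) : ℂ) = 0 := by
      rw [← h0, den]
      push_cast
      exact Finset.sum_congr rfl fun j _ => mul_comm _ _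
    exact ofReal_eq_zero.1 this
  have h2 := geom_sum₂_mul (1 - τ 0) (1 + τ 0) (k + 1)
  simp only [Nat.add_sub_cancel] at h2
  rw [h1, zero_mul] at h2
  have h3 : τ 0 = 0 := by
    have h4 := (pow_eq_pow_iff_cases (n := k + 1)).1 (sub_eq_zero.1 h2.symm)
    rcases h4 with h | h | h
    · omega
    · linarith
    · linarith [h.1]
  rw [h3] at h1
  simp at h1
  exact absurd h1 (by positivity)

theorem conj_den (k : ℕ) (τ : E3) : (starRingEnd ℂ) (den k τ) = den k τ := by
  simp [den, map_sum, conj_pp, conj_mm]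

/-- The numerator of the entry `(l, j)` of `P^τ`. On the sphere both branches equal
`(1 + τ₁)ᵏ⁻ˡ⁻ʲ (iτ₂ - τ₃)ˡ (-iτ₂ - τ₃)ʲ`; the case distinction keeps the exponents nonnegative, so
that it is a polynomial also at `τ = (-1, 0, 0)`. -/
noncomputable def num (k l j : ℕ) (τ : E3) : ℂ :=
  if l + j ≤ k then qq τ ^ l * qb τ ^ j * pp τ ^ (k - l - j)
  else qq τ ^ (k - j) * qb τ ^ (k - l) * mm τ ^ (l + j - k)

/-- The entry `(l, j)` of `P^τ`, as a smooth function on `ℝ³`. -/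
noncomputable def ent (k l j : ℕ) (τ : E3) : ℂ := num k l j τ * (den k τ)⁻¹

theorem contDiff_num {n : WithTop ℕ∞} (k l j : ℕ) : ContDiff ℝ n (num k l j) := by
  unfold num
  split_ifs <;> fun_prop

theorem contDiff_ent {n : WithTop ℕ∞} (k l j : ℕ) : ContDiff ℝ n (ent k l j) :=
  (contDiff_num k l j).mul ((contDiff_den k).inv (den_ne_zero k))

theorem conj_ent (k l j : ℕ) (τ : E3) : (starRingEnd ℂ) (ent k l j τ) = ent k j l τ := by
  simp only [ent, map_mul, map_inv₀, conj_den]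
  congr 1
  unfold num
  by_cases h : l + j ≤ k
  · rw [if_pos h, if_pos (by omega)]
    simp only [map_mul, map_pow, conj_pp, conj_qq, conj_qb, Nat.sub_right_comm k l j]
    ring
  · rw [if_neg h, if_neg (by omega)]
    simp only [map_mul, map_pow, conj_mm, conj_qq, conj_qb, add_comm l j]
    ring

theorem pp_pow_mul_num {k l j : ℕ} (hl : l ≤ k) (hj : j ≤ k) (τ : Metric.sphere (0 : E3) 1) :
    pp τ ^ k * num k l j τ = pp τ ^ (k - l) * pp τ ^ (k - j) * qq τ ^ l * qb τ ^ j := by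
  unfold num
  split_ifs with h
  · obtain ⟨r, rfl⟩ := Nat.exists_eq_add_of_le h
    have h1 : l + j + r - l - j = r := by omega
    have h2 : l + j + r - l = j + r := by omega
    have h3 : l + j + r - j = l + r := by omega
    rw [h1, h2, h3]
    ring
  · obtain ⟨a, rfl⟩ := Nat.exists_eq_add_of_le hl
    have h1 : a ≤ j := by omega
    obtain ⟨r, rfl⟩ := Nat.exists_eq_add_of_le h1
    obtain ⟨b, rfl⟩ := Nat.exists_eq_add_of_le (show r ≤ l by omega)
    have e1 : r + b + a - (a + r) = b := by omega
    have e2 : r + b + a - (r + b) = a := by omega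
    have e3 : r + b + (a + r) - (r + b + a) = r := by omega
    rw [e1, e2, e3]
    calc pp τ ^ (r + b + a) * (qq τ ^ b * qb τ ^ a * mm τ ^ r)
        = pp τ ^ (a + b) * qq τ ^ b * qb τ ^ a * (pp τ * mm τ) ^ r := by ring
      _ = _ := by rw [← qq_mul_qb]; ring

/-- The columns of `P^τ` are proportional to `((1 + τ₁)ᵏ⁻ⁱ (iτ₂ - τ₃)ⁱ)_i`, so adjacent entries of a
column satisfy `(1 + τ₁) e_{i+1} = (iτ₂ - τ₃) e_i`, and this is still true at `τ = (-1, 0, 0)`. -/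
theorem num_succ {k i j : ℕ} (hi : i < k) (hj : j ≤ k) (τ : Metric.sphere (0 : E3) 1) :
    pp τ * num k (i + 1) j τ = qq τ * num k i j τ ∧
      qb τ * num k (i + 1) j τ = mm τ * num k i j τ := by
  have hq := qq_mul_qb τ
  unfold num
  by_cases h : i + 1 + j ≤ k
  · rw [if_pos h, if_pos (by omega)]
    have e : k - i - j = (k - (i + 1) - j) + 1 := by omega
    rw [e]
    constructor
    · ring
    · linear_combination (qq τ ^ i * qb τ ^ j * pp τ ^ (k - (i + 1) - j)) * hq
  · rw [if_neg h]
    have e : k - i = (k - (i + 1)) + 1 := by omega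
    by_cases h' : i + j ≤ k
    · have e1 : k - j = i := by omega
      have e2 : j = k - (i + 1) + 1 := by omega
      have e3 : i + 1 + j - k = 1 := by omega
      have e4 : k - i - j = 0 := by omega
      rw [if_pos h', e1, e3, e4]
      have e5 : qb τ ^ j = qb τ ^ (k - (i + 1)) * qb τ := by rw [← pow_succ, ← e2]
      rw [e5]
      constructor
      · linear_combination (-(qq τ ^ i * qb τ ^ (k - (i + 1)))) * hq
      · ring
    · rw [if_neg h', e]
      have e1 : i + 1 + j - k = (i + j - k) + 1 := by omega
      rw [e1]
      constructor
      · linear_combination (-(qq τ ^ (k - j) * qb τ ^ (k - (i + 1)) * mm τ ^ (i + j - k))) * hq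
      · ring

theorem ent_succ {k i j : ℕ} (hi : i < k) (hj : j ≤ k) (τ : Metric.sphere (0 : E3) 1) :
    pp τ * ent k (i + 1) j τ = qq τ * ent k i j τ ∧
      qb τ * ent k (i + 1) j τ = mm τ * ent k i j τ := by
  obtain ⟨h1, h2⟩ := num_succ hi hj τ
  simp only [ent, ← mul_assoc, h1, h2, and_self]

theorem abs_sphere_coord_le (τ : Metric.sphere (0 : E3) 1) (j : Fin 3) : |(τ : E3) j| ≤ 1 := by
  simpa using (PiLp.norm_apply_le (τ : E3) j).trans_eq (by simp)

/-- The smooth functions `ent` are the matrix entries of `P^τ`, the exceptional point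
`τ = (-1, 0, 0)` included. -/
theorem Pτ_apply {k : ℕ} (hk : 1 ≤ k) (τ : Metric.sphere (0 : E3) 1) (v : V k)
    (l : Fin (k + 1)) : Pτ k τ v l = ∑ j : Fin (k + 1), ent k l j τ * v j := by
  by_cases hτ : (τ : E3) = EuclideanSpace.single 0 (-1)
  · have hp : pp τ = 0 := by simp [pp, hτ]
    have hm : mm τ = 2 := by simp [mm, hτ]; norm_num
    have hq : qq τ = 0 := by simp [qq, hτ]
    have hqb : qb τ = 0 := by simp [qb, hτ]
    have hden : den k τ = 2 ^ k := by
      rw [den, Finset.sum_eq_single k]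
      · simp [hm]
      · intro j hj hjk
        have : k - j ≠ 0 := by have := Finset.mem_range.1 hj; omega
        simp [hp, this]
      · simp
    have hent : ∀ j : Fin (k + 1), ent k l j τ = if j = Fin.last k ∧ l = Fin.last k then 1 else 0 := by
      intro j
      have hj := j.2
      have hl := l.2
      simp only [Fin.ext_iff, Fin.val_last]
      rw [ent, hden, num, hp, hm, hq, hqb]
      by_cases h : (j : ℕ) = k ∧ (l : ℕ) = k
      · rw [if_neg (by omega), if_pos h, h.1, h.2]
        simp
      · rw [if_neg h]
        split_ifs with h'
        · rcases Nat.eq_zero_or_pos (l : ℕ) with h0 | h0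
          · rcases Nat.eq_zero_or_pos (j : ℕ) with h1 | h1
            · simp [h0, h1, show k ≠ 0 by omega]
            · simp [h1.ne']
          · simp [h0.ne']
        · rcases Nat.eq_zero_or_pos (k - j : ℕ) with h0 | h0
          · have h1 : k - (l : ℕ) ≠ 0 := by omega
            simp [h1]
          · simp [h0.ne']
    rw [Pτ, Submodule.starProjection_singleton, e1, if_pos hτ]
    simp only [hent]
    by_cases hl : l = Fin.last k
    · subst hl
      simp [EuclideanSpace.inner_single_left]
    · simp [hl]
  · have hp : pp τ ≠ 0 := by
      intro h
      apply hτ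
      have h0 : (τ : E3) 0 = -1 := by
        have : ((1 + (τ : E3) 0 : ℝ) : ℂ) = 0 := by push_cast; exact h
        have := ofReal_eq_zero.1 this
        linarith
      have h1 := sphere_sum_sq τ
      rw [h0] at h1
      ext i
      fin_cases i
      · simpa using h0
      · simp only [Fin.mk_one, PiLp.single_apply]
        simp
        nlinarith [sq_nonneg ((τ : E3) 1), sq_nonneg ((τ : E3) 2)]
      · simp
        nlinarith [sq_nonneg ((τ : E3) 1), sq_nonneg ((τ : E3) 2)]
    set Γ : ℝ := ∑ j ∈ Finset.range (k + 1), (1 + (τ : E3) 0) ^ (2 * k - j) * (1 - (τ : E3) 0) ^ j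
      with hΓ
    let w : V k := WithLp.toLp 2 fun j : Fin (k + 1) => pp τ ^ (k - (j : ℕ)) * qq τ ^ (j : ℕ)
    have hΓC : (Γ : ℂ) = pp τ ^ k * den k τ := by
      rw [hΓ, den, Finset.mul_sum]
      push_cast
      refine Finset.sum_congr rfl fun j hj => ?_
      have : 2 * k - j = k + (k - j) := by have := Finset.mem_range.1 hj; omega
      rw [this, pow_add, mul_assoc]
      rfl
    have hΓ0 : Γ ≠ 0 := fun h => by
      rw [h, ofReal_zero] at hΓC
      exact mul_ne_zero (pow_ne_zero _ hp) (den_ne_zero k τ) hΓC.symm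
    have hΓpos : 0 ≤ Γ := by
      have h1 := abs_le.1 (abs_sphere_coord_le τ 0)
      exact Finset.sum_nonneg fun j _ =>
        mul_nonneg (pow_nonneg (by linarith) _) (pow_nonneg (by linarith) _)
    have hwn : ‖w‖ ^ 2 = Γ := by
      rw [← ofReal_inj, hΓC, den, Finset.mul_sum, Finset.sum_range]
      rw [EuclideanSpace.norm_sq_eq]
      push_cast
      refine Finset.sum_congr rfl fun j _ => ?_
      rw [← ofReal_pow, ← normSq_eq_norm_sq, normSq_eq_conj_mul_self]
      simp only [w, map_mul, map_pow, conj_pp, conj_qq]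
      obtain ⟨r, hr⟩ := Nat.exists_eq_add_of_le (Nat.lt_succ_iff.1 j.2)
      have e : k - (j : ℕ) = r := by omega
      rw [e, show pp τ ^ k = pp τ ^ (j : ℕ) * pp τ ^ r by rw [← pow_add, ← hr]]
      calc _ = pp τ ^ r * pp τ ^ r * (qq τ * qb τ) ^ (j : ℕ) := by ring
        _ = _ := by rw [qq_mul_qb]; ring
    have he : e1 k τ = (((√Γ)⁻¹ : ℝ) : ℂ) • w := by
      rw [e1, if_neg hτ]
      rfl
    have hsq : √Γ * √Γ = Γ := Real.mul_self_sqrt hΓpos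
    have hs0 : √Γ ≠ 0 := fun h => hΓ0 (by rw [← hsq, h, zero_mul])
    have hunit : ‖e1 k τ‖ = 1 := by
      rw [he, norm_smul, norm_real, Real.norm_eq_abs, abs_of_nonneg (by positivity),
        ← Real.sqrt_sq (norm_nonneg w), hwn, inv_mul_cancel₀ hs0]
    rw [Pτ, Submodule.starProjection_unit_singleton _ hunit, he, inner_smul_left, smul_smul,
      conj_ofReal]
    have hin : ⟪w, v⟫_ℂ = ∑ j : Fin (k + 1), pp τ ^ (k - (j : ℕ)) * qb τ ^ (j : ℕ) * v j := by
      rw [PiLp.inner_apply]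
      refine Finset.sum_congr rfl fun j _ => ?_
      simp [w, conj_pp, conj_qq, mul_comm]
    rw [hin, PiLp.smul_apply, smul_eq_mul, Finset.mul_sum, Finset.sum_mul, Finset.sum_mul]
    refine Finset.sum_congr rfl fun j _ => ?_
    have hinv : ((((√Γ)⁻¹ : ℝ) : ℂ)) * (((√Γ)⁻¹ : ℝ) : ℂ) = (pp τ ^ k * den k τ)⁻¹ := by
      rw [← ofReal_mul, ← mul_inv, hsq, ofReal_inv, hΓC]
    have hn := pp_pow_mul_num (Nat.lt_succ_iff.1 l.2) (Nat.lt_succ_iff.1 j.2) τ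
    have hpk : pp τ ^ k ≠ 0 := pow_ne_zero _ hp
    calc _ = ((((√Γ)⁻¹ : ℝ) : ℂ)) * (((√Γ)⁻¹ : ℝ) : ℂ) *
          (pp τ ^ (k - (l : ℕ)) * pp τ ^ (k - (j : ℕ)) * qq τ ^ (l : ℕ) * qb τ ^ (j : ℕ)) * v j := by
          simp only [w]
          ring
      _ = _ := by
          rw [hinv, ← hn, ent]
          field_simp [den_ne_zero k (τ : E3)]

end QHeis

namespace QHeis

/-! ### Translations, dilations and the horizontal vector fields -/

theorem B_add_left (x x' y : E4) : B (x + x') y = B x y + B x' y := by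
  ext i
  simp only [B, PiLp.add_apply, ← Finset.sum_add_distrib]
  exact Finset.sum_congr rfl fun l _ => Finset.sum_congr rfl fun m _ => by ring

theorem B_add_right (x y y' : E4) : B x (y + y') = B x y + B x y' := by
  ext i
  simp only [B, PiLp.add_apply, ← Finset.sum_add_distrib]
  exact Finset.sum_congr rfl fun l _ => Finset.sum_congr rfl fun m _ => by ring

theorem B_smul_left (c : ℝ) (x y : E4) : B (c • x) y = c • B x y := by
  ext i
  simp only [B, PiLp.smul_apply, smul_eq_mul, Finset.mul_sum]
  exact Finset.sum_congr rfl fun l _ => Finset.sum_congr rfl fun m _ => by ring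

theorem B_smul_right (c : ℝ) (x y : E4) : B x (c • y) = c • B x y := by
  ext i
  simp only [B, PiLp.smul_apply, smul_eq_mul, Finset.mul_sum]
  exact Finset.sum_congr rfl fun l _ => Finset.sum_congr rfl fun m _ => by ring

@[fun_prop]
theorem contDiff_B {E : Type*} [NormedAddCommGroup E] [NormedSpace ℝ E] {n : WithTop ℕ∞}
    {f g : E → E4} (hf : ContDiff ℝ n f) (hg : ContDiff ℝ n g) :
    ContDiff ℝ n fun x => B (f x) (g x) := by
  rw [contDiff_piLp]
  intro i
  simp only [B]
  refine ContDiff.sum fun l _ => ContDiff.sum fun m _ => ?_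
  exact (contDiff_const.mul ((contDiff_piLp 2).1 hf l)).mul ((contDiff_piLp 2).1 hg m)

@[fun_prop]
theorem continuous_B {E : Type*} [TopologicalSpace E] {f g : E → E4} (hf : Continuous f)
    (hg : Continuous g) : Continuous fun x => B (f x) (g x) :=
  (contDiff_B (n := 0) contDiff_fst contDiff_snd).continuous.comp (hf.prodMk hg)

@[fun_prop]
theorem continuous_gmul {E : Type*} [TopologicalSpace E] {f g : E → H} (hf : Continuous f)
    (hg : Continuous g) : Continuous fun x => gmul (f x) (g x) := by
  unfold gmul
  fun_prop

theorem gmul_ginv (p : H) : gmul p (ginv p) = 0 := by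
  have h : ginv (ginv p) = p := by simp [ginv]
  simpa [h] using ginv_gmul (ginv p)

theorem ginv_gmul_cancel (p q : H) : gmul (ginv p) (gmul p q) = q := by
  rw [← gmul_assoc, ginv_gmul, zero_gmul]

theorem gmul_ginv_cancel (p q : H) : gmul p (gmul (ginv p) q) = q := by
  rw [← gmul_assoc, gmul_ginv, zero_gmul]

/-- Left translation by `p` as a homeomorphism. -/
noncomputable def leftHomeo (p : H) : H ≃ₜ H where
  toFun := gmul p
  invFun := gmul (ginv p)
  left_inv := ginv_gmul_cancel p
  right_inv := gmul_ginv_cancel p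
  continuous_toFun := by fun_prop
  continuous_invFun := by fun_prop

theorem measurePreserving_gmul_left (p : H) : MeasurePreserving (gmul p) := by
  have h := (measurePreserving_add_left (volume : Measure E4) p.1).skew_product
    (μc := (volume : Measure E3)) (μd := volume) (g := fun x t => p.2 + t + (2 : ℝ) • B p.1 x)
    (Continuous.measurable (by unfold Function.uncurry; fun_prop)) (Eventually.of_forall fun x => by
      have : (fun t : E3 => p.2 + t + (2 : ℝ) • B p.1 x) =
          fun t => (p.2 + (2 : ℝ) • B p.1 x) + t := by
        ext1 t; abel
      rw [this]
      exact (measurePreserving_add_left volume _).map_eq)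
  exact h

theorem measurePreserving_gmul_right (p : H) : MeasurePreserving fun q => gmul q p := by
  have h := (measurePreserving_add_right (volume : Measure E4) p.1).skew_product
    (μc := (volume : Measure E3)) (μd := volume) (g := fun x t => t + p.2 + (2 : ℝ) • B x p.1)
    (Continuous.measurable (by unfold Function.uncurry; fun_prop)) (Eventually.of_forall fun x => by
      have : (fun t : E3 => t + p.2 + (2 : ℝ) • B x p.1) =
          fun t => t + (p.2 + (2 : ℝ) • B x p.1) := by
        ext1 t; abel
      rw [this]
      exact (measurePreserving_add_right volume _).map_eq)
  exact h

theorem ginv_eq_neg (p : H) : ginv p = -p := rfl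

theorem integral_gmul_left {F : Type*} [NormedAddCommGroup F] [NormedSpace ℝ F] (p : H)
    (f : H → F) : ∫ h, f (gmul p h) = ∫ h, f h :=
  (measurePreserving_gmul_left p).integral_comp (leftHomeo p).measurableEmbedding f

/-- The differential of a left translation. -/
noncomputable def leftLin (x : E4) : H →L[ℝ] H :=
  LinearMap.toContinuousLinearMap
    { toFun := fun q => (q.1, q.2 + (2 : ℝ) • B x q.1)
      map_add' := fun q q' => by
        ext1
        · rfl
        · simp only [Prod.fst_add, Prod.snd_add, B_add_right, smul_add]; abel
      map_smul' := fun c q => by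
        ext1
        · rfl
        · simp only [Prod.smul_fst, Prod.smul_snd, B_smul_right, smul_add, RingHom.id_apply]
          rw [smul_comm] }

theorem hasFDerivAt_gmul_left (p q : H) : HasFDerivAt (gmul p) (leftLin p.1) q := by
  have : gmul p = fun q => p + leftLin p.1 q := by
    ext1 q
    refine Prod.ext rfl ?_
    simp [gmul, leftLin, add_assoc]
  rw [this]
  exact (leftLin p.1).hasFDerivAt.const_add p

theorem contDiff_gmul_left {n : WithTop ℕ∞} (p : H) : ContDiff ℝ n (gmul p) := by
  unfold gmul
  fun_prop

/-- The vector field `Y_j` at the point `h`. -/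
noncomputable def hvec (j : Fin 4) (h : H) : H :=
  (EuclideanSpace.single j 1, (2 : ℝ) • B h.1 (EuclideanSpace.single j 1))

theorem Y_eq (j : Fin 4) (φ : H → ℂ) (h : H) : Y j φ h = fderiv ℝ φ h (hvec j h) := rfl

theorem continuous_hvec (j : Fin 4) : Continuous (hvec j) := by
  unfold hvec; fun_prop

theorem Y_comp_gmul {φ : H → ℂ} (hφ : Differentiable ℝ φ) (p : H) (j : Fin 4) (h : H) :
    Y j (fun q => φ (gmul p q)) h = Y j φ (gmul p h) := by
  have h1 := ((hφ (gmul p h)).hasFDerivAt.comp h (hasFDerivAt_gmul_left p h)).fderiv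
  have h2 : leftLin p.1 (hvec j h) = hvec j (gmul p h) := by
    refine Prod.ext rfl ?_
    simp [leftLin, hvec, gmul, B_add_left, add_comm]
  rw [Y_eq, Y_eq, ← h2]
  exact congrArg (fun L : H →L[ℝ] ℂ => L (hvec j h)) h1

/-- The coefficients of `Z_A^{A'}` with respect to `Y_0, …, Y_3`. -/
noncomputable def zc : Fin 2 → Fin 2 → Fin 4 → ℂ :=
  ![![![0, 0, -1, -I], ![-1, -I, 0, 0]], ![![1, -I, 0, 0], ![0, 0, -1, I]]]

theorem Z_eq (A A' : Fin 2) (φ : H → ℂ) (h : H) : Z A A' φ h = ∑ j, zc A A' j * Y j φ h := by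
  fin_cases A <;> fin_cases A' <;> simp [Z, zc, Fin.sum_univ_four] <;> ring

theorem Z_comp_gmul {φ : H → ℂ} (hφ : Differentiable ℝ φ) (p : H) (A A' : Fin 2) (h : H) :
    Z A A' (fun q => φ (gmul p q)) h = Z A A' φ (gmul p h) := by
  simp only [Z_eq, Y_comp_gmul hφ]

theorem Y_mul {φ ψ : H → ℂ} {h : H} (hφ : DifferentiableAt ℝ φ h) (hψ : DifferentiableAt ℝ ψ h)
    (j : Fin 4) : Y j (fun q => φ q * ψ q) h = φ h * Y j ψ h + ψ h * Y j φ h := by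
  have h1 : HasFDerivAt (fun q => φ q * ψ q) _ h := hφ.hasFDerivAt.mul hψ.hasFDerivAt
  rw [Y_eq, h1.fderiv]
  rfl

theorem Z_mul {φ ψ : H → ℂ} {h : H} (hφ : DifferentiableAt ℝ φ h) (hψ : DifferentiableAt ℝ ψ h)
    (A A' : Fin 2) : Z A A' (fun q => φ q * ψ q) h = φ h * Z A A' ψ h + ψ h * Z A A' φ h := by
  simp only [Z_eq, Y_mul hφ hψ, Finset.mul_sum, ← Finset.sum_add_distrib]
  exact Finset.sum_congr rfl fun j _ => by ring

theorem IsTest.comp_gmul {φ : H → ℂ} (hφ : IsTest φ) (p : H) : IsTest fun q => φ (gmul p q) where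
  smooth := hφ.smooth.comp (contDiff_gmul_left p)
  compact := hφ.compact.comp_homeomorph (leftHomeo p)

theorem IsKCF.comp_gmul {k : ℕ} {f : H → V k} (hf : IsKCF f) (p : H) :
    IsKCF fun q => f (gmul p q) := by
  intro φ hφ i A
  rw [← hf _ (hφ.comp_gmul (ginv p)) i A, pairing, pairing]
  conv_rhs => rw [← integral_gmul_left p]
  simp only [Z_comp_gmul (hφ.smooth.differentiable (by simp)), ginv_gmul_cancel]

/-- The dilation `(y, s) ↦ (t y, t² s)`. -/
noncomputable def dil (t : ℝ) : H →L[ℝ] H :=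
  (t • ContinuousLinearMap.fst ℝ E4 E3).prod (t ^ 2 • ContinuousLinearMap.snd ℝ E4 E3)

theorem dil_apply (t : ℝ) (h : H) : dil t h = (t • h.1, t ^ 2 • h.2) := rfl

theorem Y_comp_dil {φ : H → ℂ} (hφ : Differentiable ℝ φ) (t : ℝ) (j : Fin 4) (h : H) :
    Y j (fun q => φ (dil t q)) h = t * Y j φ (dil t h) := by
  have h1 := ((hφ (dil t h)).hasFDerivAt.comp h (dil t).hasFDerivAt).fderiv
  have h2 : dil t (hvec j h) = t • hvec j (dil t h) := by
    refine Prod.ext rfl ?_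
    simp only [dil_apply, hvec, B_smul_left, Prod.smul_mk, smul_smul]
    ring_nf
  have h3 : Y j (fun q => φ (dil t q)) h = fderiv ℝ φ (dil t h) (dil t (hvec j h)) :=
    congrArg (fun L : H →L[ℝ] ℂ => L (hvec j h)) h1
  rw [h3, h2, map_smul, real_smul]
  rfl

theorem memLp_coord {k : ℕ} {f : H → V k} (hf : MemLp f 2 volume) (i : Fin (k + 1)) :
    MemLp (fun h => f h i) 2 volume :=
  (EuclideanSpace.proj (𝕜 := ℂ) i : V k →L[ℂ] ℂ).comp_memLp' hf

theorem continuous_Y {φ : H → ℂ} (hφ : ContDiff ℝ ∞ φ) (j : Fin 4) : Continuous (Y j φ) :=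
  (hφ.continuous_fderiv (by simp)).clm_apply (continuous_hvec j)

theorem continuous_Z {φ : H → ℂ} (hφ : ContDiff ℝ ∞ φ) (A A' : Fin 2) :
    Continuous (Z A A' φ) := by
  have : Z A A' φ = fun h => ∑ j, zc A A' j * Y j φ h := funext (Z_eq A A' φ)
  rw [this]
  exact continuous_finsetSum _ fun j _ => continuous_const.mul (continuous_Y hφ j)

/-- The weak `k`-Cauchy-Fueter equation of a square integrable function may be tested against
smooth functions that are square integrable together with their horizontal derivatives: cut off
along the dilations. -/
theorem IsKCF.integral_eq_zero {k : ℕ} {f : H → V k} (hf : IsKCF f) (hf2 : MemLp f 2 volume)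
    {ψ : H → ℂ} (hψ : ContDiff ℝ ∞ ψ) (hψ2 : MemLp ψ 2 volume)
    (hψY : ∀ j, MemLp (Y j ψ) 2 volume) (i : Fin k) (A : Fin 2) :
    Integrable (fun h => f h i.castSucc * Z A 0 ψ h + f h i.succ * Z A 1 ψ h) ∧
    ∫ h, (f h i.castSucc * Z A 0 ψ h + f h i.succ * Z A 1 ψ h) = 0 := by
  have hZ2 : ∀ A', MemLp (Z A A' ψ) 2 volume := fun A' => by
    have : Z A A' ψ = fun h => ∑ j, zc A A' j * Y j ψ h := funext (Z_eq A A' ψ)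
    rw [this]
    exact memLp_finsetSum _ fun j _ => (hψY j).const_mul _
  have hfi := memLp_coord hf2
  have hint : Integrable (fun h => f h i.castSucc * Z A 0 ψ h + f h i.succ * Z A 1 ψ h) :=
    ((hfi _).integrable_mul (hZ2 0)).add ((hfi _).integrable_mul (hZ2 1))
  refine ⟨hint, ?_⟩
  -- The cut-offs `χ ∘ dil t`, `t → 0`, exhaust `H`, and since `Z` has degree one under the
  -- dilations their horizontal derivatives carry a factor `t` and stay bounded.
  let χ₀ : ContDiffBump (0 : H) := ⟨1, 2, one_pos, one_lt_two⟩
  let χ : H → ℂ := fun h => (χ₀ h : ℝ)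
  have hχ : IsTest χ :=
    ⟨ofRealCLM.contDiff.comp χ₀.contDiff, χ₀.hasCompactSupport.comp_left (g := ofReal) ofReal_zero⟩
  have hχd : Differentiable ℝ χ := hχ.smooth.differentiable (by simp)
  obtain ⟨C, hC⟩ : ∃ C, ∀ A' h, ‖Z A A' χ h‖ ≤ C := by
    choose C hC using fun A' => (hχ.Z A A').1.bounded_above_of_compact_support (hχ.Z A A').2
    exact ⟨max (C 0) (C 1), fun A' h => by
      fin_cases A'
      · exact (hC 0 h).trans (le_max_left _ _)
      · exact (hC 1 h).trans (le_max_right _ _)⟩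
  let t : ℕ → ℝ := fun n => 1 / ((n : ℝ) + 1)
  have ht : ∀ n, 0 < t n := fun n => Nat.one_div_pos_of_nat
  have ht1 : ∀ n, t n ≤ 1 := fun n => by
    simp only [t]
    rw [div_le_one (by positivity)]
    linarith [(Nat.cast_nonneg n : (0 : ℝ) ≤ n)]
  have ht0 : Tendsto t atTop (𝓝 0) := tendsto_one_div_add_atTop_nhds_zero_nat
  have hdilinv : ∀ n h, dil (t n)⁻¹ (dil (t n) h) = h := fun n h => by
    simp [dil_apply, smul_smul, (ht n).ne']
  have hdilinv' : ∀ n h, dil (t n) (dil (t n)⁻¹ h) = h := fun n h => by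
    simp [dil_apply, smul_smul, (ht n).ne']
  let e : ℕ → H ≃ₜ H := fun n => ⟨⟨dil (t n), dil (t n)⁻¹, hdilinv n, hdilinv' n⟩,
    (dil (t n)).continuous, (dil (t n)⁻¹).continuous⟩
  have hχn : ∀ n, IsTest fun h => χ (dil (t n) h) := fun n =>
    ⟨hχ.smooth.comp (dil (t n)).contDiff, hχ.compact.comp_homeomorph (e n)⟩
  have hZn : ∀ n A' h, Z A A' (fun h => χ (dil (t n) h)) h = t n * Z A A' χ (dil (t n) h) := by
    intro n A' h
    simp only [Z_eq, Y_comp_dil hχd, Finset.mul_sum]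
    exact Finset.sum_congr rfl fun j _ => by ring
  have htest : ∀ n, IsTest fun h => χ (dil (t n) h) * ψ h := fun n =>
    ⟨(hχn n).smooth.mul hψ, (hχn n).compact.mul_right⟩
  have hprod : ∀ n A' h, Z A A' (fun h => χ (dil (t n) h) * ψ h) h =
      χ (dil (t n) h) * Z A A' ψ h + ψ h * (t n * Z A A' χ (dil (t n) h)) := fun n A' h => by
    rw [Z_mul ((hχn n).smooth.differentiable (by simp) h) (hψ.differentiable (by simp) h), hZn]
  have hzero : ∀ n, ∫ h, (f h i.castSucc * Z A 0 (fun h => χ (dil (t n) h) * ψ h) h +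
      f h i.succ * Z A 1 (fun h => χ (dil (t n) h) * ψ h) h) = 0 := fun n =>
    neg_eq_zero.1 (hf _ (htest n) i A)
  have hχ1 : ∀ h, ‖χ h‖ ≤ 1 := fun h => by
    simp only [χ, norm_real, Real.norm_eq_abs, abs_of_nonneg χ₀.nonneg]
    exact χ₀.le_one
  have hdil0 : ∀ h, Tendsto (fun n => dil (t n) h) atTop (𝓝 0) := fun h => by
    have h1 : Continuous fun r : ℝ => dil r h := by
      simp only [dil_apply]; fun_prop
    have h2 := (h1.tendsto 0).comp ht0
    have h3 : dil 0 h = 0 := by simp [dil_apply]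
    rwa [h3] at h2
  have hlim := tendsto_integral_of_dominated_convergence
    (F := fun n h => f h i.castSucc * Z A 0 (fun h => χ (dil (t n) h) * ψ h) h +
      f h i.succ * Z A 1 (fun h => χ (dil (t n) h) * ψ h) h)
    (f := fun h => f h i.castSucc * Z A 0 ψ h + f h i.succ * Z A 1 ψ h) (μ := volume)
    (fun h => ‖f h i.castSucc‖ * (‖Z A 0 ψ h‖ + ‖ψ h‖ * C) +
      ‖f h i.succ‖ * (‖Z A 1 ψ h‖ + ‖ψ h‖ * C))
    (fun n => ((hfi _).1.mul (continuous_Z (htest n).smooth A 0).aestronglyMeasurable).add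
      ((hfi _).1.mul (continuous_Z (htest n).smooth A 1).aestronglyMeasurable))
    (((hfi _).norm.integrable_mul ((hZ2 0).norm.add (hψ2.norm.mul_const C))).add
      ((hfi _).norm.integrable_mul ((hZ2 1).norm.add (hψ2.norm.mul_const C))))
    (fun n => Eventually.of_forall fun h => by
      have hb : ∀ A', ‖Z A A' (fun h => χ (dil (t n) h) * ψ h) h‖ ≤
          ‖Z A A' ψ h‖ + ‖ψ h‖ * C := fun A' => by
        rw [hprod]
        refine (norm_add_le _ _).trans ?_
        have htn : ‖(t n : ℂ)‖ = t n := by rw [norm_real, Real.norm_eq_abs, abs_of_pos (ht n)]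
        rw [norm_mul, norm_mul, norm_mul, htn]
        have h1 := hχ1 (dil (t n) h)
        have h2 := hC A' (dil (t n) h)
        have h3 : t n * ‖Z A A' χ (dil (t n) h)‖ ≤ C :=
          (mul_le_of_le_one_left (norm_nonneg _) (ht1 n)).trans h2
        gcongr
        exact mul_le_of_le_one_left (norm_nonneg _) h1
      refine (norm_add_le _ _).trans ?_
      rw [norm_mul, norm_mul]
      gcongr
      · exact hb 0
      · exact hb 1)
    (Eventually.of_forall fun h => by
      have hl : ∀ A', Tendsto (fun n => Z A A' (fun h => χ (dil (t n) h) * ψ h) h) atTop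
          (𝓝 (Z A A' ψ h)) := fun A' => by
        simp only [hprod]
        have h1 : Tendsto (fun n => χ (dil (t n) h)) atTop (𝓝 1) := by
          have := (hχ.smooth.continuous.tendsto 0).comp (hdil0 h)
          have h0 : χ 0 = 1 := by
            simp only [χ]
            rw [χ₀.one_of_mem_closedBall (by simp [χ₀])]
            simp
          rwa [h0] at this
        have h2 : Tendsto (fun n => (t n : ℂ) * Z A A' χ (dil (t n) h)) atTop (𝓝 (0 * Z A A' χ 0)) :=
          ((continuous_ofReal.tendsto 0).comp ht0).mul
            (((hχ.Z A A').1.tendsto 0).comp (hdil0 h))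
        have h3 := (h1.mul_const (Z A A' ψ h)).add (h2.const_mul (ψ h))
        simpa using h3
      exact ((hl 0).const_mul _).add ((hl 1).const_mul _))
  simp only [hzero] at hlim
  exact (tendsto_nhds_unique hlim tendsto_const_nhds)

end QHeis

namespace QHeis

/-! ### Decay and derivatives of the kernels -/

/-- The weight `1 + ‖y‖² + ‖s‖`. -/
noncomputable def wt (h : H) : ℝ := 1 + ‖h.1‖ ^ 2 + ‖h.2‖

theorem one_le_wt (h : H) : 1 ≤ wt h := by
  unfold wt
  have := norm_nonneg h.2
  nlinarith [sq_nonneg ‖h.1‖]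

theorem wt_pos (h : H) : 0 < wt h := one_pos.trans_le (one_le_wt h)

@[fun_prop]
theorem continuous_wt : Continuous wt := by unfold wt; fun_prop

theorem continuous_wt_inv_pow (m : ℕ) : Continuous fun h => (wt h ^ m)⁻¹ :=
  Continuous.inv₀ (by fun_prop) fun h => pow_ne_zero _ (wt_pos h).ne'

theorem wt_inv_pow_anti {m n : ℕ} (hmn : m ≤ n) (h : H) : (wt h ^ n)⁻¹ ≤ (wt h ^ m)⁻¹ :=
  inv_anti₀ (pow_pos (wt_pos h) _) (pow_le_pow_right₀ (one_le_wt h) hmn)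

/-- `wt⁻⁶` is integrable, since `6 > 5 = 4 / 2 + 3`. -/
theorem integrable_wt_inv_pow_six : Integrable fun h => (wt h ^ 6)⁻¹ := by
  have h1 : Integrable (fun y : E4 => (1 + ‖y‖) ^ (-(5 : ℝ))) :=
    integrable_one_add_norm (by simp; norm_num)
  have h2 : Integrable (fun s : E3 => (1 + ‖s‖) ^ (-(7 / 2 : ℝ))) :=
    integrable_one_add_norm (by simp; norm_num)
  have h3 : Integrable (fun h : H => 2 ^ (5 / 2 : ℝ) *
      ((1 + ‖h.1‖) ^ (-(5 : ℝ)) * (1 + ‖h.2‖) ^ (-(7 / 2 : ℝ)))) := (h1.mul_prod h2).const_mul _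
  refine h3.mono' (continuous_wt_inv_pow 6).aestronglyMeasurable (Eventually.of_forall fun h => ?_)
  have hw := wt_pos h
  have hy := norm_nonneg h.1
  have hs := norm_nonneg h.2
  rw [Real.norm_eq_abs, abs_of_pos (inv_pos.2 (pow_pos hw 6))]
  have e1 : (wt h ^ 6)⁻¹ = wt h ^ (-(5 / 2 : ℝ)) * wt h ^ (-(7 / 2 : ℝ)) := by
    rw [← Real.rpow_add hw, ← Real.rpow_natCast, ← Real.rpow_neg hw.le]
    norm_num
  have e2 : wt h ^ (-(5 / 2 : ℝ)) ≤ 2 ^ (5 / 2 : ℝ) * (1 + ‖h.1‖) ^ (-(5 : ℝ)) := by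
    have hb : (1 + ‖h.1‖) ^ 2 / 2 ≤ wt h := by
      unfold wt
      nlinarith [sq_nonneg (‖h.1‖ - 1)]
    calc wt h ^ (-(5 / 2 : ℝ)) ≤ ((1 + ‖h.1‖) ^ 2 / 2) ^ (-(5 / 2 : ℝ)) :=
          Real.rpow_le_rpow_of_nonpos (by positivity) hb (by norm_num)
      _ = 2 ^ (5 / 2 : ℝ) * (1 + ‖h.1‖) ^ (-(5 : ℝ)) := by
          rw [Real.div_rpow (by positivity) (by norm_num), ← Real.rpow_natCast,
            ← Real.rpow_mul (by positivity), Real.rpow_neg (by norm_num : (0 : ℝ) ≤ 2), div_inv_eq_mul,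
            mul_comm]
          norm_num
  have e3 : wt h ^ (-(7 / 2 : ℝ)) ≤ (1 + ‖h.2‖) ^ (-(7 / 2 : ℝ)) :=
    Real.rpow_le_rpow_of_nonpos (by positivity) (by unfold wt; nlinarith [sq_nonneg ‖h.1‖])
      (by norm_num)
  rw [e1, ← mul_assoc]
  gcongr

theorem integrable_wt_inv_pow {m : ℕ} (hm : 6 ≤ m) : Integrable fun h => (wt h ^ m)⁻¹ :=
  integrable_wt_inv_pow_six.mono' (continuous_wt_inv_pow m).aestronglyMeasurable
    (Eventually.of_forall fun h => by
      rw [Real.norm_eq_abs, abs_of_pos (inv_pos.2 (pow_pos (wt_pos h) _))]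
      exact wt_inv_pow_anti hm h)

theorem memLp_wt_inv_pow {m : ℕ} (hm : 3 ≤ m) : MemLp (fun h => (wt h ^ m)⁻¹) 2 volume := by
  rw [memLp_two_iff_integrable_sq (continuous_wt_inv_pow m).aestronglyMeasurable]
  simp only [← inv_pow, ← pow_mul]
  simpa using integrable_wt_inv_pow (m := m * 2) (by omega)

theorem memLp_of_le_wt {F : Type*} [NormedAddCommGroup F] {f : H → F} (hf : Continuous f)
    (C : ℝ) {m : ℕ} (hm : 3 ≤ m) (hle : ∀ h, ‖f h‖ ≤ C * (wt h ^ m)⁻¹) : MemLp f 2 volume :=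
  ((memLp_wt_inv_pow hm).const_mul C).mono' hf.aestronglyMeasurable (Eventually.of_forall hle)

theorem norm_le_wt (h : H) : ‖h.1‖ ≤ wt h := by
  unfold wt
  nlinarith [sq_nonneg (‖h.1‖ - 1), norm_nonneg h.2]

theorem norm_sq_le_wt (h : H) : ‖h.1‖ ^ 2 ≤ wt h := by
  unfold wt
  nlinarith [norm_nonneg h.2]

/-- The kernel `∫ Q(τ) (b ‖y‖² + ε + i τ·s)⁻ᵐ dτ`; the sign of `s` is the one that occurs when
a convolution kernel is evaluated at the inverse of `(y, s)`. -/
noncomputable def ker (m : ℕ) (Q : E3 → ℂ) (b ε : ℝ) (h : H) : ℂ :=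
  planeInt m Q (b * ‖h.1‖ ^ 2 + ε, -h.2)

theorem ker_eq (m : ℕ) (Q : E3 → ℂ) (b ε : ℝ) (h : H) :
    ker m Q b ε h = planeInt m Q (radial b ε (ginv h)) := by
  simp [ker, radial, ginv]

theorem ker_mem {b ε : ℝ} (hb : 0 ≤ b) (hε : 0 < ε) (h : H) :
    (b * ‖h.1‖ ^ 2 + ε, -h.2) ∈ upper := mem_upper.2 (by positivity)

theorem contDiff_ker (m : ℕ) {Q : E3 → ℂ} (hQ : ContDiff ℝ ∞ Q) {b ε : ℝ} (hb : 0 ≤ b)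
    (hε : 0 < ε) : ContDiff ℝ ∞ (ker m Q b ε) :=
  (contDiffOn_planeInt m hQ).comp_contDiff
    (((contDiff_const.mul (contDiff_fst.norm_sq ℝ)).add contDiff_const).prodMk contDiff_snd.neg)
    (ker_mem hb hε)

/-- The decay of the kernels, locally uniform in `b` and `ε`. -/
theorem ker_bound (m : ℕ) {Q : E3 → ℂ} (hQ : ContDiff ℝ ∞ Q) {c : ℝ} (hc : 0 < c) (hc1 : c ≤ 1) :
    ∃ C, 0 ≤ C ∧ ∀ b ε, c ≤ b → c ≤ ε → ∀ h, ‖ker m Q b ε h‖ ≤ C * (wt h ^ m)⁻¹ := by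
  obtain ⟨C, hC0, hC⟩ := planeInt_bound m hQ
  refine ⟨C * (c ^ m)⁻¹, by positivity, fun b ε hb hε h => ?_⟩
  refine (hC _ (upper_subset_bdUpper (ker_mem (hc.le.trans hb) (hc.trans_le hε) h))).trans ?_
  rw [mul_assoc, ← mul_inv, ← mul_pow]
  have hw := wt_pos h
  have hle : c * wt h ≤ b * ‖h.1‖ ^ 2 + ε + ‖-h.2‖ := by
    have h1 : c * ‖h.1‖ ^ 2 ≤ b * ‖h.1‖ ^ 2 := mul_le_mul_of_nonneg_right hb (sq_nonneg _)
    have h2 : c * ‖h.2‖ ≤ ‖h.2‖ := mul_le_of_le_one_left (norm_nonneg _) hc1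
    rw [norm_neg, wt]
    linarith
  gcongr

theorem ker_bound' (m : ℕ) {Q : E3 → ℂ} (hQ : ContDiff ℝ ∞ Q) {b ε : ℝ} (hb : 0 < b)
    (hε : 0 < ε) : ∃ C, 0 ≤ C ∧ ∀ h, ‖ker m Q b ε h‖ ≤ C * (wt h ^ m)⁻¹ := by
  obtain ⟨C, hC0, hC⟩ := ker_bound m hQ (c := min (min b ε) 1) (by positivity) (min_le_right _ _)
  exact ⟨C, hC0, hC b ε ((min_le_left _ _).trans (min_le_left _ _))
    ((min_le_left _ _).trans (min_le_right _ _))⟩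

theorem memLp_ker {m : ℕ} (hm : 3 ≤ m) {Q : E3 → ℂ} (hQ : ContDiff ℝ ∞ Q) {b ε : ℝ} (hb : 0 < b)
    (hε : 0 < ε) : MemLp (ker m Q b ε) 2 volume := by
  obtain ⟨C, _, hC⟩ := ker_bound' m hQ hb hε
  exact memLp_of_le_wt (contDiff_ker m hQ hb.le hε).continuous C hm hC

/-- Kernels with a linear factor, the ones that occur in the horizontal derivatives. -/
theorem memLp_coord_mul_ker {m : ℕ} (hm : 4 ≤ m) {Q : E3 → ℂ} (hQ : ContDiff ℝ ∞ Q) {b ε : ℝ}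
    (hb : 0 < b) (hε : 0 < ε) {P : H → ℂ} (hP : Continuous P) {K : ℝ}
    (hPK : ∀ h, ‖P h‖ ≤ K * wt h) : MemLp (fun h => P h * ker m Q b ε h) 2 volume := by
  obtain ⟨C, hC0, hC⟩ := ker_bound' m hQ hb hε
  refine memLp_of_le_wt (hP.mul (contDiff_ker m hQ hb.le hε).continuous) (K * C) (m := m - 1)
    (by omega) fun h => ?_
  have hw := wt_pos h
  obtain ⟨n, rfl⟩ : ∃ n, m = n + 1 := ⟨m - 1, by omega⟩
  rw [norm_mul]
  calc ‖P h‖ * ‖ker (n + 1) Q b ε h‖ ≤ (K * wt h) * (C * (wt h ^ (n + 1))⁻¹) :=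
        mul_le_mul (hPK h) (hC h) (norm_nonneg _) ((norm_nonneg _).trans (hPK h))
    _ = K * C * (wt h ^ (n + 1 - 1))⁻¹ := by
        rw [Nat.add_sub_cancel]
        field_simp
        ring

theorem planeInt_congr (m : ℕ) {Q Q' : E3 → ℂ} (hQ : ContDiff ℝ ∞ Q) (hQ' : ContDiff ℝ ∞ Q')
    (h : ∀ τ : Metric.sphere (0 : E3) 1, Q τ = Q' τ) {p : ℝ × E3} (hp : p ∈ upper) :
    planeInt m Q p = planeInt m Q' p := by
  rw [planeInt_eq m hQ.continuous hp, planeInt_eq m hQ'.continuous hp]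
  simp only [h]

theorem planeInt_add (m : ℕ) {Q Q' : E3 → ℂ} (hQ : ContDiff ℝ ∞ Q) (hQ' : ContDiff ℝ ∞ Q')
    {p : ℝ × E3} (hp : p ∈ upper) :
    planeInt m (fun τ => Q τ + Q' τ) p = planeInt m Q p + planeInt m Q' p := by
  rw [planeInt_eq m hQ.continuous hp, planeInt_eq m hQ'.continuous hp,
    planeInt_eq m (hQ.add hQ').continuous hp, ← integral_add
      (integrable_sphInt (differentiableOn_inv_pow m).continuousOn hQ.continuous hp)
      (integrable_sphInt (differentiableOn_inv_pow m).continuousOn hQ'.continuous hp)]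
  simp only [add_mul]

theorem planeInt_const_mul (m : ℕ) {Q : E3 → ℂ} (hQ : ContDiff ℝ ∞ Q) (c : ℂ)
    {p : ℝ × E3} (hp : p ∈ upper) :
    planeInt m (fun τ => c * Q τ) p = c * planeInt m Q p := by
  rw [planeInt_eq m hQ.continuous hp, planeInt_eq m (contDiff_const.mul hQ).continuous hp,
    ← integral_const_mul]
  simp only [mul_assoc]

theorem Y_ker (m : ℕ) {Q : E3 → ℂ} (hQ : ContDiff ℝ ∞ Q) {b ε : ℝ} (hb : 0 ≤ b) (hε : 0 < ε)
    (j : Fin 4) (h : H) :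
    Y j (ker m Q b ε) h = -m * (2 * b * h.1 j * ker (m + 1) Q b ε h +
      2 * I * ∑ l, (B h.1 (EuclideanSpace.single j 1) l : ℂ) *
        ker (m + 1) (fun τ => τ l * Q τ) b ε h) := by
  have h1 : HasFDerivAt (fun h : H => (b * ‖h.1‖ ^ 2 + ε, -h.2))
      (((b • (2 : ℝ) • (innerSL ℝ h.1).comp (ContinuousLinearMap.fst ℝ E4 E3))).prod
        (-ContinuousLinearMap.snd ℝ E4 E3)) h := by
    have h2 : HasFDerivAt (fun h : H => ‖h.1‖ ^ 2)
        ((2 : ℝ) • (innerSL ℝ h.1).comp (ContinuousLinearMap.fst ℝ E4 E3)) h := by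
      have := (hasFDerivAt_fst (𝕜 := ℝ) (p := h)).norm_sq
      exact this.congr_fderiv ((two_nsmul _).trans (two_smul ℝ _).symm)
    exact ((h2.const_mul b).add_const ε).prodMk hasFDerivAt_snd.neg
  have h3 : HasFDerivAt (ker m Q b ε) _ h :=
    (hasFDerivAt_planeInt m hQ (ker_mem hb hε h)).comp h h1
  rw [Y_eq, h3.fderiv]
  simp only [hvec, planeDeriv, ker, ContinuousLinearMap.comp_apply, add_apply, smul_apply,
    ContinuousLinearMap.prod_apply, ContinuousLinearMap.coe_fst', ContinuousLinearMap.coe_snd',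
    neg_apply, Fin.sum_univ_three, innerSL_apply_apply, EuclideanSpace.inner_single_right,
    PiLp.proj_apply, PiLp.neg_apply, PiLp.smul_apply, smul_eq_mul, ofRealCLM_apply]
  simp
  ring

theorem hasDerivAt_ker (m : ℕ) {Q : E3 → ℂ} (hQ : ContDiff ℝ ∞ Q) {b ε : ℝ} (hb : 0 ≤ b)
    (hε : 0 < ε) (h : H) :
    HasDerivAt (fun b => ker m Q b ε h) (-m * ((‖h.1‖ ^ 2 : ℝ) : ℂ) * ker (m + 1) Q b ε h) b := by
  have h1 : HasDerivAt (fun b : ℝ => (b * ‖h.1‖ ^ 2 + ε, -h.2)) (‖h.1‖ ^ 2, (0 : E3)) b := by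
    have := ((hasDerivAt_id b).mul_const (‖h.1‖ ^ 2)).add_const ε
    simp only [one_mul] at this
    exact this.prodMk (hasDerivAt_const b _)
  have h3 := (hasFDerivAt_planeInt m hQ (ker_mem hb hε h)).comp_hasDerivAt b h1
  refine h3.congr_deriv ?_
  simp [planeDeriv, ker]
  ring

end QHeis

namespace QHeis

/-! ### Test functions for the Cauchy-Fueter equation built from plane waves -/

/-- The complex conjugates of the coordinates `∑_j zc A A' j y_j` dual to `Z_A^{A'}`. -/
noncomputable def zbar (A A' : Fin 2) (h : H) : ℂ :=
  ∑ j, (starRingEnd ℂ) (zc A A' j) * (h.1 j : ℂ)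

/-- `zbar` as a real linear map. -/
noncomputable def zbarL (A A' : Fin 2) : H →L[ℝ] ℂ :=
  ∑ j, (starRingEnd ℂ) (zc A A' j) •
    ofRealCLM.comp ((EuclideanSpace.proj j).comp (ContinuousLinearMap.fst ℝ E4 E3))

theorem zbar_eq (A A' : Fin 2) : zbar A A' = zbarL A A' := by
  ext h
  simp [zbar, zbarL]

theorem contDiff_zbar (A A' : Fin 2) {n : WithTop ℕ∞} : ContDiff ℝ n (zbar A A') := by
  rw [zbar_eq]; exact (zbarL A A').contDiff

theorem Y_zbar (A A' : Fin 2) (j : Fin 4) (h : H) :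
    Y j (zbar A A') h = (starRingEnd ℂ) (zc A A' j) := by
  rw [Y_eq, zbar_eq, ContinuousLinearMap.fderiv, ← zbar_eq]
  simp [zbar, hvec, PiLp.single_apply, apply_ite]

theorem Z_zbar (A A' A'' : Fin 2) (h : H) :
    Z A A' (zbar A A'') h = ∑ j, zc A A' j * (starRingEnd ℂ) (zc A A'' j) := by
  simp only [Z_eq, Y_zbar]

theorem sum_zc_mul_conj (A' A'' : Fin 2) :
    ∑ A, ∑ j, zc A A' j * (starRingEnd ℂ) (zc A A'' j) = if A' = A'' then 4 else 0 := by
  fin_cases A' <;> fin_cases A'' <;> simp [zc, Fin.sum_univ_four] <;> norm_num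

theorem zbar_bound (A A' : Fin 2) (h : H) : ‖zbar A A' h‖ ≤ ‖zbarL A A'‖ * ‖h.1‖ := by
  have : zbar A A' h = zbarL A A' (h.1, 0) := by rw [← zbar_eq]; rfl
  rw [this]
  refine (ContinuousLinearMap.le_opNorm _ _).trans_eq ?_
  simp [Prod.norm_def]

/-- The quaternionic matrix with the entries `∑_j zc A A' j y_j` is `‖y‖` times a unitary one. -/
theorem zbar_mul_coord (A' A'' : Fin 2) (h : H) :
    ∑ A, zbar A A'' h * ∑ j, zc A A' j * (h.1 j : ℂ) =
      if A' = A'' then ((‖h.1‖ ^ 2 : ℝ) : ℂ) else 0 := by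
  rw [EuclideanSpace.norm_sq_eq]
  have hI := I_sq
  fin_cases A' <;> fin_cases A'' <;> simp [zbar, zc, Fin.sum_univ_four] <;> grind

/-- The matrices `M_l` with `∑_l τ_l M_l = ((τ₁, q̄), (q, -τ₁))`, `q = iτ₂ - τ₃`. -/
noncomputable def pauli : Fin 3 → Fin 2 → Fin 2 → ℂ :=
  ![![![1, 0], ![0, -1]], ![![0, -I], ![I, 0]], ![![0, -1], ![-1, 0]]]

/-- The group structure enters here: the rotation of `y` by the structure matrix `B^l` acts on the
quaternionic matrix of `zbar_mul_coord` as multiplication by `pauli l`. -/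
theorem zbar_mul_B (A' A'' : Fin 2) (l : Fin 3) (h : H) :
    I * ∑ A, zbar A A'' h * ∑ j, zc A A' j * (B h.1 (EuclideanSpace.single j 1) l : ℂ) =
      ((‖h.1‖ ^ 2 : ℝ) : ℂ) * pauli l A'' A' := by
  rw [EuclideanSpace.norm_sq_eq]
  have hI := I_sq
  fin_cases l <;> fin_cases A' <;> fin_cases A'' <;>
    simp [zbar, zc, pauli, B, Bmat, Fin.sum_univ_four, Matrix.of_apply] <;> grind

/-- The divergence of the vector-valued test function used below. The hypothesis says that the row
`(g 0, g 1)` is a left eigenvector of `((τ₁, q̄), (q, -τ₁))` for the eigenvalue `σ`. -/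
theorem sum_Z_zbar_mul_ker (m : ℕ) {g : Fin 2 → E3 → ℂ} (hg : ∀ A, ContDiff ℝ ∞ (g A)) {σ : ℝ}
    (hσ : ∀ (A' : Fin 2) (τ : Metric.sphere (0 : E3) 1),
      ∑ l, ∑ A'', pauli l A'' A' * ((τ : E3) l * g A'' τ) = σ * g A' τ)
    {b ε : ℝ} (hb : 0 ≤ b) (hε : 0 < ε) (A' : Fin 2) (h : H) :
    ∑ A, Z A A' (fun h => ∑ A'', zbar A A'' h * ker m (g A'') b ε h) h =
      4 * ker m (g A') b ε h -
        2 * m * (b + σ) * ((‖h.1‖ ^ 2 : ℝ) : ℂ) * ker (m + 1) (g A') b ε h := by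
  have hk := fun A'' => (contDiff_ker m (hg A'') hb hε).differentiable (by simp) h
  have hz := fun A A'' => (contDiff_zbar A A'' (n := 1)).differentiable one_ne_zero h
  have hsumZ : ∀ (A : Fin 2) (F : Fin 2 → H → ℂ), (∀ A'', DifferentiableAt ℝ (F A'') h) →
      Z A A' (fun h => ∑ A'', F A'' h) h = ∑ A'', Z A A' (F A'') h := by
    intro A F hF
    simp only [Z_eq, Y_eq]
    rw [fderiv_fun_sum fun i _ => hF i, Finset.sum_comm]
    refine Finset.sum_congr rfl fun j _ => ?_
    rw [← Finset.mul_sum, sum_apply]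
  have hZk : ∀ A A'', Z A A' (ker m (g A'') b ε) h =
      -2 * m * (b * (∑ j, zc A A' j * (h.1 j : ℂ)) * ker (m + 1) (g A'') b ε h +
        I * ∑ l, (∑ j, zc A A' j * (B h.1 (EuclideanSpace.single j 1) l : ℂ)) *
          ker (m + 1) (fun τ => τ l * g A'' τ) b ε h) := by
    intro A A''
    simp only [Z_eq, Y_ker m (hg A'') hb hε, Fin.sum_univ_four, Fin.sum_univ_three]
    ring
  -- The eigenvector equation under the integral sign.
  have hlin : ∑ l, ∑ A'', pauli l A'' A' * ker (m + 1) (fun τ => τ l * g A'' τ) b ε h =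
      σ * ker (m + 1) (g A') b ε h := by
    have hp := ker_mem hb hε h
    unfold ker
    have e1 : ∀ l A'', pauli l A'' A' * planeInt (m + 1) (fun τ => τ l * g A'' τ)
        (b * ‖h.1‖ ^ 2 + ε, -h.2) = ∫ τ : Metric.sphere (0 : E3) 1,
        pauli l A'' A' * ((τ : E3) l * g A'' τ) *
          (phase (b * ‖h.1‖ ^ 2 + ε, -h.2) τ ^ (m + 1))⁻¹ ∂sphereMeasure := fun l A'' => by
      rw [planeInt_eq _ (contDiff_coord_mul l (hg A'')).continuous hp, ← integral_const_mul]
      simp only [mul_assoc]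
    simp only [e1]
    have e2 : ∀ l A'', Integrable (fun τ : Metric.sphere (0 : E3) 1 =>
        pauli l A'' A' * ((τ : E3) l * g A'' τ) *
          (phase (b * ‖h.1‖ ^ 2 + ε, -h.2) τ ^ (m + 1))⁻¹) sphereMeasure := fun l A'' =>
      integrable_sphInt (Q := fun τ => pauli l A'' A' * ((τ : E3) l * g A'' τ))
        (differentiableOn_inv_pow (m + 1)).continuousOn
        (continuous_const.mul (contDiff_coord_mul l (hg A'')).continuous) hp
    simp_rw [← integral_finsetSum _ fun A'' _ => e2 _ A'']
    rw [← integral_finsetSum _ fun l _ => integrable_finsetSum _ fun A'' _ => e2 l A'',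
      planeInt_eq _ (hg A').continuous hp, ← integral_const_mul]
    refine integral_congr_ae (Eventually.of_forall fun τ => ?_)
    simp only [← Finset.sum_mul, hσ]
    rw [mul_assoc]
  have key : ∀ A, Z A A' (fun h => ∑ A'', zbar A A'' h * ker m (g A'') b ε h) h =
      ∑ A'', (zbar A A'' h * Z A A' (ker m (g A'') b ε) h +
        ker m (g A'') b ε h * ∑ j, zc A A' j * (starRingEnd ℂ) (zc A A'' j)) := by
    intro A
    rw [hsumZ A (fun A'' h => zbar A A'' h * ker m (g A'') b ε h)
      fun A'' => (hz A A'').mul (hk A'')]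
    exact Finset.sum_congr rfl fun A'' _ => by rw [Z_mul (hz A A'') (hk A''), Z_zbar]
  have t1 : ∑ A : Fin 2, ∑ A'' : Fin 2, ker m (g A'') b ε h *
      ∑ j, zc A A' j * (starRingEnd ℂ) (zc A A'' j) = 4 * ker m (g A') b ε h := by
    rw [Finset.sum_comm]
    simp only [← Finset.mul_sum, sum_zc_mul_conj]
    simp [mul_comm]
  have t2 : ∑ A : Fin 2, ∑ A'' : Fin 2, zbar A A'' h * Z A A' (ker m (g A'') b ε) h =
      -2 * m * (b * (((‖h.1‖ ^ 2 : ℝ) : ℂ) * ker (m + 1) (g A') b ε h) +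
        ((‖h.1‖ ^ 2 : ℝ) : ℂ) * (σ * ker (m + 1) (g A') b ε h)) := by
    have s1 : ∑ A'' : Fin 2, (∑ A, zbar A A'' h * ∑ j, zc A A' j * (h.1 j : ℂ)) *
        ker (m + 1) (g A'') b ε h = ((‖h.1‖ ^ 2 : ℝ) : ℂ) * ker (m + 1) (g A') b ε h := by
      simp only [zbar_mul_coord]
      simp
    have s2 : ∑ l, ∑ A'' : Fin 2, (I * ∑ A, zbar A A'' h * ∑ j, zc A A' j *
        (B h.1 (EuclideanSpace.single j 1) l : ℂ)) *
          ker (m + 1) (fun τ => τ l * g A'' τ) b ε h =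
        ((‖h.1‖ ^ 2 : ℝ) : ℂ) * (σ * ker (m + 1) (g A') b ε h) := by
      simp only [zbar_mul_B, mul_assoc, ← Finset.mul_sum, hlin]
    rw [← s1, ← s2]
    simp only [hZk, Fin.sum_univ_two, Fin.sum_univ_three]
    ring
  simp only [key, Finset.sum_add_distrib, t1, t2]
  ring

end QHeis

namespace QHeis

/-! ### The conservation law in the width parameter -/

/-- The pairing of a function on `H` with the kernel `ker 5 Q b ε`, as a function of the
width `b`. -/
noncomputable def pairK (u : H → ℂ) (Q : E3 → ℂ) (ε b : ℝ) : ℂ := ∫ h, u h * ker 5 Q b ε h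

theorem integrable_mul_ker {u : H → ℂ} (hu : MemLp u 2 volume) {m : ℕ} (hm : 3 ≤ m) {Q : E3 → ℂ}
    (hQ : ContDiff ℝ ∞ Q) {b ε : ℝ} (hb : 0 < b) (hε : 0 < ε) :
    Integrable fun h => u h * ker m Q b ε h :=
  hu.integrable_mul (memLp_ker hm hQ hb hε)

theorem memLp_norm_sq_mul_ker {Q : E3 → ℂ} (hQ : ContDiff ℝ ∞ Q) {b ε : ℝ} (hb : 0 < b)
    (hε : 0 < ε) : MemLp (fun h => ((‖h.1‖ ^ 2 : ℝ) : ℂ) * ker 6 Q b ε h) 2 volume :=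
  memLp_coord_mul_ker (by norm_num) hQ hb hε (P := fun h => ((‖h.1‖ ^ 2 : ℝ) : ℂ)) (K := 1)
    (by fun_prop) fun h => by
      rw [norm_real, Real.norm_eq_abs, abs_of_nonneg (sq_nonneg _), one_mul]
      exact norm_sq_le_wt h

theorem hasDerivAt_pairK {u : H → ℂ} (hu : MemLp u 2 volume) {Q : E3 → ℂ} (hQ : ContDiff ℝ ∞ Q)
    {b ε : ℝ} (hb : 0 < b) (hε : 0 < ε) :
    HasDerivAt (pairK u Q ε)
      (-5 * ∫ h, u h * (((‖h.1‖ ^ 2 : ℝ) : ℂ) * ker 6 Q b ε h)) b := by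
  obtain ⟨C, hC0, hC⟩ := ker_bound 6 hQ (c := min (min (b / 2) ε) 1) (by positivity)
    (min_le_right _ _)
  have hs : Set.Ioi (b / 2) ∈ 𝓝 b := Ioi_mem_nhds (half_lt_self hb)
  have hpos : ∀ c ∈ Set.Ioi (b / 2), 0 < c := fun c hc => (half_pos hb).trans hc
  have key := hasDerivAt_integral_of_dominated_loc_of_deriv_le (μ := (volume : Measure H))
    (F := fun b h => u h * ker 5 Q b ε h)
    (F' := fun b h => u h * (-((5 : ℕ) : ℂ) * ((‖h.1‖ ^ 2 : ℝ) : ℂ) * ker (5 + 1) Q b ε h))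
    (x₀ := b) (bound := fun h => ‖u h‖ * (5 * C * (wt h ^ 5)⁻¹)) hs
    (by
      filter_upwards [hs] with c hc
      exact (integrable_mul_ker hu (by norm_num) hQ (hpos c hc) hε).1)
    (integrable_mul_ker hu (by norm_num) hQ hb hε)
    (hu.1.mul ((continuous_const.mul (by fun_prop)).mul
      (contDiff_ker 6 hQ hb.le hε).continuous).aestronglyMeasurable)
    (Eventually.of_forall fun h c hc => by
      have hw := wt_pos h
      rw [norm_mul, norm_mul, norm_mul, norm_neg, norm_real, Real.norm_eq_abs,
        abs_of_nonneg (sq_nonneg _), norm_natCast]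
      have h1 := hC c ε ((min_le_left _ _).trans ((min_le_left _ _).trans (le_of_lt hc)))
        ((min_le_left _ _).trans (min_le_right _ _)) h
      have h2 := norm_sq_le_wt h
      refine mul_le_mul_of_nonneg_left ?_ (norm_nonneg _)
      calc _ ≤ ((5 : ℕ) : ℝ) * wt h * (C * (wt h ^ 6)⁻¹) := by gcongr
        _ = 5 * C * (wt h ^ 5)⁻¹ := by
          field_simp
          push_cast
          ring)
    (hu.norm.integrable_mul ((memLp_wt_inv_pow (by norm_num)).const_mul (5 * C)))
    (Eventually.of_forall fun h c hc => (hasDerivAt_ker 5 hQ (hpos c hc).le hε h).const_mul _)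
  refine key.2.congr_deriv ?_
  rw [← integral_const_mul]
  congr 1
  ext h
  push_cast
  ring

theorem B_single_bound (j : Fin 4) : ∃ K : ℝ, 0 ≤ K ∧ ∀ (x : E4) (l : Fin 3),
    |B x (EuclideanSpace.single j 1) l| ≤ K * ‖x‖ := by
  let L : E4 →L[ℝ] E3 := LinearMap.toContinuousLinearMap
    { toFun := fun x => B x (EuclideanSpace.single j 1)
      map_add' := fun x y => B_add_left x y _
      map_smul' := fun c x => B_smul_left c x _ }
  refine ⟨‖L‖, norm_nonneg _, fun x l => ?_⟩
  exact (PiLp.norm_apply_le (L x) l).trans (L.le_opNorm x)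

theorem Y_fun_sum {ι : Type*} (t : Finset ι) {F : ι → H → ℂ} {h : H}
    (hF : ∀ a, DifferentiableAt ℝ (F a) h) (j : Fin 4) :
    Y j (fun h => ∑ a ∈ t, F a h) h = ∑ a ∈ t, Y j (F a) h := by
  simp only [Y_eq]
  rw [fderiv_fun_sum fun a _ => hF a, sum_apply]

theorem contDiff_zbar_mul_ker {Q : E3 → ℂ} (hQ : ContDiff ℝ ∞ Q) {b ε : ℝ} (hb : 0 < b)
    (hε : 0 < ε) (A A' : Fin 2) : ContDiff ℝ ∞ fun h => zbar A A' h * ker 5 Q b ε h :=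
  (contDiff_zbar A A').mul (contDiff_ker 5 hQ hb.le hε)

theorem memLp_zbar_mul_ker {Q : E3 → ℂ} (hQ : ContDiff ℝ ∞ Q) {b ε : ℝ} (hb : 0 < b)
    (hε : 0 < ε) (A A' : Fin 2) : MemLp (fun h => zbar A A' h * ker 5 Q b ε h) 2 volume :=
  memLp_coord_mul_ker (by norm_num) hQ hb hε (contDiff_zbar A A' (n := 1)).continuous
    (K := ‖zbarL A A'‖) fun h => (zbar_bound A A' h).trans
      (mul_le_mul_of_nonneg_left (norm_le_wt h) (norm_nonneg _))

theorem memLp_Y_zbar_mul_ker {Q : E3 → ℂ} (hQ : ContDiff ℝ ∞ Q) {b ε : ℝ} (hb : 0 < b)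
    (hε : 0 < ε) (A A' : Fin 2) (j : Fin 4) :
    MemLp (Y j fun h => zbar A A' h * ker 5 Q b ε h) 2 volume := by
  obtain ⟨K, hK0, hK⟩ := B_single_bound j
  have e : (Y j fun h => zbar A A' h * ker 5 Q b ε h) = fun h =>
      -5 * (2 * b * ((zbar A A' h * h.1 j) * ker 6 Q b ε h) + 2 * I * ∑ l,
        (zbar A A' h * (B h.1 (EuclideanSpace.single j 1) l : ℂ)) *
          ker 6 (fun τ => τ l * Q τ) b ε h) +
      (starRingEnd ℂ) (zc A A' j) * ker 5 Q b ε h := by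
    ext h
    rw [Y_mul ((contDiff_zbar A A' (n := 1)).differentiable one_ne_zero h)
      ((contDiff_ker 5 hQ hb.le hε).differentiable (by simp) h) j, Y_ker 5 hQ hb.le hε, Y_zbar]
    simp only [Fin.sum_univ_three]
    push_cast
    ring
  rw [e]
  have hzc := (contDiff_zbar A A' (n := 1)).continuous
  have m1 : MemLp (fun h => (zbar A A' h * h.1 j) * ker 6 Q b ε h) 2 volume := by
    refine memLp_coord_mul_ker (by norm_num) hQ hb hε (K := ‖zbarL A A'‖)
      (hzc.mul (by fun_prop)) fun h => ?_
    rw [norm_mul, norm_real]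
    calc _ ≤ (‖zbarL A A'‖ * ‖h.1‖) * ‖h.1‖ :=
          mul_le_mul (zbar_bound A A' h) (PiLp.norm_apply_le _ j) (norm_nonneg _) (by positivity)
      _ = ‖zbarL A A'‖ * ‖h.1‖ ^ 2 := by ring
      _ ≤ _ := mul_le_mul_of_nonneg_left (norm_sq_le_wt h) (norm_nonneg _)
  have m2 : ∀ l, MemLp (fun h => (zbar A A' h * (B h.1 (EuclideanSpace.single j 1) l : ℂ)) *
      ker 6 (fun τ => τ l * Q τ) b ε h) 2 volume := by
    intro l
    have hB : Continuous fun h : H => (B h.1 (EuclideanSpace.single j 1) l : ℂ) := by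
      unfold B
      fun_prop
    refine memLp_coord_mul_ker (by norm_num) (contDiff_coord_mul l hQ) hb hε
      (K := ‖zbarL A A'‖ * K) (hzc.mul hB) fun h => ?_
    rw [norm_mul, norm_real]
    calc _ ≤ (‖zbarL A A'‖ * ‖h.1‖) * (K * ‖h.1‖) :=
          mul_le_mul (zbar_bound A A' h) (hK h.1 l) (abs_nonneg _) (by positivity)
      _ = ‖zbarL A A'‖ * K * ‖h.1‖ ^ 2 := by ring
      _ ≤ _ := mul_le_mul_of_nonneg_left (norm_sq_le_wt h) (by positivity)
  exact (((m1.const_mul (2 * (b : ℂ))).add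
    ((memLp_finsetSum Finset.univ fun l _ => m2 l).const_mul (2 * I))).const_mul (-5)).add
      ((memLp_ker (by norm_num) hQ hb hε).const_mul _)

/-- The weak Cauchy-Fueter equation for the test function of `sum_Z_zbar_mul_ker`. -/
theorem IsKCF.integral_ker_eq_zero {k : ℕ} {f : H → V k} (hf : IsKCF f) (hf2 : MemLp f 2 volume)
    (i : Fin k) {g : Fin 2 → E3 → ℂ} (hg : ∀ A, ContDiff ℝ ∞ (g A)) {σ : ℝ}
    (hσ : ∀ (A' : Fin 2) (τ : Metric.sphere (0 : E3) 1),
      ∑ l, ∑ A'', pauli l A'' A' * ((τ : E3) l * g A'' τ) = σ * g A' τ)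
    {ε b : ℝ} (hε : 0 < ε) (hb : 0 < b) :
    ∫ h, (f h i.castSucc * (4 * ker 5 (g 0) b ε h -
        2 * ((5 : ℕ) : ℂ) * (b + σ) * ((‖h.1‖ ^ 2 : ℝ) : ℂ) * ker (5 + 1) (g 0) b ε h) +
      f h i.succ * (4 * ker 5 (g 1) b ε h -
        2 * ((5 : ℕ) : ℂ) * (b + σ) * ((‖h.1‖ ^ 2 : ℝ) : ℂ) * ker (5 + 1) (g 1) b ε h)) = 0 := by
  have h0 := fun A => hf.integral_eq_zero hf2
    (ψ := fun h => ∑ A'', zbar A A'' h * ker 5 (g A'') b ε h)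
    (ContDiff.sum fun A'' _ => contDiff_zbar_mul_ker (hg A'') hb hε A A'')
    (memLp_finsetSum _ fun A'' _ => memLp_zbar_mul_ker (hg A'') hb hε A A'')
    (fun j => by
      have e : (Y j fun h => ∑ A'', zbar A A'' h * ker 5 (g A'') b ε h) =
          fun h => ∑ A'', Y j (fun h => zbar A A'' h * ker 5 (g A'') b ε h) h :=
        funext fun h => Y_fun_sum _ (fun A'' =>
          (contDiff_zbar_mul_ker (hg A'') hb hε A A'').differentiable (by simp) h) j
      rw [e]
      exact memLp_finsetSum _ fun A'' _ => memLp_Y_zbar_mul_ker (hg A'') hb hε A A'' j) i A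
  have hS := integral_add (h0 0).1 (h0 1).1
  rw [(h0 0).2, (h0 1).2, add_zero] at hS
  rw [← hS]
  refine integral_congr_ae (Eventually.of_forall fun h => ?_)
  simp only
  rw [← sum_Z_zbar_mul_ker 5 hg hσ hb.le hε 0 h, ← sum_Z_zbar_mul_ker 5 hg hσ hb.le hε 1 h,
    Fin.sum_univ_two, Fin.sum_univ_two]
  ring

theorem integral_mul_ker_comb {u : H → ℂ} (hu : MemLp u 2 volume) {Q : E3 → ℂ}
    (hQ : ContDiff ℝ ∞ Q) {ε b : ℝ} (hε : 0 < ε) (hb : 0 < b) (c : ℂ) :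
    Integrable (fun h => u h * (4 * ker 5 Q b ε h -
        2 * ((5 : ℕ) : ℂ) * c * ((‖h.1‖ ^ 2 : ℝ) : ℂ) * ker (5 + 1) Q b ε h)) ∧
    ∫ h, u h * (4 * ker 5 Q b ε h -
        2 * ((5 : ℕ) : ℂ) * c * ((‖h.1‖ ^ 2 : ℝ) : ℂ) * ker (5 + 1) Q b ε h) =
      4 * pairK u Q ε b - 10 * c * ∫ h, u h * (((‖h.1‖ ^ 2 : ℝ) : ℂ) * ker 6 Q b ε h) := by
  have i0 : Integrable fun h => 4 * (u h * ker 5 Q b ε h) :=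
    (integrable_mul_ker hu (m := 5) (by norm_num) hQ hb hε).const_mul 4
  have j0 : Integrable fun h => 10 * c * (u h * (((‖h.1‖ ^ 2 : ℝ) : ℂ) * ker 6 Q b ε h)) :=
    Integrable.const_mul (hu.integrable_mul (memLp_norm_sq_mul_ker hQ hb hε)) (10 * c)
  have e : (fun h => u h * (4 * ker 5 Q b ε h -
      2 * ((5 : ℕ) : ℂ) * c * ((‖h.1‖ ^ 2 : ℝ) : ℂ) * ker (5 + 1) Q b ε h)) =
      fun h => 4 * (u h * ker 5 Q b ε h) -
        10 * c * (u h * (((‖h.1‖ ^ 2 : ℝ) : ℂ) * ker 6 Q b ε h)) := by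
    ext h
    push_cast
    ring
  rw [e]
  refine ⟨i0.sub j0, ?_⟩
  rw [integral_sub i0 j0, integral_const_mul, integral_const_mul, pairK]

/-- The conservation law behind the theorem. For a `k`-Cauchy-Fueter function, pairing two adjacent
components with the kernels for a left eigenvector `g` (eigenvalue `σ = ±1`) of the matrix
`((τ₁, q̄), (q, -τ₁))` gives a function of the width parameter `b` that is proportional to
`(b + σ)⁻²`. -/
theorem IsKCF.pairK_const {k : ℕ} {f : H → V k} (hf : IsKCF f) (hf2 : MemLp f 2 volume)
    (i : Fin k) {g : Fin 2 → E3 → ℂ} (hg : ∀ A, ContDiff ℝ ∞ (g A)) {σ : ℝ}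
    (hσ : ∀ (A' : Fin 2) (τ : Metric.sphere (0 : E3) 1),
      ∑ l, ∑ A'', pauli l A'' A' * ((τ : E3) l * g A'' τ) = σ * g A' τ)
    {ε : ℝ} (hε : 0 < ε) {b b' : ℝ} (hb : 0 < b) (hb' : 0 < b') :
    ((b : ℂ) + σ) ^ 2 * (pairK (fun h => f h i.castSucc) (g 0) ε b +
      pairK (fun h => f h i.succ) (g 1) ε b) =
    ((b' : ℂ) + σ) ^ 2 * (pairK (fun h => f h i.castSucc) (g 0) ε b' +
      pairK (fun h => f h i.succ) (g 1) ε b') := by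
  have hfi := memLp_coord hf2
  have hder : ∀ b ∈ Set.Ioi (0 : ℝ), HasDerivAt (fun b : ℝ => ((b : ℂ) + σ) ^ 2 *
      (pairK (fun h => f h i.castSucc) (g 0) ε b + pairK (fun h => f h i.succ) (g 1) ε b)) 0 b := by
    intro b hb
    have hb : 0 < b := hb
    have d0 := hasDerivAt_pairK (hfi i.castSucc) (hg 0) hb hε
    have d1 := hasDerivAt_pairK (hfi i.succ) (hg 1) hb hε
    have dp : HasDerivAt (fun b : ℝ => ((b : ℂ) + σ) ^ 2) (2 * ((b : ℂ) + σ)) b := by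
      have := (((hasDerivAt_id b).ofReal_comp).add_const (σ : ℂ)).fun_pow 2
      simpa using this
    have c0 := integral_mul_ker_comb (hfi i.castSucc) (hg 0) hε hb ((b : ℂ) + σ)
    have c1 := integral_mul_ker_comb (hfi i.succ) (hg 1) hε hb ((b : ℂ) + σ)
    have e3 := hf.integral_ker_eq_zero hf2 i hg hσ hε hb
    rw [integral_add c0.1 c1.1, c0.2, c1.2] at e3
    refine HasDerivAt.congr_deriv (f' := 2 * ((b : ℂ) + σ) * _ + ((b : ℂ) + σ) ^ 2 * _)
      (dp.mul (d0.add d1)) ?_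
    linear_combination (((b : ℂ) + σ) / 2) * e3
  exact IsOpen.is_const_of_deriv_eq_zero isOpen_Ioi isPreconnected_Ioi
    (fun b hb => (hder b hb).differentiableAt.differentiableWithinAt)
    (fun b hb => (hder b hb).deriv) hb hb'

end QHeis

namespace QHeis

/-! ### Pairing a Cauchy-Fueter function with the entries of `P^τ` -/

theorem ker_add (m : ℕ) {Q Q' : E3 → ℂ} (hQ : ContDiff ℝ ∞ Q) (hQ' : ContDiff ℝ ∞ Q') {b ε : ℝ}
    (hb : 0 ≤ b) (hε : 0 < ε) (h : H) :
    ker m (fun τ => Q τ + Q' τ) b ε h = ker m Q b ε h + ker m Q' b ε h :=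
  planeInt_add m hQ hQ' (ker_mem hb hε h)

theorem planeInt_zero (m : ℕ) {p : ℝ × E3} (hp : p ∈ upper) : planeInt m (fun _ => 0) p = 0 := by
  rw [planeInt_eq m (Q := fun _ => 0) continuous_const hp]
  simp

theorem planeInt_sum (m : ℕ) {ι : Type*} (t : Finset ι) {Q : ι → E3 → ℂ}
    (hQ : ∀ a, ContDiff ℝ ∞ (Q a)) {p : ℝ × E3} (hp : p ∈ upper) :
    planeInt m (fun τ => ∑ a ∈ t, Q a τ) p = ∑ a ∈ t, planeInt m (Q a) p := by
  classical
  induction t using Finset.induction_on with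
  | empty => simpa only [Finset.sum_empty] using planeInt_zero m hp
  | insert a t ha ih =>
    simp only [Finset.sum_insert ha]
    rw [planeInt_add m (hQ a) (ContDiff.sum fun a _ => hQ a) hp, ih]

theorem ker_sum (m : ℕ) {ι : Type*} (t : Finset ι) {Q : ι → E3 → ℂ}
    (hQ : ∀ a, ContDiff ℝ ∞ (Q a)) {b ε : ℝ} (hb : 0 ≤ b) (hε : 0 < ε) (h : H) :
    ker m (fun τ => ∑ a ∈ t, Q a τ) b ε h = ∑ a ∈ t, ker m (Q a) b ε h :=
  planeInt_sum m t hQ (ker_mem hb hε h)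

theorem ker_const_mul (m : ℕ) {Q : E3 → ℂ} (hQ : ContDiff ℝ ∞ Q) (c : ℂ) {b ε : ℝ}
    (hb : 0 ≤ b) (hε : 0 < ε) (h : H) :
    ker m (fun τ => c * Q τ) b ε h = c * ker m Q b ε h :=
  planeInt_const_mul m hQ c (ker_mem hb hε h)

theorem pairK_add {u : H → ℂ} (hu : MemLp u 2 volume) {Q Q' : E3 → ℂ} (hQ : ContDiff ℝ ∞ Q)
    (hQ' : ContDiff ℝ ∞ Q') {b ε : ℝ} (hb : 0 < b) (hε : 0 < ε) :
    pairK u (fun τ => Q τ + Q' τ) ε b = pairK u Q ε b + pairK u Q' ε b := by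
  unfold pairK
  rw [← integral_add (integrable_mul_ker hu (by norm_num) hQ hb hε)
    (integrable_mul_ker hu (by norm_num) hQ' hb hε)]
  simp only [ker_add 5 hQ hQ' hb.le hε, mul_add]

theorem pairK_sum {u : H → ℂ} (hu : MemLp u 2 volume) {ι : Type*} (t : Finset ι) {Q : ι → E3 → ℂ}
    (hQ : ∀ a, ContDiff ℝ ∞ (Q a)) {b ε : ℝ} (hb : 0 < b) (hε : 0 < ε) :
    pairK u (fun τ => ∑ a ∈ t, Q a τ) ε b = ∑ a ∈ t, pairK u (Q a) ε b := by
  unfold pairK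
  rw [← integral_finsetSum _ fun a _ => integrable_mul_ker hu (by norm_num) (hQ a) hb hε]
  simp only [ker_sum 5 t hQ hb.le hε, Finset.mul_sum]

theorem pairK_const_mul {u : H → ℂ} {Q : E3 → ℂ} (hQ : ContDiff ℝ ∞ Q) (c : ℂ) {b ε : ℝ}
    (hb : 0 < b) (hε : 0 < ε) :
    pairK u (fun τ => c * Q τ) ε b = c * pairK u Q ε b := by
  unfold pairK
  rw [← integral_const_mul]
  simp only [ker_const_mul 5 hQ c hb.le hε]
  congr 1
  ext h
  ring

variable {k : ℕ} {f : H → V k}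

/-- For a row that is a left eigenvector of `((τ₁, q̄), (q, -τ₁))` for the eigenvalue `-1`, the
pairing vanishes: it is proportional to `(b - 1)⁻²`, and finite at `b = 1`. -/
theorem IsKCF.pairK_null (hf : IsKCF f) (hf2 : MemLp f 2 volume)
    (i : Fin k) {g : Fin 2 → E3 → ℂ} (hg : ∀ A, ContDiff ℝ ∞ (g A))
    (hσ : ∀ (A' : Fin 2) (τ : Metric.sphere (0 : E3) 1),
      ∑ l, ∑ A'', pauli l A'' A' * ((τ : E3) l * g A'' τ) = (-1 : ℝ) * g A' τ)
    {ε : ℝ} (hε : 0 < ε) {b : ℝ} (hb : 0 < b) :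
    pairK (fun h => f h i.castSucc) (g 0) ε b + pairK (fun h => f h i.succ) (g 1) ε b = 0 := by
  have hne : ∀ b : ℝ, 0 < b → b ≠ 1 → pairK (fun h => f h i.castSucc) (g 0) ε b +
      pairK (fun h => f h i.succ) (g 1) ε b = 0 := by
    intro b hb hb1
    have h := hf.pairK_const hf2 i hg hσ hε hb one_pos
    have h1 : (b : ℂ) + ((-1 : ℝ) : ℂ) ≠ 0 := by
      rw [← ofReal_add]
      exact_mod_cast (by intro h; apply hb1; linarith : b + -1 ≠ 0)
    have h2 : ((1 : ℝ) : ℂ) + ((-1 : ℝ) : ℂ) = 0 := by push_cast; ring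
    rw [h2, zero_pow two_ne_zero, zero_mul] at h
    exact (mul_eq_zero.1 h).resolve_left (pow_ne_zero 2 h1)
  rcases eq_or_ne b 1 with rfl | hb1
  · have hc : ContinuousAt (fun b => pairK (fun h => f h i.castSucc) (g 0) ε b +
        pairK (fun h => f h i.succ) (g 1) ε b) 1 :=
      (hasDerivAt_pairK (memLp_coord hf2 _) (hg 0) one_pos hε).continuousAt.add
        (hasDerivAt_pairK (memLp_coord hf2 _) (hg 1) one_pos hε).continuousAt
    refine tendsto_nhds_unique (hc.tendsto.mono_left nhdsWithin_le_nhds : Tendsto _ (𝓝[≠] (1 : ℝ)) _)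
      (tendsto_const_nhds.congr' ?_)
    filter_upwards [self_mem_nhdsWithin, nhdsWithin_le_nhds (Ioi_mem_nhds one_pos)] with b h1 h2
    exact (hne b h2 h1).symm
  · exact hne b hb hb1

/-- `pairK_null` for the left eigenvector `(1 - τ₁, -q̄)`. -/
theorem IsKCF.pairK_mm (hf : IsKCF f) (hf2 : MemLp f 2 volume) (i : Fin k) {χ : E3 → ℂ}
    (hχ : ContDiff ℝ ∞ χ) {ε : ℝ} (hε : 0 < ε) {b : ℝ} (hb : 0 < b) :
    pairK (fun h => f h i.castSucc) (fun τ => χ τ * mm τ) ε b =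
      pairK (fun h => f h i.succ) (fun τ => χ τ * qb τ) ε b := by
  have h := hf.pairK_null hf2 i (g := ![fun τ => χ τ * mm τ, fun τ => -1 * (χ τ * qb τ)])
    (by
      intro A
      fin_cases A
      · exact hχ.mul contDiff_mm
      · exact contDiff_const.mul (hχ.mul contDiff_qb))
    (by
      intro A' τ
      have hq := qq_mul_qb τ
      have hI := I_sq
      simp only [pp, mm, qq, qb] at hq
      fin_cases A' <;> simp [pauli, Fin.sum_univ_three, mm, qb] <;> grind) hε hb
  simp only [Matrix.cons_val_zero, Matrix.cons_val_one] at h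
  rw [pairK_const_mul (hχ.mul contDiff_qb) (-1) hb hε] at h
  linear_combination h

/-- `pairK_null` for the left eigenvector `(-q, 1 + τ₁)`. -/
theorem IsKCF.pairK_qq (hf : IsKCF f) (hf2 : MemLp f 2 volume) (i : Fin k) {χ : E3 → ℂ}
    (hχ : ContDiff ℝ ∞ χ) {ε : ℝ} (hε : 0 < ε) {b : ℝ} (hb : 0 < b) :
    pairK (fun h => f h i.castSucc) (fun τ => χ τ * qq τ) ε b =
      pairK (fun h => f h i.succ) (fun τ => χ τ * pp τ) ε b := by
  have h := hf.pairK_null hf2 i (g := ![fun τ => -1 * (χ τ * qq τ), fun τ => χ τ * pp τ])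
    (by
      intro A
      fin_cases A
      · exact contDiff_const.mul (hχ.mul contDiff_qq)
      · exact hχ.mul contDiff_pp)
    (by
      intro A' τ
      have hq := qq_mul_qb τ
      have hI := I_sq
      simp only [pp, mm, qq, qb] at hq
      fin_cases A' <;> simp [pauli, Fin.sum_univ_three, pp, qq] <;> grind) hε hb
  simp only [Matrix.cons_val_zero, Matrix.cons_val_one] at h
  rw [pairK_const_mul (hχ.mul contDiff_qq) (-1) hb hε] at h
  linear_combination -h

theorem pp_add_mm (τ : E3) : pp τ + mm τ = 2 := by simp only [pp, mm]; ring

/-- Every single pairing is proportional to `(b + 1)⁻²`: it is one half of a pairing of two adjacent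
components with a left eigenvector, `(1 + τ₁, q̄)` or `(q, 1 - τ₁)`, for the eigenvalue `1`. -/
theorem IsKCF.pairK_scale (hk : 1 ≤ k) (hf : IsKCF f) (hf2 : MemLp f 2 volume) (j : Fin (k + 1))
    {χ : E3 → ℂ} (hχ : ContDiff ℝ ∞ χ) {ε : ℝ} (hε : 0 < ε) {b : ℝ} (hb : 0 < b) :
    4 * pairK (fun h => f h j) χ ε 1 = (1 + (b : ℂ)) ^ 2 * pairK (fun h => f h j) χ ε b := by
  have htwo : ∀ (j : Fin (k + 1)) {b : ℝ}, 0 < b →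
      pairK (fun h => f h j) (fun τ => χ τ * pp τ) ε b +
        pairK (fun h => f h j) (fun τ => χ τ * mm τ) ε b = 2 * pairK (fun h => f h j) χ ε b := by
    intro j b hb
    rw [← pairK_add (memLp_coord hf2 j) (hχ.mul contDiff_pp) (hχ.mul contDiff_mm) hb hε,
      ← pairK_const_mul hχ 2 hb hε]
    congr 1
    ext τ
    linear_combination χ τ * pp_add_mm τ
  have h1 : (((1 : ℝ) : ℂ) + ((1 : ℝ) : ℂ)) ^ 2 = 4 := by push_cast; norm_num
  rcases Fin.eq_castSucc_or_eq_last j with ⟨i, rfl⟩ | rfl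
  · have h := hf.pairK_const hf2 i (σ := 1) (g := ![fun τ => χ τ * pp τ, fun τ => χ τ * qb τ])
      (by
        intro A
        fin_cases A
        · exact hχ.mul contDiff_pp
        · exact hχ.mul contDiff_qb)
      (by
        intro A' τ
        have hq := qq_mul_qb τ
        have hI := I_sq
        simp only [pp, mm, qq, qb] at hq
        fin_cases A' <;> simp [pauli, Fin.sum_univ_three, pp, qb] <;> grind) hε one_pos hb
    simp only [Matrix.cons_val_zero, Matrix.cons_val_one] at h
    rw [← hf.pairK_mm hf2 i hχ hε one_pos, ← hf.pairK_mm hf2 i hχ hε hb, htwo _ one_pos, htwo _ hb,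
      h1] at h
    push_cast at h
    linear_combination h / 2
  · obtain ⟨n, rfl⟩ : ∃ n, k = n + 1 := ⟨k - 1, by omega⟩
    have h := hf.pairK_const hf2 (Fin.last n) (σ := 1)
      (g := ![fun τ => χ τ * qq τ, fun τ => χ τ * mm τ])
      (by
        intro A
        fin_cases A
        · exact hχ.mul contDiff_qq
        · exact hχ.mul contDiff_mm)
      (by
        intro A' τ
        have hq := qq_mul_qb τ
        have hI := I_sq
        simp only [pp, mm, qq, qb] at hq
        fin_cases A' <;> simp [pauli, Fin.sum_univ_three, mm, qq] <;> grind) hε one_pos hb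
    simp only [Matrix.cons_val_zero, Matrix.cons_val_one] at h
    rw [hf.pairK_qq hf2 _ hχ hε one_pos, hf.pairK_qq hf2 _ hχ hε hb, Fin.succ_last,
      htwo _ one_pos, htwo _ hb, h1] at h
    push_cast at h
    linear_combination h / 2

/-- The pairing with the `j`-th component, for a natural number `j`; it is `0` for `j > k`. -/
noncomputable def pairN (f : H → V k) (Q : E3 → ℂ) (ε b : ℝ) (j : ℕ) : ℂ :=
  if hj : j < k + 1 then pairK (fun h => f h ⟨j, hj⟩) Q ε b else 0

theorem IsKCF.pairN_mm_pow (hf : IsKCF f) (hf2 : MemLp f 2 volume) {ε : ℝ} (hε : 0 < ε) {b : ℝ}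
    (hb : 0 < b) (r i : ℕ) (hi : i + r ≤ k) {χ : E3 → ℂ} (hχ : ContDiff ℝ ∞ χ) :
    pairN f (fun τ => χ τ * mm τ ^ r) ε b i = pairN f (fun τ => χ τ * qb τ ^ r) ε b (i + r) := by
  induction r generalizing i χ with
  | zero => simp
  | succ r ih =>
    have h1 := hf.pairK_mm hf2 ⟨i, by omega⟩ (χ := fun τ => χ τ * mm τ ^ r)
      (hχ.mul (contDiff_mm.pow r)) hε hb
    have h2 := ih (i + 1) (by omega) (χ := fun τ => χ τ * qb τ) (hχ.mul contDiff_qb)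
    have e1 : (fun τ => χ τ * mm τ ^ (r + 1)) = fun τ => χ τ * mm τ ^ r * mm τ := by ext; ring
    have e2 : (fun τ => χ τ * qb τ ^ (r + 1)) = fun τ => χ τ * qb τ * qb τ ^ r := by ext; ring
    have e3 : (fun τ => χ τ * mm τ ^ r * qb τ) = fun τ => χ τ * qb τ * mm τ ^ r := by ext; ring
    rw [e1, e2, show i + (r + 1) = i + 1 + r by ring, ← h2, pairN, pairN, dif_pos (by omega),
      dif_pos (by omega), ← e3]
    exact h1

theorem IsKCF.pairN_qq_pow (hf : IsKCF f) (hf2 : MemLp f 2 volume) {ε : ℝ} (hε : 0 < ε) {b : ℝ}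
    (hb : 0 < b) (r i : ℕ) (hi : i + r ≤ k) {χ : E3 → ℂ} (hχ : ContDiff ℝ ∞ χ) :
    pairN f (fun τ => χ τ * qq τ ^ r) ε b i = pairN f (fun τ => χ τ * pp τ ^ r) ε b (i + r) := by
  induction r generalizing i χ with
  | zero => simp
  | succ r ih =>
    have h1 := hf.pairK_qq hf2 ⟨i, by omega⟩ (χ := fun τ => χ τ * qq τ ^ r)
      (hχ.mul (contDiff_qq.pow r)) hε hb
    have h2 := ih (i + 1) (by omega) (χ := fun τ => χ τ * pp τ) (hχ.mul contDiff_pp)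
    have e1 : (fun τ => χ τ * qq τ ^ (r + 1)) = fun τ => χ τ * qq τ ^ r * qq τ := by ext; ring
    have e2 : (fun τ => χ τ * pp τ ^ (r + 1)) = fun τ => χ τ * pp τ * pp τ ^ r := by ext; ring
    have e3 : (fun τ => χ τ * qq τ ^ r * pp τ) = fun τ => χ τ * pp τ * qq τ ^ r := by ext; ring
    rw [e1, e2, show i + (r + 1) = i + 1 + r by ring, ← h2, pairN, pairN, dif_pos (by omega),
      dif_pos (by omega), ← e3]
    exact h1

/-- The entry `(l, j)` of `P^τ` paired with the `j`-th component can be moved to the `l`-th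
component, where only a scalar density remains. -/
theorem IsKCF.pairN_ent (hf : IsKCF f) (hf2 : MemLp f 2 volume) {ε : ℝ} (hε : 0 < ε) {b : ℝ}
    (hb : 0 < b) {l j : ℕ} (hl : l ≤ k) (hj : j ≤ k) :
    pairN f (ent k l j) ε b j =
      pairN f (fun τ => pp τ ^ (k - j) * mm τ ^ j * (den k τ)⁻¹) ε b l := by
  have hden : ContDiff ℝ ∞ fun τ => (den k τ)⁻¹ := (contDiff_den k).inv (den_ne_zero k)
  -- For `l + j ≤ k` the numerator is `qˡ q̄ʲ (1 + τ₁)ᵏ⁻ˡ⁻ʲ`: lowering the component from `j` to `0`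
  -- turns `q̄ʲ` into `(1 - τ₁)ʲ`, and raising it to `l` turns `qˡ` into `(1 + τ₁)ˡ`. In the other
  -- case the component is first raised from `j` to `k` and then lowered to `l`.
  by_cases hlj : l + j ≤ k
  · obtain ⟨r, rfl⟩ := Nat.exists_eq_add_of_le hlj
    have h1 := hf.pairN_mm_pow hf2 hε hb j 0 (by omega)
      (χ := fun τ => qq τ ^ l * pp τ ^ r * (den (l + j + r) τ)⁻¹)
      (((contDiff_qq.pow l).mul (contDiff_pp.pow r)).mul hden)
    have h2 := hf.pairN_qq_pow hf2 hε hb l 0 (by omega)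
      (χ := fun τ => mm τ ^ j * pp τ ^ r * (den (l + j + r) τ)⁻¹)
      (((contDiff_mm.pow j).mul (contDiff_pp.pow r)).mul hden)
    rw [zero_add] at h1 h2
    have e1 : ent (l + j + r) l j =
        fun τ => qq τ ^ l * pp τ ^ r * (den (l + j + r) τ)⁻¹ * qb τ ^ j := by
      ext τ
      rw [ent, num, if_pos (by omega), show l + j + r - l - j = r by omega]
      ring
    have e2 : (fun τ => pp τ ^ (l + j + r - j) * mm τ ^ j * (den (l + j + r) τ)⁻¹) =
        fun τ => mm τ ^ j * pp τ ^ r * (den (l + j + r) τ)⁻¹ * pp τ ^ l := by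
      ext τ
      rw [show l + j + r - j = l + r by omega]
      ring
    rw [e1, ← h1, e2, ← h2]
    congr 1
    ext τ
    ring
  · obtain ⟨r, rfl⟩ := Nat.exists_eq_add_of_le hj
    obtain ⟨t, ht⟩ := Nat.exists_eq_add_of_le hl
    obtain ⟨n, rfl⟩ := Nat.exists_eq_add_of_le (show r ≤ l by omega)
    have hjt : j = n + t := by omega
    have h1 := hf.pairN_qq_pow hf2 hε hb r j (by omega)
      (χ := fun τ => qb τ ^ t * mm τ ^ n * (den (j + r) τ)⁻¹)
      (((contDiff_qb.pow t).mul (contDiff_mm.pow n)).mul hden)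
    have h2 := hf.pairN_mm_pow hf2 hε hb t (r + n) (by omega)
      (χ := fun τ => pp τ ^ r * mm τ ^ n * (den (j + r) τ)⁻¹)
      (((contDiff_pp.pow r).mul (contDiff_mm.pow n)).mul hden)
    have e1 : ent (j + r) (r + n) j =
        fun τ => qb τ ^ t * mm τ ^ n * (den (j + r) τ)⁻¹ * qq τ ^ r := by
      ext τ
      rw [ent, num, if_neg hlj, show j + r - j = r by omega, show j + r - (r + n) = t by omega,
        show r + n + j - (j + r) = n by omega]
      ring
    have e2 : (fun τ => pp τ ^ (j + r - j) * mm τ ^ j * (den (j + r) τ)⁻¹) =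
        fun τ => pp τ ^ r * mm τ ^ n * (den (j + r) τ)⁻¹ * mm τ ^ t := by
      ext τ
      rw [show j + r - j = r by omega, show mm τ ^ j = mm τ ^ n * mm τ ^ t by
        rw [hjt, pow_add]]
      ring
    rw [e1, h1, e2, h2, show r + n + t = j + r by omega]
    congr 1
    ext τ
    ring

/-- Pairing a `k`-Cauchy-Fueter function with the matrix `P^τ` is the same as pairing it with a
multiple of the identity. -/
theorem IsKCF.sum_pairK_ent (hk : 1 ≤ k) (hf : IsKCF f) (hf2 : MemLp f 2 volume) {ε : ℝ}
    (hε : 0 < ε) {b : ℝ} (hb : 0 < b) (l : Fin (k + 1)) :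
    ∑ j : Fin (k + 1), pairK (fun h => f h j) (ent k l j) ε 1 =
      (1 + (b : ℂ)) ^ 2 / 4 * pairK (fun h => f h l) (fun _ => 1) ε b := by
  have hden : ContDiff ℝ ∞ fun τ => (den k τ)⁻¹ := (contDiff_den k).inv (den_ne_zero k)
  have h1 : ∀ j : Fin (k + 1), pairK (fun h => f h j) (ent k l j) ε 1 =
      pairK (fun h => f h l) (fun τ => pp τ ^ (k - j) * mm τ ^ (j : ℕ) * (den k τ)⁻¹) ε 1 := by
    intro j
    have := hf.pairN_ent hf2 hε one_pos (Nat.le_of_lt_succ l.2) (Nat.le_of_lt_succ j.2)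
    simpa only [pairN, dif_pos j.2, dif_pos l.2] using this
  simp only [h1]
  rw [← pairK_sum (memLp_coord hf2 l) _ (fun j : Fin (k + 1) =>
    ((contDiff_pp.pow (k - j)).mul (contDiff_mm.pow (j : ℕ))).mul hden) one_pos hε]
  -- The scalar densities add up to `1`, by the definition of the denominator `den`.
  have e : (fun τ => ∑ j : Fin (k + 1), pp τ ^ (k - j) * mm τ ^ (j : ℕ) * (den k τ)⁻¹) =
      fun _ => 1 := by
    ext τ
    rw [← Finset.sum_mul, Fin.sum_univ_eq_sum_range fun j => pp τ ^ (k - j) * mm τ ^ j]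
    exact mul_inv_cancel₀ (den_ne_zero k τ)
  have h2 := hf.pairK_scale hk hf2 l (χ := fun _ => 1) contDiff_const hε hb
  rw [e]
  linear_combination h2 / 4

end QHeis

namespace QHeis

/-! ### The scalar kernels and the Poisson kernel of the centre -/

theorem sphereMeasure_real_univ : sphereMeasure.real Set.univ = 4 * Real.pi := by
  rw [sphereMeasure, Measure.toSphere_real_apply_univ, measureReal_def,
    EuclideanSpace.volume_ball_fin_three, finrank_euclideanSpace_fin]
  simp only [ENNReal.ofReal_one, one_pow, one_mul]
  rw [ENNReal.toReal_ofReal (by positivity)]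
  push_cast
  ring

theorem phase_mul_inv_pow {p : ℝ × E3} (hp : p ∈ upper) (τ : E3) (m : ℕ) :
    phase p τ * (phase p τ ^ (m + 1))⁻¹ = (phase p τ ^ m)⁻¹ := by
  have := phase_ne_zero hp τ
  field_simp
  ring

/-- The three-term recursion for the scalar superpositions: integration by parts on the sphere with
constant density. -/
theorem planeInt_one_rec (m : ℕ) {p : ℝ × E3} (hp : p ∈ upper) :
    ((m : ℂ) + 1) * ((‖p.2‖ ^ 2 + p.1 ^ 2 : ℝ) : ℂ) * planeInt (m + 2) (fun _ => 1) p =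
      2 * p.1 * m * planeInt (m + 1) (fun _ => 1) p - (m - 1) * planeInt m (fun _ => 1) p := by
  have h := sphInt_deriv (differentiableOn_inv_pow (m + 1)) (Q := fun _ => 1) contDiff_const hp
  have hph : ∀ τ : E3, 0 < (phase p τ).re := phase_mem hp
  have hc : ∀ n, planeInt n (fun _ => 1) p =
      ∫ τ : Metric.sphere (0 : E3) 1, (phase p τ ^ n)⁻¹ ∂sphereMeasure := fun n => by
    rw [planeInt_eq n continuous_const hp]
    simp only [one_mul]
  have hi : ∀ n, Integrable (fun τ : Metric.sphere (0 : E3) 1 => (phase p τ ^ n)⁻¹)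
      sphereMeasure := fun n => by
    have := integrable_sphInt (differentiableOn_inv_pow n).continuousOn
      (Q := fun _ => 1) continuous_const hp
    simpa only [one_mul] using this
  have e1 : sphInt (deriv fun z => (z ^ (m + 1))⁻¹) (fun _ => 1) p =
      -((m : ℂ) + 1) * planeInt (m + 2) (fun _ => 1) p := by
    rw [hc, ← integral_const_mul]
    unfold sphInt
    refine integral_congr_ae (Eventually.of_forall fun τ => ?_)
    simp only
    rw [deriv_inv_pow _ (hph τ)]
    push_cast
    ring
  have e2 : sphInt (fun z => z * deriv (fun z => (z ^ (m + 1))⁻¹) z) (fun _ => 1) p =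
      -((m : ℂ) + 1) * planeInt (m + 1) (fun _ => 1) p := by
    rw [hc, ← integral_const_mul]
    unfold sphInt
    refine integral_congr_ae (Eventually.of_forall fun τ => ?_)
    simp only
    rw [deriv_inv_pow _ (hph τ), ← phase_mul_inv_pow hp τ (m + 1)]
    push_cast
    ring
  have e3 : sphInt (fun z => z ^ 2 * deriv (fun z => (z ^ (m + 1))⁻¹) z) (fun _ => 1) p =
      -((m : ℂ) + 1) * planeInt m (fun _ => 1) p := by
    rw [hc, ← integral_const_mul]
    unfold sphInt
    refine integral_congr_ae (Eventually.of_forall fun τ => ?_)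
    simp only
    rw [deriv_inv_pow _ (hph τ), ← phase_mul_inv_pow hp τ m, ← phase_mul_inv_pow hp τ (m + 1)]
    push_cast
    ring
  have e4 : I * ∑ j, (p.2 j : ℂ) * sphInt (fun z => (z ^ (m + 1))⁻¹) (tanDiv j fun _ => 1) p =
      2 * (planeInt m (fun _ => 1) p - p.1 * planeInt (m + 1) (fun _ => 1) p) := by
    rw [hc, hc, ← integral_const_mul, ← integral_sub (hi m) ((hi (m + 1)).const_mul _),
      ← integral_const_mul]
    unfold sphInt
    simp_rw [← integral_const_mul]
    rw [← integral_finsetSum _ fun j _ => (integrable_sphInt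
      (differentiableOn_inv_pow (m + 1)).continuousOn
      (contDiff_tanDiv j (Q := fun _ => 1) contDiff_const).continuous hp).const_mul _,
      ← integral_const_mul]
    refine integral_congr_ae (Eventually.of_forall fun τ => ?_)
    have hin : phase p τ = p.1 - I * ∑ j, (p.2 j : ℂ) * (τ : E3) j := by
      rw [phase, inner_eq_sum]
      push_cast
      rfl
    simp only [tanDiv, fderiv_const_apply, zero_apply, Fin.sum_univ_three] at hin ⊢
    rw [← phase_mul_inv_pow hp τ m]
    generalize (phase p τ ^ (m + 1))⁻¹ = w
    rw [hin]
    ring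
  rw [e1, e2, e3, e4] at h
  linear_combination -h

theorem planeInt_two_one {p : ℝ × E3} (hp : p ∈ upper) :
    ((‖p.2‖ ^ 2 + p.1 ^ 2 : ℝ) : ℂ) * planeInt 2 (fun _ => 1) p = 4 * Real.pi := by
  have h := planeInt_one_rec 0 hp
  have h0 : planeInt 0 (fun _ => 1) p = 4 * Real.pi := by
    rw [planeInt_eq 0 continuous_const hp]
    simp [sphereMeasure_real_univ]
  rw [h0] at h
  push_cast at h ⊢
  linear_combination h

theorem planeInt_three_one {p : ℝ × E3} (hp : p ∈ upper) :
    planeInt 3 (fun _ => 1) p =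
      ((4 * Real.pi * p.1 / (‖p.2‖ ^ 2 + p.1 ^ 2) ^ 2 : ℝ) : ℂ) := by
  have h2 := planeInt_two_one hp
  have h := planeInt_one_rec 1 hp
  have hp1 : 0 < p.1 := mem_upper.1 hp
  have hne : ((‖p.2‖ ^ 2 + p.1 ^ 2 : ℝ) : ℂ) ≠ 0 := by
    exact_mod_cast (by positivity : ‖p.2‖ ^ 2 + p.1 ^ 2 ≠ 0)
  generalize hA : ‖p.2‖ ^ 2 + p.1 ^ 2 = A at *
  push_cast at h ⊢
  norm_num at h
  rw [eq_div_iff (pow_ne_zero 2 hne)]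
  linear_combination (A : ℂ) / 2 * h + p.1 * h2

theorem hasDerivAt_planeInt_fst (m : ℕ) {Q : E3 → ℂ} (hQ : ContDiff ℝ ∞ Q) {a : ℝ} (ha : 0 < a)
    (s : E3) :
    HasDerivAt (fun a => planeInt m Q (a, s)) (-m * planeInt (m + 1) Q (a, s)) a := by
  have h1 : HasDerivAt (fun a : ℝ => (a, s)) (1, (0 : E3)) a :=
    (hasDerivAt_id a).prodMk (hasDerivAt_const a _)
  have h3 := (hasFDerivAt_planeInt m hQ (p := (a, s)) (mem_upper.2 ha)).comp_hasDerivAt a h1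
  refine h3.congr_deriv ?_
  simp [planeDeriv]

theorem volume_real_ball_E4 : (volume : Measure E4).real (Metric.ball 0 1) = Real.pi ^ 2 / 2 := by
  rw [measureReal_def, InnerProductSpace.volume_ball_of_dim_even (k := 2) (by simp)]
  simp
  positivity

/-- Integrating the scalar kernel over the horizontal layer gives `π² / 12` times the kernel
with exponent `5 - 2`. -/
theorem integral_planeInt_five {ε : ℝ} (hε : 0 < ε) (s : E3) :
    ∫ y : E4, planeInt 5 (fun _ => 1) (‖y‖ ^ 2 + ε, s) =
      (Real.pi ^ 2 / 12 : ℝ) * planeInt 3 (fun _ => 1) (ε, s) := by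
  have hQ : ContDiff ℝ ∞ fun _ : E3 => (1 : ℂ) := contDiff_const
  have hpos : ∀ r : ℝ, 0 < r ^ 2 + ε := fun r => by positivity
  have hder : ∀ (m : ℕ) (r : ℝ), HasDerivAt (fun r => planeInt m (fun _ => 1) (r ^ 2 + ε, s))
      ((2 * r : ℝ) * (-m * planeInt (m + 1) (fun _ => 1) (r ^ 2 + ε, s))) r := by
    intro m r
    have h1 : HasDerivAt (fun r : ℝ => r ^ 2 + ε) (2 * r) r := by
      simpa using (hasDerivAt_pow 2 r).add_const ε
    have := (hasDerivAt_planeInt_fst m hQ (hpos r) s).scomp r h1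
    simpa [Function.comp_def] using this
  have hbound : ∀ m : ℕ, ∃ C, 0 ≤ C ∧ ∀ r : ℝ,
      ‖planeInt m (fun _ => 1) (r ^ 2 + ε, s)‖ ≤ C * ((1 + r ^ 2) ^ m)⁻¹ := by
    intro m
    obtain ⟨C, hC0, hC⟩ := planeInt_bound m hQ
    have hc : 0 < min ε 1 := by positivity
    refine ⟨C * (min ε 1 ^ m)⁻¹, by positivity, fun r => ?_⟩
    refine (hC _ (upper_subset_bdUpper (mem_upper.2 (hpos r)))).trans ?_
    rw [mul_assoc, ← mul_inv, ← mul_pow]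
    have : min ε 1 * (1 + r ^ 2) ≤ r ^ 2 + ε + ‖s‖ := by
      nlinarith [min_le_left ε 1, min_le_right ε 1, norm_nonneg s, sq_nonneg r,
        mul_le_mul_of_nonneg_right (min_le_right ε 1) (sq_nonneg r)]
    gcongr
  -- In polar coordinates the integrand is `r³ I₅`, with `I_m = planeInt m 1 (r² + ε, s)`;
  -- it has the primitive `-(3 r² I₄ + I₃) / 24`.
  have hprim : ∀ r : ℝ, HasDerivAt (fun r : ℝ => -(1 / 24 : ℂ) * (3 * ((r ^ 2 : ℝ) *
      planeInt 4 (fun _ => 1) (r ^ 2 + ε, s)) + planeInt 3 (fun _ => 1) (r ^ 2 + ε, s)))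
      ((r ^ 3 : ℝ) • planeInt 5 (fun _ => 1) (r ^ 2 + ε, s)) r := by
    intro r
    have h1 : HasDerivAt (fun r : ℝ => ((r ^ 2 : ℝ) : ℂ)) ((2 * r : ℝ) : ℂ) r := by
      have : HasDerivAt (fun r : ℝ => r ^ 2) (2 * r) r := by simpa using hasDerivAt_pow 2 r
      exact this.ofReal_comp
    refine HasDerivAt.congr_deriv (HasDerivAt.const_mul _
      (HasDerivAt.add (HasDerivAt.const_mul _ (h1.mul (hder 4 r))) (hder 3 r))) ?_
    rw [real_smul]
    push_cast
    ring
  have hint : IntegrableOn (fun r : ℝ => (r ^ 3 : ℝ) • planeInt 5 (fun _ => 1) (r ^ 2 + ε, s))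
      (Set.Ioi 0) := by
    obtain ⟨C, hC0, hC⟩ := hbound 5
    refine ((integrable_inv_one_add_sq.const_mul C).integrableOn).mono' ?_ ?_
    · have : Continuous fun r : ℝ => planeInt 5 (fun _ => 1) (r ^ 2 + ε, s) :=
        continuous_iff_continuousAt.2 fun r => (hder 5 r).continuousAt
      exact ((continuous_pow 3).smul this).aestronglyMeasurable
    · filter_upwards [ae_restrict_mem measurableSet_Ioi] with r hr
      have hr : 0 < r := hr
      rw [norm_smul, Real.norm_eq_abs, abs_of_pos (pow_pos hr 3)]
      have h1 : r ^ 3 ≤ (1 + r ^ 2) ^ 4 := by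
        have : r ≤ 1 + r ^ 2 := by nlinarith [sq_nonneg (r - 1)]
        calc r ^ 3 ≤ (1 + r ^ 2) ^ 3 := by gcongr
          _ ≤ (1 + r ^ 2) ^ 4 := pow_le_pow_right₀ (by nlinarith) (by norm_num)
      calc r ^ 3 * ‖planeInt 5 (fun _ => 1) (r ^ 2 + ε, s)‖
          ≤ (1 + r ^ 2) ^ 4 * (C * ((1 + r ^ 2) ^ 5)⁻¹) :=
            mul_le_mul h1 (hC r) (norm_nonneg _) (by positivity)
        _ = C * (1 + r ^ 2)⁻¹ := by field_simp
  have hlim : ∀ m : ℕ, 2 ≤ m → Tendsto (fun r : ℝ => ((r ^ 2 : ℝ) : ℂ) *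
      planeInt m (fun _ => 1) (r ^ 2 + ε, s)) atTop (𝓝 0) ∧
      Tendsto (fun r : ℝ => planeInt m (fun _ => 1) (r ^ 2 + ε, s)) atTop (𝓝 0) := by
    intro m hm
    obtain ⟨C, hC0, hC⟩ := hbound m
    have hT : Tendsto (fun r : ℝ => C * (1 + r ^ 2)⁻¹) atTop (𝓝 0) := by
      have : Tendsto (fun r : ℝ => 1 + r ^ 2) atTop atTop :=
        tendsto_atTop_add_const_left _ _ (tendsto_pow_atTop two_ne_zero)
      simpa using this.inv_tendsto_atTop.const_mul C
    have hle : ∀ r : ℝ, (1 + r ^ 2) * ((1 + r ^ 2) ^ m)⁻¹ ≤ (1 + r ^ 2)⁻¹ := fun r => by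
      have h1 : (1 : ℝ) ≤ 1 + r ^ 2 := by nlinarith
      obtain ⟨n, rfl⟩ := Nat.exists_eq_add_of_le' hm
      have : (1 + r ^ 2) * ((1 + r ^ 2) ^ (n + 2))⁻¹ = ((1 + r ^ 2) ^ (n + 1))⁻¹ := by
        field_simp
        ring
      rw [this]
      exact inv_anti₀ (by positivity) (le_self_pow₀ h1 (by omega))
    constructor
    · refine squeeze_zero_norm (fun r => ?_) hT
      rw [norm_mul, norm_real, Real.norm_eq_abs, abs_of_nonneg (sq_nonneg r)]
      calc _ ≤ (1 + r ^ 2) * (C * ((1 + r ^ 2) ^ m)⁻¹) :=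
            mul_le_mul (by linarith) (hC r) (norm_nonneg _) (by positivity)
        _ = C * ((1 + r ^ 2) * ((1 + r ^ 2) ^ m)⁻¹) := by ring
        _ ≤ _ := mul_le_mul_of_nonneg_left (hle r) hC0
    · refine squeeze_zero_norm (fun r => ?_) hT
      refine (hC r).trans (mul_le_mul_of_nonneg_left (le_trans ?_ (hle r)) hC0)
      exact le_mul_of_one_le_left (by positivity) (by nlinarith)
  have hval := integral_Ioi_of_hasDerivAt_of_tendsto' (a := 0) (fun r _ => hprim r) hint
    (((((hlim 4 (by norm_num)).1.const_mul 3).add (hlim 3 (by norm_num)).2)).const_mul _)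
  have hpol := integral_fun_norm_addHaar (volume : Measure E4)
    (fun r => planeInt 5 (fun _ => 1) (r ^ 2 + ε, s))
  rw [hpol, finrank_euclideanSpace_fin, volume_real_ball_E4, show 4 - 1 = 3 from rfl, hval]
  simp
  ring

/-- The Poisson kernel of `ℝ³`, with unit width. -/
noncomputable def pois (s : E3) : ℝ := (Real.pi ^ 2 * (1 + ‖s‖ ^ 2) ^ 2)⁻¹

theorem pois_pos (s : E3) : 0 < pois s := by
  unfold pois
  have := Real.pi_pos
  positivity

theorem continuous_pois : Continuous pois := by
  unfold pois
  exact Continuous.inv₀ (by fun_prop) fun s => by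
    have := Real.pi_pos
    positivity

theorem integral_pois : ∫ s, pois s = 1 := by
  -- The radial integrand `r² (1 + r²)⁻²` in polar coordinates.
  have hprim : ∀ r : ℝ, HasDerivAt (fun r : ℝ => (Real.arctan r - r * (1 + r ^ 2)⁻¹) / 2)
      (r ^ 2 * ((1 + r ^ 2) ^ 2)⁻¹) r := by
    intro r
    have hne : 1 + r ^ 2 ≠ 0 := by positivity
    have h1 : HasDerivAt (fun r : ℝ => 1 + r ^ 2) (2 * r) r := by
      simpa using (hasDerivAt_pow 2 r).const_add 1
    refine HasDerivAt.congr_deriv (HasDerivAt.div_const (HasDerivAt.sub (Real.hasDerivAt_arctan r)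
      ((hasDerivAt_id r).mul (h1.inv hne))) 2) ?_
    simp
    field_simp
  have hT : Tendsto (fun r : ℝ => r * (1 + r ^ 2)⁻¹) atTop (𝓝 0) := by
    refine squeeze_zero' (eventually_atTop.2 ⟨0, fun r hr => by positivity⟩)
      (eventually_atTop.2 ⟨1, fun r hr => ?_⟩) tendsto_inv_atTop_zero
    have h0 : 0 < r := one_pos.trans_le hr
    rw [← div_eq_mul_inv, div_le_iff₀ (by positivity)]
    field_simp
    nlinarith
  have hlim : Tendsto (fun r : ℝ => (Real.arctan r - r * (1 + r ^ 2)⁻¹) / 2) atTop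
      (𝓝 ((Real.pi / 2 - 0) / 2)) :=
    (((Real.tendsto_arctan_atTop.mono_right nhdsWithin_le_nhds).sub hT).div_const 2)
  have hval := integral_Ioi_of_hasDerivAt_of_nonneg' (a := 0) (fun r _ => hprim r)
    (fun r _ => by positivity) hlim
  have hpol := integral_fun_norm_addHaar (volume : Measure E3)
    (fun r => (Real.pi ^ 2 * (1 + r ^ 2) ^ 2)⁻¹)
  have e : ∀ r : ℝ, r ^ 2 • (Real.pi ^ 2 * (1 + r ^ 2) ^ 2)⁻¹ =
      (Real.pi ^ 2)⁻¹ * (r ^ 2 * ((1 + r ^ 2) ^ 2)⁻¹) := fun r => by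
    rw [smul_eq_mul, mul_inv]; ring
  unfold pois
  rw [hpol, finrank_euclideanSpace_fin, show 3 - 1 = 2 from rfl]
  simp only [e]
  rw [integral_const_mul, hval, measureReal_def, EuclideanSpace.volume_ball_fin_three]
  rw [ENNReal.ofReal_one, one_pow, one_mul, ENNReal.toReal_ofReal (by positivity)]
  have := Real.pi_pos
  simp
  field_simp
  norm_num

theorem integrable_pois : Integrable pois :=
  Integrable.of_integral_ne_zero (by rw [integral_pois]; exact one_ne_zero)

/-- The integral of the scalar kernel over the horizontal layer is a multiple of the Poisson
kernel of width `ε`. -/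
theorem integral_planeInt_five_eq_pois {ε : ℝ} (hε : 0 < ε) (s : E3) :
    ∫ y : E4, planeInt 5 (fun _ => 1) (‖y‖ ^ 2 + ε, -s) =
      ((Real.pi ^ 5 / 3 * ((ε ^ 3)⁻¹ * pois (ε⁻¹ • s)) : ℝ) : ℂ) := by
  rw [integral_planeInt_five hε, planeInt_three_one (p := (ε, -s)) (mem_upper.2 hε), ← ofReal_mul]
  congr 1
  have := Real.pi_pos
  rw [pois, norm_neg, norm_smul, norm_inv, Real.norm_of_nonneg hε.le]
  field_simp
  ring

end QHeis

namespace QHeis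

/-! ### Right translations and Poisson means on `L²` -/

variable {k : ℕ}

/-- Right translation by `p` on `L²`. -/
noncomputable def rtr (p : H) : L2H k →+ L2H k :=
  Lp.compMeasurePreserving (fun q => gmul q p) (measurePreserving_gmul_right p)

theorem coeFn_rtr (p : H) (f : L2H k) : rtr p f =ᵐ[volume] fun q => f (gmul q p) :=
  Lp.coeFn_compMeasurePreserving f (measurePreserving_gmul_right p)

theorem norm_rtr (p : H) (f : L2H k) : ‖rtr p f‖ = ‖f‖ :=
  Lp.norm_compMeasurePreserving f (measurePreserving_gmul_right p)

theorem rtr_zero (f : L2H k) : rtr 0 f = f := by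
  refine Lp.ext ?_
  filter_upwards [coeFn_rtr 0 f] with q hq
  rw [hq, gmul_zero]

theorem continuous_rtr (f : L2H k) : Continuous fun p : H => rtr p f := by
  let g : H → C(H, H) := fun p => ⟨fun q => gmul q p, continuous_gmul continuous_id continuous_const⟩
  have hg : Continuous g := ContinuousMap.continuous_of_continuous_uncurry _
    (continuous_gmul continuous_snd continuous_fst)
  exact (continuous_const (y := f)).compMeasurePreservingLp hg
    (fun p => measurePreserving_gmul_right p) (by simp)

theorem norm_inner_rtr_le (Ψ f : L2H k) (p : H) : ‖inner ℂ Ψ (rtr p f)‖ ≤ ‖Ψ‖ * ‖f‖ :=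
  (norm_inner_le_norm _ _).trans_eq (by rw [norm_rtr])

theorem exists_hasCompactSupport_norm_sub_le (f : L2H k) {δ : ℝ} (hδ : 0 < δ) :
    ∃ g : H → V k, HasCompactSupport g ∧ ∃ hg : MemLp g 2 (volume : Measure H),
      ‖f - hg.toLp g‖ ≤ δ := by
  obtain ⟨g, h1, h2, -, h4⟩ := (Lp.memLp f).exists_hasCompactSupport_eLpNorm_sub_le
    (by simp) (ε := ENNReal.ofReal δ) (by simpa using hδ)
  refine ⟨g, h1, h4, ?_⟩
  rw [Lp.norm_def]
  refine ENNReal.toReal_le_of_le_ofReal hδ.le (le_trans (le_of_eq ?_) h2)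
  refine eLpNorm_congr_ae ?_
  filter_upwards [Lp.coeFn_sub f (h4.toLp g), h4.coeFn_toLp] with q h5 h6
  rw [h5, Pi.sub_apply, Pi.sub_apply, h6]

/-- Translations in a central direction move every `L²` function weakly to `0`. -/
theorem tendsto_inner_rtr (Ψ f : L2H k) {s : E3} (hs : s ≠ 0) :
    Tendsto (fun N : ℝ => inner ℂ Ψ (rtr (0, N • s) f)) atTop (𝓝 0) := by
  rw [Metric.tendsto_atTop]
  intro δ hδ
  let η : ℝ := min 1 (δ / (2 * (‖Ψ‖ + ‖f‖ + 2)))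
  have hη : 0 < η := by positivity
  obtain ⟨ψ, hψc, hψ, hψ'⟩ := exists_hasCompactSupport_norm_sub_le Ψ hη
  obtain ⟨g, hgc, hg, hg'⟩ := exists_hasCompactSupport_norm_sub_le f hη
  obtain ⟨R, hR⟩ := hψc.isCompact.isBounded.exists_norm_le
  obtain ⟨R', hR'⟩ := hgc.isCompact.isBounded.exists_norm_le
  have hs' : 0 < ‖s‖ := norm_pos_iff.2 hs
  refine ⟨max 0 ((R + R' + 1) / ‖s‖), fun N hN => ?_⟩
  have hN0 : 0 ≤ N := (le_max_left _ _).trans hN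
  have hNs : R + R' + 1 ≤ N * ‖s‖ := (div_le_iff₀ hs').1 ((le_max_right _ _).trans hN)
  -- For compactly supported functions the supports are eventually disjoint.
  have hzero : inner ℂ (hψ.toLp ψ) (rtr (0, N • s) (hg.toLp g)) = 0 := by
    rw [L2.inner_def]
    refine integral_eq_zero_of_ae ?_
    filter_upwards [hψ.coeFn_toLp, coeFn_rtr (0, N • s) (hg.toLp g),
      (measurePreserving_gmul_right (0, N • s)).quasiMeasurePreserving.ae hg.coeFn_toLp]
      with q h1 h2 h3
    rw [h1, h2, h3, Pi.zero_apply]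
    by_cases hq : q ∈ tsupport ψ
    · have : gmul q (0, N • s) ∉ tsupport g := by
        intro hq'
        have e : (gmul q (0, N • s)).2 = q.2 + N • s := by
          ext i
          simp [gmul, B]
        have h4 : ‖q.2 + N • s‖ ≤ R' := by
          rw [← e]
          exact (norm_snd_le _).trans (hR' _ hq')
        have h5 : ‖q.2‖ ≤ R := (norm_snd_le _).trans (hR _ hq)
        have h6 : ‖N • s‖ ≤ ‖q.2 + N • s‖ + ‖q.2‖ := by
          simpa using norm_sub_le (q.2 + N • s) q.2
        rw [norm_smul, Real.norm_of_nonneg hN0] at h6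
        linarith
      rw [image_eq_zero_of_notMem_tsupport this, inner_zero_right]
    · rw [image_eq_zero_of_notMem_tsupport hq, inner_zero_left]
  have hsplit : inner ℂ Ψ (rtr (0, N • s) f) = inner ℂ (Ψ - hψ.toLp ψ) (rtr (0, N • s) f) +
      inner ℂ (hψ.toLp ψ) (rtr (0, N • s) (f - hg.toLp g)) := by
    rw [map_sub, inner_sub_left, inner_sub_right, hzero]
    ring
  rw [dist_zero_right, hsplit]
  have hη1 : η ≤ 1 := min_le_left _ _
  have hη2 : η * (2 * (‖Ψ‖ + ‖f‖ + 2)) ≤ δ := by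
    rw [← le_div_iff₀ (by positivity)]
    exact min_le_right _ _
  have hψn : ‖hψ.toLp ψ‖ ≤ ‖Ψ‖ + 1 := by
    have := norm_sub_norm_le (hψ.toLp ψ) Ψ
    rw [norm_sub_rev] at this
    linarith
  calc _ ≤ ‖Ψ - hψ.toLp ψ‖ * ‖f‖ + ‖hψ.toLp ψ‖ * ‖f - hg.toLp g‖ :=
        (norm_add_le _ _).trans (add_le_add (norm_inner_rtr_le _ _ _) (norm_inner_rtr_le _ _ _))
    _ ≤ η * ‖f‖ + (‖Ψ‖ + 1) * η := by gcongr
    _ < δ := by nlinarith [norm_nonneg f, norm_nonneg Ψ]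

/-- The average of `f` over right translations by the centre with respect to the Poisson kernel
of width `ε`. -/
noncomputable def poisMean (ε : ℝ) (f : L2H k) : L2H k := ∫ s, pois s • rtr (0, ε • s) f

theorem integrable_poisMean (ε : ℝ) (f : L2H k) :
    Integrable fun s => pois s • rtr (0, ε • s) f := by
  refine (integrable_pois.mul_const ‖f‖).mono' ?_ (Eventually.of_forall fun s => ?_)
  · exact (continuous_pois.smul ((continuous_rtr f).comp (by fun_prop))).aestronglyMeasurable
  · rw [norm_smul, norm_rtr, Real.norm_of_nonneg (pois_pos s).le]

theorem inner_poisMean (Ψ f : L2H k) (ε : ℝ) :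
    inner ℂ Ψ (poisMean ε f) = ∫ s, (pois s : ℂ) * inner ℂ Ψ (rtr (0, ε • s) f) := by
  rw [poisMean, ← integral_inner (integrable_poisMean ε f)]
  congr 1
  ext s
  rw [inner_smul_right_eq_smul, real_smul]

/-- The Poisson means are an approximate identity. -/
theorem tendsto_poisMean (f : L2H k) : Tendsto (fun ε => poisMean ε f) (𝓝 0) (𝓝 f) := by
  have h : ∫ s, pois s • f = f := by rw [integral_smul_const, integral_pois, one_smul]
  suffices key : Tendsto (fun ε => poisMean ε f) (𝓝 0) (𝓝 (∫ s, pois s • f)) by rwa [h] at key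
  refine tendsto_integral_filter_of_dominated_convergence (fun s => pois s * ‖f‖)
    (Eventually.of_forall fun ε => (integrable_poisMean ε _).1)
    (Eventually.of_forall fun ε => Eventually.of_forall fun s => ?_)
    (integrable_pois.mul_const _) (Eventually.of_forall fun s => ?_)
  · rw [norm_smul, norm_rtr, Real.norm_of_nonneg (pois_pos s).le]
  · have hc : Continuous fun ε : ℝ => rtr ((0 : E4), ε • s) f :=
      (continuous_rtr f).comp (by fun_prop)
    have := hc.tendsto 0
    simp only [zero_smul] at this
    rw [show ((0 : E4), (0 : E3)) = (0 : H) from rfl, rtr_zero] at this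
    exact this.const_smul _

/-- Poisson means of large width tend weakly to `0`. -/
theorem tendsto_inner_poisMean (Ψ f : L2H k) :
    Tendsto (fun N => inner ℂ Ψ (poisMean N f)) atTop (𝓝 0) := by
  simp only [inner_poisMean]
  have h0 : (0 : ℂ) = ∫ _ : E3, (0 : ℂ) := by simp
  rw [h0]
  refine tendsto_integral_filter_of_dominated_convergence (fun s => pois s * (‖Ψ‖ * ‖f‖))
    (Eventually.of_forall fun N => ?_)
    (Eventually.of_forall fun N => Eventually.of_forall fun s => ?_)
    (integrable_pois.mul_const _) ?_
  · have hc : Continuous fun s : E3 => inner ℂ Ψ (rtr ((0 : E4), N • s) f) :=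
      continuous_const.inner ((continuous_rtr f).comp (by fun_prop))
    exact ((continuous_ofReal.comp continuous_pois).mul hc).aestronglyMeasurable
  · rw [norm_mul, norm_real, Real.norm_of_nonneg (pois_pos s).le]
    exact mul_le_mul_of_nonneg_left (norm_inner_rtr_le _ _ _) (pois_pos s).le
  · have : ∀ᵐ s : E3, s ≠ 0 := by simp [ae_iff, measure_singleton]
    filter_upwards [this] with s hs
    simpa using (tendsto_inner_rtr Ψ f hs).const_mul (pois s : ℂ)

end QHeis

namespace QHeis

/-! ### Collapsing the horizontal layer -/

/-- The scalar kernel, with constant density. -/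
noncomputable abbrev kone (b ε : ℝ) (h : H) : ℂ := ker 5 (fun _ => 1) b ε h

theorem continuous_kone {b ε : ℝ} (hb : 0 ≤ b) (hε : 0 < ε) : Continuous (kone b ε) :=
  (contDiff_ker 5 contDiff_const hb hε).continuous

/-- Changing the parameter `b` is the same as dilating the horizontal layer. -/
theorem kone_sq (t ε : ℝ) (h : H) : kone (t ^ 2) ε h = kone 1 ε (t • h.1, h.2) := by
  simp only [kone, ker, norm_smul, mul_pow, Real.norm_eq_abs, sq_abs, one_mul]

/-- A difference of two scalar kernels decays one order better than each of them; this makes it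
integrable. -/
theorem integrable_kone_sub {b ε N : ℝ} (hb : 0 < b) (hε : 0 < ε) (hN : 0 < N) :
    Integrable fun h => kone b ε h - kone b N h := by
  have hQ : ContDiff ℝ ∞ fun _ : E3 => (1 : ℂ) := contDiff_const
  let m := min ε N
  have hm : 0 < m := lt_min hε hN
  obtain ⟨C, hC0, hC⟩ := ker_bound 6 hQ (c := min (min b m) 1) (by positivity)
    (min_le_right _ _)
  refine ((integrable_wt_inv_pow (m := 6) le_rfl).const_mul (5 * C * |ε - N|)).mono'
    ((continuous_kone hb.le hε).sub (continuous_kone hb.le hN)).aestronglyMeasurable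
    (Eventually.of_forall fun h => ?_)
  have key := (convex_Ici m).norm_image_sub_le_of_norm_hasDerivWithin_le
    (f := fun a => kone b a h) (f' := fun a => -(5 : ℕ) * ker 6 (fun _ => 1) b a h)
    (C := 5 * (C * (wt h ^ 6)⁻¹)) (x := N) (y := ε) (fun a ha => ?_) (fun a ha => ?_)
    (min_le_right ε N) (min_le_left ε N)
  · rw [Real.norm_eq_abs] at key
    exact key.trans_eq (by ring)
  · have ha' : 0 < a := hm.trans_le ha
    have hpos : 0 < b * ‖h.1‖ ^ 2 + a := by positivity
    exact ((hasDerivAt_planeInt_fst 5 hQ hpos (-h.2)).comp_const_add _ _).hasDerivWithinAt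
  · rw [norm_mul, norm_neg, norm_natCast]
    exact mul_le_mul_of_nonneg_left (hC b a ((min_le_left _ _).trans (min_le_left _ _))
      (((min_le_left _ _).trans (min_le_right _ _)).trans ha) h)
      (by norm_num)

theorem integral_kone_horizontal {ε : ℝ} (hε : 0 < ε) (s : E3) :
    ∫ y : E4, kone 1 ε (y, s) = ((Real.pi ^ 5 / 3 * ((ε ^ 3)⁻¹ * pois (ε⁻¹ • s)) : ℝ) : ℂ) := by
  simp only [kone, ker, one_mul]
  exact integral_planeInt_five_eq_pois hε s

theorem integrable_kone_horizontal {ε : ℝ} (hε : 0 < ε) (s : E3) :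
    Integrable fun y : E4 => kone 1 ε (y, s) := by
  refine Integrable.of_integral_ne_zero ?_
  rw [integral_kone_horizontal hε, ofReal_ne_zero]
  have := pois_pos (ε⁻¹ • s)
  have := Real.pi_pos
  positivity

theorem integral_pois_scale {c : H → ℂ} {ε : ℝ} (hε : 0 < ε) :
    ∫ s : E3, (((ε ^ 3)⁻¹ * pois (ε⁻¹ • s) : ℝ) : ℂ) * c (0, s) =
      ∫ s : E3, (pois s : ℂ) * c (0, ε • s) := by
  have h := Measure.integral_comp_smul (volume : Measure E3)
    (fun s => (((ε ^ 3)⁻¹ : ℝ) : ℂ) * ((pois s : ℂ) * c (0, ε • s))) ε⁻¹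
  rw [integral_const_mul, finrank_euclideanSpace_fin, abs_of_pos (by positivity), real_smul,
    integral_const_mul] at h
  have hε3 : (((ε⁻¹ ^ 3)⁻¹ : ℝ) : ℂ) * ((((ε ^ 3)⁻¹ : ℝ) : ℂ) *
      ∫ s : E3, (pois s : ℂ) * c (0, ε • s)) = ∫ s : E3, (pois s : ℂ) * c (0, ε • s) := by
    rw [← mul_assoc, ← ofReal_mul]
    have : (ε⁻¹ ^ 3)⁻¹ * (ε ^ 3)⁻¹ = 1 := by field_simp
    rw [this, ofReal_one, one_mul]
  rw [hε3] at h
  rw [← h, ← integral_const_mul]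
  refine integral_congr_ae (Eventually.of_forall fun s => ?_)
  simp only [smul_inv_smul₀ hε.ne']
  push_cast
  ring

theorem integrable_pois_scale {c : H → ℂ} (hc : Continuous c) {M : ℝ} (hM : ∀ h, ‖c h‖ ≤ M) {ε : ℝ}
    (hε : 0 < ε) : Integrable fun s : E3 => (((ε ^ 3)⁻¹ * pois (ε⁻¹ • s) : ℝ) : ℂ) * c (0, s) := by
  have h1 : Integrable fun s : E3 => (((ε ^ 3)⁻¹ * pois (ε⁻¹ • s) : ℝ) : ℂ) :=
    ((integrable_pois.comp_smul (inv_ne_zero hε.ne')).const_mul _).ofReal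
  exact h1.mul_bdd (g := fun s : E3 => c (0, s))
    (hc.comp (by fun_prop)).aestronglyMeasurable (Eventually.of_forall fun s => hM _)

/-- The integral of a difference of scalar kernels against a function of the central variable. -/
theorem integral_kone_sub_center {c : H → ℂ} (hc : Continuous c) {M : ℝ} (hM : ∀ h, ‖c h‖ ≤ M)
    {ε N : ℝ} (hε : 0 < ε) (hN : 0 < N) :
    ∫ h, (kone 1 ε h - kone 1 N h) * c (0, h.2) = (Real.pi ^ 5 / 3 : ℝ) *
      ((∫ s, (pois s : ℂ) * c (0, ε • s)) - ∫ s, (pois s : ℂ) * c (0, N • s)) := by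
  have hi : Integrable fun h : H => (kone 1 ε h - kone 1 N h) * c (0, h.2) :=
    (integrable_kone_sub one_pos hε hN).mul_bdd
      (g := fun h : H => c (0, h.2)) (hc.comp (by fun_prop)).aestronglyMeasurable
      (Eventually.of_forall fun h => hM _)
  rw [Measure.volume_eq_prod] at hi ⊢
  rw [integral_prod_symm _ hi, ← integral_pois_scale hε, ← integral_pois_scale hN,
    ← integral_sub (integrable_pois_scale hc hM hε) (integrable_pois_scale hc hM hN),
    ← integral_const_mul]
  refine integral_congr_ae (Eventually.of_forall fun s => ?_)
  simp only
  rw [integral_mul_const, integral_sub (integrable_kone_horizontal hε s)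
    (integrable_kone_horizontal hN s), integral_kone_horizontal hε, integral_kone_horizontal hN]
  push_cast
  ring

/-- Letting the horizontal width parameter tend to infinity concentrates a difference of scalar
kernels on the centre. -/
theorem eq_of_kone_sub_const {c : H → ℂ} (hc : Continuous c) {M : ℝ} (hM : ∀ h, ‖c h‖ ≤ M)
    {ε N : ℝ} (hε : 0 < ε) (hN : 0 < N) {D : ℂ}
    (hD : ∀ t : ℝ, 0 < t → (1 + (t : ℂ) ^ 2) ^ 2 / 4 *
      ∫ h, (kone (t ^ 2) ε h - kone (t ^ 2) N h) * c h = D) :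
    D = (Real.pi ^ 5 / 12 : ℝ) *
      ((∫ s, (pois s : ℂ) * c (0, ε • s)) - ∫ s, (pois s : ℂ) * c (0, N • s)) := by
  have hκ := integrable_kone_sub one_pos hε hN
  have hi : ∀ r : ℝ, Integrable fun h : H => (kone 1 ε h - kone 1 N h) * c (r • h.1, h.2) :=
    fun r => hκ.mul_bdd (g := fun h : H => c (r • h.1, h.2))
      (hc.comp (by fun_prop)).aestronglyMeasurable
      (Eventually.of_forall fun h => hM _)
  -- The width `t²` is moved from the kernel to `c`, which is then evaluated at `(t⁻¹ y, s) → (0, s)`;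
  -- the Jacobian `t⁻⁴` cancels the growth of `(1 + t²)²`.
  have hscale : ∀ t : ℝ, 0 < t → ∫ h, (kone (t ^ 2) ε h - kone (t ^ 2) N h) * c h =
      ((t : ℂ) ^ 4)⁻¹ * ∫ h : H, (kone 1 ε h - kone 1 N h) * c (t⁻¹ • h.1, h.2) := by
    intro t ht
    have hi1 : Integrable fun h => (kone (t ^ 2) ε h - kone (t ^ 2) N h) * c h :=
      (integrable_kone_sub (by positivity) hε hN).mul_bdd hc.aestronglyMeasurable
        (Eventually.of_forall hM)
    have hi2 := hi t⁻¹
    rw [Measure.volume_eq_prod] at hi1 hi2 ⊢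
    rw [integral_prod_symm _ hi1, integral_prod_symm _ hi2, ← integral_const_mul]
    refine integral_congr_ae (Eventually.of_forall fun s => ?_)
    have h := Measure.integral_comp_smul (volume : Measure E4)
      (fun y => (kone 1 ε (y, s) - kone 1 N (y, s)) * c (t⁻¹ • y, s)) t
    rw [finrank_euclideanSpace_fin, abs_of_pos (by positivity), real_smul] at h
    simp only [kone_sq]
    push_cast at h
    rw [← h]
    simp only [inv_smul_smul₀ ht.ne']
  have hlim : Tendsto (fun t : ℝ => (1 + ((t⁻¹ : ℝ) : ℂ) ^ 2) ^ 2 / 4 *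
      ∫ h : H, (kone 1 ε h - kone 1 N h) * c (t⁻¹ • h.1, h.2)) atTop
      (𝓝 ((1 + 0 ^ 2) ^ 2 / 4 * ∫ h : H, (kone 1 ε h - kone 1 N h) * c (0, h.2))) := by
    have h0 : Tendsto (fun t : ℝ => ((t⁻¹ : ℝ) : ℂ)) atTop (𝓝 0) := by
      rw [← ofReal_zero]
      exact (continuous_ofReal.tendsto 0).comp tendsto_inv_atTop_zero
    refine Tendsto.mul (((tendsto_const_nhds.add (h0.pow 2)).pow 2).div_const 4) ?_
    refine tendsto_integral_filter_of_dominated_convergence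
      (fun h => ‖kone 1 ε h - kone 1 N h‖ * M) (Eventually.of_forall fun t => (hi _).1)
      (Eventually.of_forall fun t => Eventually.of_forall fun h => ?_)
      (hκ.norm.mul_const M) (Eventually.of_forall fun h => ?_)
    · rw [norm_mul]
      exact mul_le_mul_of_nonneg_left (hM _) (norm_nonneg _)
    · have h1 : Tendsto (fun t : ℝ => (t⁻¹ • h.1, h.2)) atTop (𝓝 ((0 : E4), h.2)) := by
        have := (tendsto_inv_atTop_zero (𝕜 := ℝ)).smul_const h.1
        rw [zero_smul] at this
        exact this.prodMk_nhds tendsto_const_nhds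
      exact ((hc.tendsto _).comp h1).const_mul _
  have hD' : Tendsto (fun t : ℝ => (1 + ((t⁻¹ : ℝ) : ℂ) ^ 2) ^ 2 / 4 *
      ∫ h : H, (kone 1 ε h - kone 1 N h) * c (t⁻¹ • h.1, h.2)) atTop (𝓝 D) := by
    refine tendsto_const_nhds.congr' ?_
    filter_upwards [eventually_gt_atTop 0] with t ht
    have ht' : (t : ℂ) ≠ 0 := ofReal_ne_zero.2 ht.ne'
    rw [← hD t ht, hscale t ht]
    push_cast
    field_simp
    ring
  rw [tendsto_nhds_unique hD' hlim, integral_kone_sub_center hc hM hε hN]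
  push_cast
  ring

end QHeis

namespace QHeis

/-! ### Cauchy-Fueter functions are reproduced up to a Poisson mean -/

/-- The correlation `∫ u(h w) K(w) dw`. -/
noncomputable def corr (u K : H → ℂ) (h : H) : ℂ := ∫ w, u (gmul h w) * K w

theorem memLp_comp_gmul_left {F : Type*} [NormedAddCommGroup F] {u : H → F}
    (hu : MemLp u 2 volume) (h : H) : MemLp (fun w => u (gmul h w)) 2 volume :=
  hu.comp_measurePreserving (measurePreserving_gmul_left h)

theorem integrable_corr {u K : H → ℂ} (hu : MemLp u 2 volume) (hK : MemLp K 2 volume) (h : H) :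
    Integrable fun w => u (gmul h w) * K w :=
  (memLp_comp_gmul_left hu h).integrable_mul hK

theorem integral_norm_corr_le {u K : H → ℂ} (hu : MemLp u 2 volume) (hK : MemLp K 2 volume)
    (h : H) : ∫ w, ‖u (gmul h w) * K w‖ ≤ (∫ w, ‖u w‖ ^ 2) + ∫ w, ‖K w‖ ^ 2 := by
  have h1 := (memLp_two_iff_integrable_sq_norm hK.1).1 hK
  have hu' := memLp_comp_gmul_left hu h
  have h2 := (memLp_two_iff_integrable_sq_norm hu'.1).1 hu'
  have h3 : ∫ w, ‖u (gmul h w)‖ ^ 2 = ∫ w, ‖u w‖ ^ 2 := integral_gmul_left h fun w => ‖u w‖ ^ 2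
  rw [← h3, ← integral_add h2 h1]
  refine integral_mono (integrable_corr hu hK h).norm (h2.add h1) fun w => ?_
  simp only [norm_mul]
  nlinarith [sq_nonneg (‖u (gmul h w)‖ - ‖K w‖), sq_nonneg ‖u (gmul h w)‖, sq_nonneg ‖K w‖]

theorem norm_corr_le {u K : H → ℂ} (hu : MemLp u 2 volume) (hK : MemLp K 2 volume)
    (h : H) : ‖corr u K h‖ ≤ (∫ w, ‖u w‖ ^ 2) + ∫ w, ‖K w‖ ^ 2 :=
  (norm_integral_le_integral_norm _).trans (integral_norm_corr_le hu hK h)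

theorem stronglyMeasurable_corr_uncurry {u K : H → ℂ} (hum : StronglyMeasurable u)
    (hKc : Continuous K) : StronglyMeasurable fun p : H × H => u (gmul p.1 p.2) * K p.2 :=
  (hum.comp_measurable (continuous_gmul continuous_fst continuous_snd).measurable).mul
    (hKc.comp continuous_snd).stronglyMeasurable

theorem stronglyMeasurable_corr {u K : H → ℂ} (hum : StronglyMeasurable u) (hKc : Continuous K) :
    StronglyMeasurable (corr u K) :=
  (stronglyMeasurable_corr_uncurry hum hKc).integral_prod_right

theorem integral_mul_corr {u K : H → ℂ} (hum : StronglyMeasurable u) (hu : MemLp u 2 volume)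
    (hKc : Continuous K) (hK : MemLp K 2 volume) {ψ : H → ℂ} (hψ : Continuous ψ)
    (hψc : HasCompactSupport ψ) :
    (Integrable fun w => (∫ h, ψ h * u (gmul h w)) * K w) ∧
      ∫ h, ψ h * corr u K h = ∫ w, (∫ h, ψ h * u (gmul h w)) * K w := by
  have hi : Integrable (Function.uncurry fun h w => ψ h * (u (gmul h w) * K w))
      (volume.prod volume) := by
    have hm : StronglyMeasurable fun p : H × H => ψ p.1 * (u (gmul p.1 p.2) * K p.2) :=
      (hψ.comp continuous_fst).stronglyMeasurable.mul (stronglyMeasurable_corr_uncurry hum hKc)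
    refine (integrable_prod_iff hm.aestronglyMeasurable).2
      ⟨Eventually.of_forall fun h => (integrable_corr hu hK h).const_mul (ψ h), ?_⟩
    have hm2 : StronglyMeasurable fun h => ∫ w, ‖ψ h * (u (gmul h w) * K w)‖ :=
      hm.norm.integral_prod_right
    refine ((hψ.integrable_of_hasCompactSupport hψc).norm.mul_const
      ((∫ w, ‖u w‖ ^ 2) + ∫ w, ‖K w‖ ^ 2)).mono' hm2.aestronglyMeasurable
      (Eventually.of_forall fun h => ?_)
    rw [Real.norm_of_nonneg (integral_nonneg fun w => norm_nonneg _)]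
    simp only [norm_mul (ψ h)]
    rw [integral_const_mul]
    exact mul_le_mul_of_nonneg_left (integral_norm_corr_le hu hK h) (norm_nonneg _)
  have e : ∀ w, ∫ h, ψ h * (u (gmul h w) * K w) = (∫ h, ψ h * u (gmul h w)) * K w := fun w => by
    simp only [← mul_assoc, integral_mul_const]
  constructor
  · have := hi.integral_prod_right
    simpa only [Function.uncurry_apply_pair, e] using this
  · have h := integral_integral_swap hi
    simp only [integral_const_mul, e] at h
    exact h

/-- The kernel of large width is small, uniformly against the weight `wt⁻⁴`. -/
theorem kone_bound_large : ∃ C, 0 ≤ C ∧ ∀ N : ℝ, 1 ≤ N → ∀ h,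
    ‖kone 1 N h‖ ≤ C * N⁻¹ * (wt h ^ 4)⁻¹ := by
  obtain ⟨C, hC0, hC⟩ := planeInt_bound 5 (Q := fun _ => 1) contDiff_const
  refine ⟨C, hC0, fun N hN h => ?_⟩
  have hN0 : 0 < N := one_pos.trans_le hN
  refine (hC _ (upper_subset_bdUpper (ker_mem zero_le_one hN0 h))).trans ?_
  rw [mul_assoc, ← mul_inv]
  have hw := wt_pos h
  have h1 : N ≤ 1 * ‖h.1‖ ^ 2 + N + ‖-h.2‖ := by
    have := norm_nonneg (-h.2)
    nlinarith [sq_nonneg ‖h.1‖]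
  have h2 : wt h ≤ 1 * ‖h.1‖ ^ 2 + N + ‖-h.2‖ := by
    rw [wt, norm_neg]
    linarith
  have h3 : N * wt h ^ 4 ≤ (1 * ‖h.1‖ ^ 2 + N + ‖-h.2‖) ^ 5 := by
    rw [pow_succ' _ 4]
    gcongr
  gcongr

variable {k : ℕ}

theorem memLp_kone {b ε : ℝ} (hb : 0 < b) (hε : 0 < ε) : MemLp (kone b ε) 2 volume :=
  memLp_ker (by norm_num) contDiff_const hb hε

theorem stronglyMeasurable_coord (f : L2H k) (l : Fin (k + 1)) :
    StronglyMeasurable fun h => f h l :=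
  (EuclideanSpace.proj (𝕜 := ℂ) l).continuous.comp_stronglyMeasurable (Lp.stronglyMeasurable f)

/-- The identity `IsKCF.sum_pairK_ent` for all left translates of a Cauchy-Fueter function. -/
theorem IsKCF.sum_corr_ent (hk : 1 ≤ k) {f : L2H k} (hf : IsKCF (f : H → V k)) {ε : ℝ}
    (hε : 0 < ε) {b : ℝ} (hb : 0 < b) (l : Fin (k + 1)) (h : H) :
    ∑ j : Fin (k + 1), corr (fun h => f h j) (ker 5 (ent k l j) 1 ε) h =
      (1 + (b : ℂ)) ^ 2 / 4 * corr (fun h => f h l) (kone b ε) h :=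
  (hf.comp_gmul h).sum_pairK_ent hk (memLp_comp_gmul_left (Lp.memLp f) h) hε hb l

/-- A Cauchy-Fueter function convolved with the regularized kernel is its Poisson mean. -/
theorem IsKCF.sum_corr_ent_ae_eq (hk : 1 ≤ k) {f : L2H k} (hf : IsKCF (f : H → V k)) {ε : ℝ}
    (hε : 0 < ε) (l : Fin (k + 1)) :
    ∀ᵐ h, ∑ j : Fin (k + 1), corr (fun h => f h j) (ker 5 (ent k l j) 1 ε) h =
      (Real.pi ^ 5 / 12 : ℝ) * poisMean ε f h l := by
  have hu : MemLp (fun h => f h l) 2 volume := memLp_coord (Lp.memLp f) l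
  have hum := stronglyMeasurable_coord f l
  have hred : ∀ {ε : ℝ}, 0 < ε → ∀ h,
      ∑ j : Fin (k + 1), corr (fun h => f h j) (ker 5 (ent k l j) 1 ε) h =
        corr (fun h => f h l) (kone 1 ε) h := fun hε h => by
    rw [hf.sum_corr_ent hk hε one_pos]
    push_cast
    norm_num
  simp only [hred hε]
  refine ae_eq_of_integral_contDiff_smul_eq ?_ ?_ fun g hg hgc => ?_
  · refine (locallyIntegrable_const ((∫ w, ‖f w l‖ ^ 2) + ∫ w, ‖kone 1 ε w‖ ^ 2)).mono
      (stronglyMeasurable_corr hum (continuous_kone zero_le_one hε)).aestronglyMeasurable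
      (Eventually.of_forall fun h => ?_)
    exact (norm_corr_le hu (memLp_kone one_pos hε) h).trans (le_abs_self _)
  · exact ((memLp_coord (Lp.memLp (poisMean ε f)) l).const_mul _).locallyIntegrable one_le_two
  let ψ : H → ℂ := fun h => (g h : ℂ)
  have hψ : Continuous ψ := continuous_ofReal.comp hg.continuous
  have hψc : HasCompactSupport ψ := hgc.comp_left ofReal_zero
  have hψ2 : MemLp (fun h => ψ h • (EuclideanSpace.single l 1 : V k)) 2 volume :=
    (hψ.smul continuous_const).memLp_of_hasCompactSupport hψc.smul_right
  let Ψ : L2H k := hψ2.toLp _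
  have hinner : ∀ F : L2H k, inner ℂ Ψ F = ∫ h, ψ h * F h l := fun F => by
    rw [L2.inner_def]
    refine integral_congr_ae ?_
    filter_upwards [hψ2.coeFn_toLp] with h hh
    rw [hh, inner_smul_left, EuclideanSpace.inner_single_left]
    simp [ψ]
  -- Testing against `ψ` turns the correlation of `f` with the kernel into the integral of the
  -- kernel against the bounded continuous function `c`, to which `eq_of_kone_sub_const` applies.
  let c : H → ℂ := fun w => inner ℂ Ψ (rtr w f)
  have hc : Continuous c := continuous_const.inner (continuous_rtr f)
  have hcM : ∀ w, ‖c w‖ ≤ ‖Ψ‖ * ‖f‖ := norm_inner_rtr_le Ψ f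
  have hc_eq : ∀ w, c w = ∫ h, ψ h * f (gmul h w) l := fun w => by
    simp only [c, hinner]
    refine integral_congr_ae ?_
    filter_upwards [coeFn_rtr w f] with h hh
    rw [hh]
  let D : ℝ → ℂ := fun ε => ∫ h, ψ h * corr (fun h => f h l) (kone 1 ε) h
  have hD : ∀ {ε : ℝ}, 0 < ε → ∀ {b : ℝ}, 0 < b →
      D ε = (1 + (b : ℂ)) ^ 2 / 4 * ∫ w, c w * kone b ε w := by
    intro ε hε b hb
    simp only [D, hc_eq]
    rw [← (integral_mul_corr hum hu (continuous_kone hb.le hε) (memLp_kone hb hε) hψ hψc).2,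
      ← integral_const_mul]
    refine integral_congr_ae (Eventually.of_forall fun h => ?_)
    simp only
    rw [← hred hε, hf.sum_corr_ent hk hε hb]
    ring
  have hci : ∀ {ε : ℝ}, 0 < ε → ∀ {b : ℝ}, 0 < b → Integrable fun w => c w * kone b ε w := by
    intro ε hε b hb
    simp only [hc_eq]
    exact (integral_mul_corr hum hu (continuous_kone hb.le hε) (memLp_kone hb hε) hψ hψc).1
  have hdiff : ∀ {N : ℝ}, 0 < N → D ε - D N = (Real.pi ^ 5 / 12 : ℝ) *
      (inner ℂ Ψ (poisMean ε f) - inner ℂ Ψ (poisMean N f)) := by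
    intro N hN
    rw [inner_poisMean, inner_poisMean]
    refine eq_of_kone_sub_const hc hcM hε hN fun t ht => ?_
    have ht2 : 0 < t ^ 2 := by positivity
    rw [hD hε ht2, hD hN ht2, ← mul_sub, ← integral_sub (hci hε ht2) (hci hN ht2)]
    push_cast
    congr 1
    refine integral_congr_ae (Eventually.of_forall fun w => ?_)
    ring
  -- The comparison kernel of width `N` disappears in the limit `N → ∞`, on both sides of `hdiff`.
  have hD0 : Tendsto D atTop (𝓝 0) := by
    obtain ⟨C, hC0, hC⟩ := kone_bound_large
    have hw4 : MemLp (fun w => (((wt w ^ 4)⁻¹ : ℝ) : ℂ)) 2 volume :=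
      (memLp_wt_inv_pow (by norm_num)).ofReal
    let M := (∫ w, ‖f w l‖ ^ 2) + ∫ w, ‖(((wt w ^ 4)⁻¹ : ℝ) : ℂ)‖ ^ 2
    have hT : Tendsto (fun N : ℝ => ∫ h, ‖ψ h‖ * (C * N⁻¹ * M)) atTop (𝓝 0) := by
      have : Tendsto (fun N : ℝ => (∫ h, ‖ψ h‖) * (C * N⁻¹ * M)) atTop
          (𝓝 ((∫ h, ‖ψ h‖) * (C * 0 * M))) :=
        ((tendsto_inv_atTop_zero.const_mul C).mul_const M).const_mul _
      simpa [integral_mul_const] using this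
    refine squeeze_zero_norm' ?_ hT
    filter_upwards [eventually_ge_atTop 1] with N hN
    have hN0 : 0 < N := one_pos.trans_le hN
    refine norm_integral_le_of_norm_le
      ((hψ.integrable_of_hasCompactSupport hψc).norm.mul_const _) (Eventually.of_forall fun h => ?_)
    rw [norm_mul]
    refine mul_le_mul_of_nonneg_left ?_ (norm_nonneg _)
    have hi := integrable_corr hu hw4 h
    calc ‖corr (fun h => f h l) (kone 1 N) h‖
        ≤ ∫ w, C * N⁻¹ * ‖f (gmul h w) l * (((wt w ^ 4)⁻¹ : ℝ) : ℂ)‖ := by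
          refine norm_integral_le_of_norm_le (hi.norm.const_mul _)
            (Eventually.of_forall fun w => ?_)
          rw [norm_mul, norm_mul, norm_real,
            Real.norm_of_nonneg (inv_nonneg.2 (pow_nonneg (wt_pos w).le 4))]
          calc _ ≤ ‖f (gmul h w) l‖ * (C * N⁻¹ * (wt w ^ 4)⁻¹) :=
                mul_le_mul_of_nonneg_left (hC N hN w) (norm_nonneg _)
            _ = _ := by ring
      _ ≤ C * N⁻¹ * M := by
          rw [integral_const_mul]
          exact mul_le_mul_of_nonneg_left (integral_norm_corr_le hu hw4 h) (by positivity)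
  have hlim : Tendsto (fun N => D ε - D N) atTop (𝓝 (D ε - 0)) := tendsto_const_nhds.sub hD0
  have hlim' : Tendsto (fun N => D ε - D N) atTop
      (𝓝 ((Real.pi ^ 5 / 12 : ℝ) * (inner ℂ Ψ (poisMean ε f) - 0))) := by
    refine Tendsto.congr' ?_ ((tendsto_const_nhds.sub (tendsto_inner_poisMean Ψ f)).const_mul _)
    filter_upwards [eventually_gt_atTop 0] with N hN
    exact (hdiff hN).symm
  have h := tendsto_nhds_unique hlim hlim'
  rw [sub_zero, sub_zero, hinner, ← integral_const_mul] at h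
  simp only [real_smul]
  refine h.trans (integral_congr_ae (Eventually.of_forall fun w => ?_))
  simp only [ψ]
  ring

end QHeis

namespace QHeis

/-! ### The operator-valued kernel -/

variable {k : ℕ}

/-- The matrix unit sending the `j`-th basis vector to the `l`-th one. -/
noncomputable def elemMat (l j : Fin (k + 1)) : V k →L[ℂ] V k :=
  (EuclideanSpace.proj (𝕜 := ℂ) j).smulRight (EuclideanSpace.single l 1)

theorem sum_smul_elemMat_apply (M : Fin (k + 1) → Fin (k + 1) → ℂ) (v : V k) (l : Fin (k + 1)) :
    (∑ i, ∑ j, M i j • elemMat i j) v l = ∑ j, M l j * v j := by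
  simp only [sum_apply, smul_apply, elemMat, ContinuousLinearMap.smulRight_apply,
    PiLp.smul_apply, PiLp.proj_apply, WithLp.ofLp_sum, Finset.sum_apply, smul_eq_mul,
    PiLp.single_apply]
  rw [Finset.sum_eq_single l]
  · simp
  · intro i _ hi
    simp [hi.symm]
  · simp

theorem Pτ_eq_sum (hk : 1 ≤ k) (τ : Metric.sphere (0 : E3) 1) :
    Pτ k τ = ∑ l : Fin (k + 1), ∑ j : Fin (k + 1), ent k l j τ • elemMat l j := by
  refine ContinuousLinearMap.ext fun v => ?_
  ext l
  rw [Pτ_apply hk, sum_smul_elemMat_apply]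

/-- The constant `2⁷ · 3 / (2π)⁵`. -/
noncomputable def kconst : ℝ := 2 ^ 7 * 3 / (2 * Real.pi) ^ 5

theorem kconst_mul : kconst * (Real.pi ^ 5 / 12) = 1 := by
  have := Real.pi_pos
  unfold kconst
  field_simp
  norm_num

/-- The kernel integral as a function on the closed half space without the origin. -/
noncomputable def kernelMat (k : ℕ) (p : ℝ × E3) : V k →L[ℂ] V k :=
  (kconst : ℂ) • ∑ l : Fin (k + 1), ∑ j : Fin (k + 1), planeInt 5 (ent k l j) p • elemMat l j

theorem kernelMat_apply (p : ℝ × E3) (v : V k) (l : Fin (k + 1)) :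
    kernelMat k p v l = kconst * ∑ j : Fin (k + 1), planeInt 5 (ent k l j) p * v j := by
  rw [kernelMat, smul_apply, PiLp.smul_apply, sum_smul_elemMat_apply, smul_eq_mul]

theorem kernelIntegrand_eq (hk : 1 ≤ k) (a : ℝ) (s : E3) (τ : Metric.sphere (0 : E3) 1) :
    kernelIntegrand k a s τ =
      ∑ l : Fin (k + 1), ∑ j : Fin (k + 1),
        (ent k l j τ * (phase (a, s) τ ^ 5)⁻¹) • elemMat l j := by
  rw [kernelIntegrand, Pτ_eq_sum hk, Finset.smul_sum]
  refine Finset.sum_congr rfl fun l _ => ?_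
  rw [Finset.smul_sum]
  refine Finset.sum_congr rfl fun j _ => ?_
  rw [smul_smul, mul_comm]
  rfl

theorem integrable_sum_smul {X F ι κ : Type*} [MeasurableSpace X] {μ : Measure X}
    [NormedAddCommGroup F] [NormedSpace ℂ F] [Fintype ι] [Fintype κ]
    {q : ι → κ → X → ℂ} (hq : ∀ l j, Integrable (q l j) μ) (e : ι → κ → F) :
    Integrable (fun x => ∑ l, ∑ j, q l j x • e l j) μ :=
  integrable_finsetSum Finset.univ fun l _ =>
    integrable_finsetSum Finset.univ fun j _ => (hq l j).smul_const (e l j)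

theorem integral_sum_smul {X F ι κ : Type*} [MeasurableSpace X] {μ : Measure X}
    [NormedAddCommGroup F] [NormedSpace ℂ F] [CompleteSpace F] [Fintype ι] [Fintype κ]
    {q : ι → κ → X → ℂ}
    (hq : ∀ l j, Integrable (q l j) μ) (e : ι → κ → F) :
    ∫ x, ∑ l, ∑ j, q l j x • e l j ∂μ = ∑ l, ∑ j, (∫ x, q l j x ∂μ) • e l j := by
  have hi : ∀ l j, Integrable (fun x => q l j x • e l j) μ := fun l j => (hq l j).smul_const (e l j)
  rw [integral_finsetSum Finset.univ fun l _ => integrable_finsetSum Finset.univ fun j _ => hi l j]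
  refine Finset.sum_congr rfl fun l _ => ?_
  rw [integral_finsetSum Finset.univ fun j _ => hi l j]
  exact Finset.sum_congr rfl fun j _ => integral_smul_const _ _

theorem integrable_ent (l j : Fin (k + 1)) {a : ℝ} (ha : 0 < a) (s : E3) :
    Integrable (fun τ : Metric.sphere (0 : E3) 1 => ent k l j τ * (phase (a, s) τ ^ 5)⁻¹)
      sphereMeasure :=
  integrable_sphInt (differentiableOn_inv_pow 5).continuousOn
    (contDiff_ent (n := 0) k l j).continuous (p := (a, s)) (mem_upper.2 ha)

theorem integrable_kernelIntegrand (hk : 1 ≤ k) {a : ℝ} (ha : 0 < a) (s : E3) :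
    Integrable (kernelIntegrand k a s) sphereMeasure := by
  have h := integrable_sum_smul (fun l j => integrable_ent l j ha s)
    fun l j => (elemMat l j : V k →L[ℂ] V k)
  rw [funext (kernelIntegrand_eq hk a s)]
  exact h

theorem integral_kernelIntegrand (hk : 1 ≤ k) {a : ℝ} (ha : 0 < a) (s : E3) :
    ∫ τ, kernelIntegrand k a s τ ∂sphereMeasure =
      ∑ l : Fin (k + 1), ∑ j : Fin (k + 1), planeInt 5 (ent k l j) (a, s) • elemMat l j := by
  have h := integral_sum_smul (fun l j => integrable_ent l j ha s) fun l j => (elemMat l j : V k →L[ℂ] V k)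
  rw [funext (kernelIntegrand_eq hk a s)]
  refine h.trans (Finset.sum_congr rfl fun l _ => Finset.sum_congr rfl fun j _ => ?_)
  rw [planeInt_eq 5 (contDiff_ent (n := 0) k l j).continuous (mem_upper.2 ha : (a, s) ∈ upper)]

theorem kernelIntegral_eq (hk : 1 ≤ k) {a : ℝ} (ha : 0 < a) (s : E3) :
    kernelIntegral k a s = kernelMat k (a, s) := by
  rw [kernelIntegral, integral_kernelIntegrand hk ha]
  rfl

theorem kernelMat_smul {t : ℝ} (ht : 0 < t) {p : ℝ × E3} (hp : p ∈ bdUpper) :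
    kernelMat k (t • p) = (((t ^ 5)⁻¹ : ℝ) : ℂ) • kernelMat k p := by
  unfold kernelMat
  rw [smul_comm]
  congr 1
  simp only [planeInt_smul 5 (contDiff_ent k _ _) ht hp, Finset.smul_sum, smul_smul]

theorem norm_kernelMat_le (k : ℕ) :
    ∃ C, 0 ≤ C ∧ ∀ p ∈ bdUpper, ‖kernelMat k p‖ ≤ C * ((p.1 + ‖p.2‖) ^ 5)⁻¹ := by
  choose C hC0 hC using fun l j : Fin (k + 1) => planeInt_bound 5 (contDiff_ent (n := ∞) k l j)
  refine ⟨‖(kconst : ℂ)‖ * ∑ l, ∑ j, C l j * ‖(elemMat l j : V k →L[ℂ] V k)‖,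
    mul_nonneg (norm_nonneg _) (Finset.sum_nonneg fun l _ => Finset.sum_nonneg fun j _ =>
      mul_nonneg (hC0 l j) (norm_nonneg _)), fun p hp => ?_⟩
  rw [kernelMat, norm_smul, mul_assoc, Finset.sum_mul]
  refine mul_le_mul_of_nonneg_left ((norm_sum_le _ _).trans (Finset.sum_le_sum fun l _ => ?_))
    (norm_nonneg _)
  rw [Finset.sum_mul]
  refine (norm_sum_le _ _).trans (Finset.sum_le_sum fun j _ => ?_)
  rw [norm_smul, mul_right_comm]
  exact mul_le_mul_of_nonneg_right (hC l j p hp) (norm_nonneg _)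

theorem continuousOn_kernelMat (k : ℕ) : ContinuousOn (kernelMat k) bdUpper := by
  unfold kernelMat
  refine ContinuousOn.const_smul (continuousOn_finsetSum _ fun l _ =>
    continuousOn_finsetSum _ fun j _ => ?_) (kconst : ℂ)
  exact ContinuousOn.smul (continuousOn_planeInt 5 (contDiff_ent k l j)) continuousOn_const

theorem contDiffOn_kernelMat_radial (k : ℕ) :
    ContDiffOn ℝ ∞ (fun h : H => kernelMat k (radial 1 0 h)) {0}ᶜ := by
  unfold kernelMat
  refine ContDiffOn.const_smul (kconst : ℂ) (ContDiffOn.sum fun l _ =>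
    ContDiffOn.sum fun j _ => ?_)
  exact ContDiffOn.smul (contDiffOn_planeInt_radial 5 (contDiff_ent k l j)) contDiffOn_const

/-- The kernel `S_ε`, regularized for `ε > 0`; `ε = 0` gives the boundary kernel `S`, whose value at
the origin is irrelevant. -/
noncomputable def regK (k : ℕ) (ε : ℝ) (h : H) : V k →L[ℂ] V k := kernelMat k (radial 1 ε h)

theorem kernelIntegral_eq_regK (hk : 1 ≤ k) {ε : ℝ} (hε : 0 < ε) :
    (fun p : H => kernelIntegral k (‖p.1‖ ^ 2 + ε) p.2) = regK k ε := by
  ext1 p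
  rw [kernelIntegral_eq hk (by positivity), regK, radial, one_mul]

theorem radial_one_mem_upper {ε : ℝ} (hε : 0 < ε) (h : H) : radial 1 ε h ∈ upper :=
  mem_upper.2 (by simp only [radial]; positivity)

theorem continuous_regK {ε : ℝ} (hε : 0 < ε) : Continuous (regK k ε) :=
  (continuousOn_kernelMat k).comp_continuous (contDiff_radial 1 ε (n := 0)).continuous
    fun h => upper_subset_bdUpper (radial_one_mem_upper hε h)

theorem norm_regK_le {ε : ℝ} (hε : 0 < ε) :
    ∃ C, 0 ≤ C ∧ ∀ h, ‖regK k ε h‖ ≤ C * (wt h ^ 5)⁻¹ := by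
  obtain ⟨C, hC0, hC⟩ := norm_kernelMat_le k
  have hc : 0 < min ε 1 := by positivity
  refine ⟨C * (min ε 1 ^ 5)⁻¹, by positivity, fun h => ?_⟩
  refine (hC _ (upper_subset_bdUpper (radial_one_mem_upper hε h))).trans ?_
  rw [mul_assoc, ← mul_inv, ← mul_pow]
  have hw := wt_pos h
  have : min ε 1 * wt h ≤ (radial 1 ε h).1 + ‖(radial 1 ε h).2‖ := by
    simp only [radial, wt]
    have h1 := mul_le_of_le_one_left (sq_nonneg ‖h.1‖) (min_le_right ε 1)
    have h2 := mul_le_of_le_one_left (norm_nonneg h.2) (min_le_right ε 1)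
    linarith [min_le_left ε 1]
  gcongr

theorem ginv_gmul_eq (w h : H) : gmul (ginv w) h = ginv (gmul (ginv h) w) := by
  ext i
  · simp [gmul, ginv]
  · fin_cases i <;> simp [gmul, ginv, B, Bmat, Fin.sum_univ_four] <;> ring

theorem wt_ginv (h : H) : wt (ginv h) = wt h := by simp [wt, ginv]

theorem aestronglyMeasurable_conv {g : H → V k} (hg : AEStronglyMeasurable g volume)
    {K : H → V k →L[ℂ] V k} {h : H}
    (hK : AEStronglyMeasurable (fun w => K (gmul (ginv w) h)) volume) :
    AEStronglyMeasurable (fun w => K (gmul (ginv w) h) (g w)) volume :=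
  (isBoundedBilinearMap_apply (𝕜 := ℂ) (E := V k) (F := V k)).continuous.comp_aestronglyMeasurable
    (hK.prodMk hg)

theorem convAt_regK {g : H → V k} (hg : MemLp g 2 volume) {ε : ℝ} (hε : 0 < ε) (h : H) :
    ConvAt g (regK k ε) h := by
  obtain ⟨C, hC0, hC⟩ := norm_regK_le (k := k) hε
  have hw : MemLp (fun w => (wt (gmul (ginv h) w) ^ 5)⁻¹) 2 volume :=
    memLp_comp_gmul_left (memLp_wt_inv_pow (m := 5) (by norm_num)) (ginv h)
  have hcont : Continuous fun w => regK k ε (gmul (ginv w) h) :=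
    (continuous_regK hε).comp (continuous_gmul continuous_neg continuous_const)
  have hi : Integrable fun w => C * (wt (gmul (ginv h) w) ^ 5)⁻¹ * ‖g w‖ :=
    (hw.const_mul C).integrable_mul hg.norm
  refine hi.mono' (aestronglyMeasurable_conv hg.1 hcont.aestronglyMeasurable)
    (Eventually.of_forall fun w => ?_)
  refine (ContinuousLinearMap.le_opNorm _ _).trans (mul_le_mul_of_nonneg_right ?_ (norm_nonneg _))
  have := hC (gmul (ginv w) h)
  rwa [ginv_gmul_eq, wt_ginv, ← ginv_gmul_eq] at this

theorem conv_regK_apply {g : H → V k} (hg : MemLp g 2 volume) {ε : ℝ} (hε : 0 < ε) (h : H)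
    (l : Fin (k + 1)) : conv g (regK k ε) h l =
      kconst * ∑ j : Fin (k + 1), corr (fun h => g h j) (ker 5 (ent k l j) 1 ε) h := by
  have h1 : conv g (regK k ε) h l = ∫ w, regK k ε (gmul (ginv w) h) (g w) l :=
    ((EuclideanSpace.proj (𝕜 := ℂ) l).integral_comp_comm (convAt_regK hg hε h)).symm
  rw [h1, ← integral_gmul_left h]
  unfold corr
  rw [← integral_finsetSum _ fun j _ => integrable_corr (memLp_coord hg j)
    (memLp_ker (by norm_num) (contDiff_ent k l j) one_pos hε) h, ← integral_const_mul]
  refine integral_congr_ae (Eventually.of_forall fun w => ?_)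
  simp only
  rw [ginv_gmul_eq, ginv_gmul_cancel, regK, kernelMat_apply]
  simp only [ker_eq, mul_comm]

/-- Convolving a Cauchy-Fueter function with the regularized kernel gives its Poisson mean. -/
theorem IsKCF.conv_regK_ae_eq (hk : 1 ≤ k) {f : L2H k} (hf : IsKCF (f : H → V k)) {ε : ℝ}
    (hε : 0 < ε) : conv f (regK k ε) =ᵐ[volume] poisMean ε f := by
  have h := ae_all_iff.2 fun l => hf.sum_corr_ent_ae_eq hk hε l
  filter_upwards [h] with q hq
  ext l
  rw [conv_regK_apply (Lp.memLp f) hε, hq, ← mul_assoc, ← ofReal_mul, kconst_mul, ofReal_one,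
    one_mul]

end QHeis

namespace QHeis

/-! ### The rows of the kernel are Cauchy-Fueter functions -/

theorem integral_mul_fderiv_eq_zero {a φ : H → ℂ} (ha : ContDiff ℝ ∞ a) (hφ : IsTest φ) (v : H)
    (hav : ∀ h, fderiv ℝ a h v = 0) : ∫ h, a h * fderiv ℝ φ h v = 0 := by
  have hφ' : Continuous fun h => fderiv ℝ φ h v :=
    (hφ.smooth.continuous_fderiv (by simp)).clm_apply continuous_const
  have hφc : HasCompactSupport fun h => fderiv ℝ φ h v :=
    (hφ.compact.fderiv (𝕜 := ℝ)).comp_left (g := fun L : H →L[ℝ] ℂ => L v) rfl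
  have : (volume : Measure H).IsAddHaarMeasure := Measure.prod.instIsAddHaarMeasure _ _
  rw [integral_mul_fderiv_eq_neg_fderiv_mul_of_integrable]
  · simp [hav]
  · simp [hav]
  · exact (ha.continuous.mul hφ').integrable_of_hasCompactSupport hφc.mul_left
  · exact (ha.continuous.mul hφ.smooth.continuous).integrable_of_hasCompactSupport
      hφ.compact.mul_left
  · exact fun h _ => ha.differentiable (by simp) h
  · exact fun h _ => hφ.smooth.differentiable (by simp) h

/-- The vector fields `Y_j` are divergence free. -/
theorem integral_Y_eq_zero {φ : H → ℂ} (hφ : IsTest φ) (j : Fin 4) : ∫ h, Y j φ h = 0 := by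
  let b : Fin 3 → H → ℂ := fun l h => ((2 * B h.1 (EuclideanSpace.single j 1) l : ℝ) : ℂ)
  have hb : ∀ l, ContDiff ℝ ∞ (b l) := fun l => by
    have h1 : ContDiff ℝ ∞ fun h : H => B h.1 (EuclideanSpace.single j 1) :=
      contDiff_B contDiff_fst contDiff_const
    exact ofRealCLM.contDiff.comp (contDiff_const.mul ((contDiff_piLp_apply 2).comp h1))
  have hbv : ∀ l h, fderiv ℝ (b l) h (0, EuclideanSpace.single l 1) = 0 := fun l h => by
    have h1 : b l = (fun y : E4 => ((2 * B y (EuclideanSpace.single j 1) l : ℝ) : ℂ)) ∘ Prod.fst :=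
      rfl
    have h2 : ContDiff ℝ ∞ fun y : E4 => ((2 * B y (EuclideanSpace.single j 1) l : ℝ) : ℂ) := by
      have h1 : ContDiff ℝ ∞ fun h : E4 => B h (EuclideanSpace.single j 1) :=
        contDiff_B contDiff_id contDiff_const
      exact ofRealCLM.contDiff.comp (contDiff_const.mul ((contDiff_piLp_apply 2).comp h1))
    rw [h1, fderiv_comp h (h2.differentiable (by simp) _) differentiableAt_fst, fderiv_fst,
      ContinuousLinearMap.comp_apply, ContinuousLinearMap.coe_fst', map_zero]
  have e : ∀ h, Y j φ h = 1 * fderiv ℝ φ h (EuclideanSpace.single j 1, 0) +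
      ∑ l, b l h * fderiv ℝ φ h (0, EuclideanSpace.single l 1) := by
    intro h
    have hv : hvec j h = (EuclideanSpace.single j 1, 0) +
        ∑ l, (2 * B h.1 (EuclideanSpace.single j 1) l) • ((0 : E4), (EuclideanSpace.single l 1 : E3)) := by
      refine Prod.ext ?_ ?_
      · simp [hvec, Fin.sum_univ_three]
      · ext l
        fin_cases l <;> simp [hvec, Fin.sum_univ_three]
    rw [Y_eq, hv, map_add, map_sum]
    simp only [map_smul, real_smul, one_mul, b]
  have hi : ∀ (a : H → ℂ), Continuous a → ∀ v, Integrable fun h => a h * fderiv ℝ φ h v := by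
    intro a ha v
    have hφc : HasCompactSupport fun h => fderiv ℝ φ h v :=
      (hφ.compact.fderiv (𝕜 := ℝ)).comp_left (g := fun L : H →L[ℝ] ℂ => L v) rfl
    exact (ha.mul ((hφ.smooth.continuous_fderiv (by simp)).clm_apply
      continuous_const)).integrable_of_hasCompactSupport hφc.mul_left
  simp only [e]
  rw [integral_add (hi (fun _ => 1) continuous_const _)
    (integrable_finsetSum _ fun l _ => hi _ (hb l).continuous _),
    integral_finsetSum _ fun l _ => hi _ (hb l).continuous _,
    integral_mul_fderiv_eq_zero (a := fun _ => 1) contDiff_const hφ _ (by simp)]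
  simp only [integral_mul_fderiv_eq_zero (hb _) hφ _ (hbv _), Finset.sum_const_zero, add_zero]

theorem integral_Z_eq_zero {φ : H → ℂ} (hφ : IsTest φ) (A A' : Fin 2) : ∫ h, Z A A' φ h = 0 := by
  simp only [Z_eq]
  rw [integral_finsetSum]
  · simp [integral_const_mul, integral_Y_eq_zero hφ]
  · exact fun j _ => (((hφ.Y j).1.integrable_of_hasCompactSupport (hφ.Y j).2)).const_mul _

theorem IsTest.smooth_mul {a φ : H → ℂ} (ha : ContDiff ℝ ∞ a) (hφ : IsTest φ) :
    IsTest fun h => a h * φ h :=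
  ⟨ha.mul hφ.smooth, hφ.compact.mul_left⟩

/-- A smooth classical solution is a weak solution. -/
theorem isKCF_of_smooth {k : ℕ} {f : H → V k} (hf : ∀ j, ContDiff ℝ ∞ fun h => f h j)
    (hZ : ∀ (i : Fin k) (A : Fin 2) (h : H),
      Z A 0 (fun h => f h i.castSucc) h + Z A 1 (fun h => f h i.succ) h = 0) : IsKCF f := by
  intro φ hφ i A
  have hd := fun j h => (hf j).differentiable (by simp) h
  have hφd := fun h => hφ.smooth.differentiable (by simp) h
  have t0 := hφ.smooth_mul (hf i.castSucc)
  have t1 := hφ.smooth_mul (hf i.succ)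
  have h0 := integral_add (μ := volume)
    ((t0.Z A 0).1.integrable_of_hasCompactSupport (t0.Z A 0).2)
    ((t1.Z A 1).1.integrable_of_hasCompactSupport (t1.Z A 1).2)
  rw [integral_Z_eq_zero t0, integral_Z_eq_zero t1, add_zero] at h0
  rw [pairing, neg_eq_zero, ← h0]
  refine integral_congr_ae (Eventually.of_forall fun h => ?_)
  simp only
  rw [Z_mul (hd _ h) (hφd h), Z_mul (hd _ h) (hφd h)]
  linear_combination (-φ h) * hZ i A h

theorem Y_planeInt (m : ℕ) {Q : E3 → ℂ} (hQ : ContDiff ℝ ∞ Q) {ε : ℝ} (hε : 0 < ε)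
    (j : Fin 4) (h : H) :
    Y j (fun h => planeInt m Q (radial 1 ε h)) h =
      -m * (2 * h.1 j * planeInt (m + 1) Q (radial 1 ε h) -
      2 * I * ∑ l, (B h.1 (EuclideanSpace.single j 1) l : ℂ) *
        planeInt (m + 1) (fun τ => τ l * Q τ) (radial 1 ε h)) := by
  have h1 : HasFDerivAt (radial 1 ε)
      ((((1 : ℝ) • (2 : ℝ) • (innerSL ℝ h.1).comp (ContinuousLinearMap.fst ℝ E4 E3))).prod
        (ContinuousLinearMap.snd ℝ E4 E3)) h := by
    have h2 : HasFDerivAt (fun h : H => ‖h.1‖ ^ 2)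
        ((2 : ℝ) • (innerSL ℝ h.1).comp (ContinuousLinearMap.fst ℝ E4 E3)) h := by
      have := (hasFDerivAt_fst (𝕜 := ℝ) (p := h)).norm_sq
      exact this.congr_fderiv ((two_nsmul _).trans (two_smul ℝ _).symm)
    exact ((h2.const_mul 1).add_const ε).prodMk hasFDerivAt_snd
  have h3 : HasFDerivAt (fun h => planeInt m Q (radial 1 ε h)) _ h :=
    (hasFDerivAt_planeInt m hQ (radial_one_mem_upper hε h)).comp h h1
  rw [Y_eq, h3.fderiv]
  simp only [hvec, planeDeriv, ContinuousLinearMap.comp_apply, add_apply, smul_apply,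
    ContinuousLinearMap.prod_apply, ContinuousLinearMap.coe_fst', ContinuousLinearMap.coe_snd',
    Fin.sum_univ_three, innerSL_apply_apply, EuclideanSpace.inner_single_right,
    PiLp.proj_apply, PiLp.smul_apply, smul_eq_mul, ofRealCLM_apply]
  simp
  ring

/-- The symbol of `∑_{A'} Z_A^{A'}` on a plane wave annihilates every column of `P^τ`. -/
theorem symbol_eq_zero (A : Fin 2) (h : H) (t : Fin 3 → ℂ) (Q : Fin 2 → ℂ)
    (h0 : (1 - t 0) * Q 0 = (-I * t 1 - t 2) * Q 1) (h1 : (1 + t 0) * Q 1 = (I * t 1 - t 2) * Q 0) :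
    ∑ A', ((∑ j, zc A A' j * (h.1 j : ℂ)) * Q A' -
      I * ∑ l, (∑ j, zc A A' j * (B h.1 (EuclideanSpace.single j 1) l : ℂ)) * (t l * Q A')) = 0 := by
  have hI := I_sq
  fin_cases A <;> simp [zc, B, Bmat, Fin.sum_univ_four, Fin.sum_univ_three, Matrix.of_apply]
  · linear_combination (-(h.1 2 : ℂ) - I * h.1 3) * h0 + (-(h.1 0 : ℂ) - I * h.1 1) * h1 +
      (-(h.1 2 : ℂ) * Q 0 * t 0 + h.1 2 * Q 1 * t 2 + h.1 0 * Q 0 * t 2 + h.1 0 * Q 1 * t 0) * hI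
  · linear_combination ((h.1 0 : ℂ) - I * h.1 1) * h0 + (-(h.1 2 : ℂ) + I * h.1 3) * h1 +
      ((h.1 0 : ℂ) * Q 0 * t 0 - h.1 0 * Q 1 * t 2 + h.1 2 * Q 0 * t 2 + h.1 2 * Q 1 * t 0) * hI

theorem contDiff_planeInt_radial_one (m : ℕ) {Q : E3 → ℂ} (hQ : ContDiff ℝ ∞ Q) {ε : ℝ}
    (hε : 0 < ε) : ContDiff ℝ ∞ fun h => planeInt m Q (radial 1 ε h) :=
  (contDiffOn_planeInt m hQ).comp_contDiff (contDiff_radial 1 ε) (radial_one_mem_upper hε)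

theorem sum_Z_planeInt_eq_zero {Q : Fin 2 → E3 → ℂ} (hQ : ∀ A, ContDiff ℝ ∞ (Q A))
    (h0 : ∀ τ : Metric.sphere (0 : E3) 1, mm τ * Q 0 τ = qb τ * Q 1 τ)
    (h1 : ∀ τ : Metric.sphere (0 : E3) 1, pp τ * Q 1 τ = qq τ * Q 0 τ)
    {ε : ℝ} (hε : 0 < ε) (A : Fin 2) (h : H) :
    ∑ A', Z A A' (fun h => planeInt 5 (Q A') (radial 1 ε h)) h = 0 := by
  have hp := radial_one_mem_upper hε h
  let a : Fin 2 → ℂ := fun A' => ∑ j, zc A A' j * (h.1 j : ℂ)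
  let c : Fin 2 → Fin 3 → ℂ := fun A' l =>
    -I * ∑ j, zc A A' j * (B h.1 (EuclideanSpace.single j 1) l : ℂ)
  have hcq : ∀ A' l, ContDiff ℝ ∞ fun τ : E3 => c A' l * ((τ l : ℂ) * Q A' τ) := fun A' l =>
    contDiff_const.mul (contDiff_coord_mul l (hQ A'))
  have haq : ∀ A', ContDiff ℝ ∞ fun τ : E3 => a A' * Q A' τ := fun A' =>
    contDiff_const.mul (hQ A')
  have hR : ∀ A', ContDiff ℝ ∞ fun τ : E3 => a A' * Q A' τ + ∑ l, c A' l * ((τ l : ℂ) * Q A' τ) :=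
    fun A' => (haq A').add (ContDiff.sum fun l _ => hcq A' l)
  have key : planeInt 6 (fun τ => ∑ A', (a A' * Q A' τ + ∑ l, c A' l * ((τ l : ℂ) * Q A' τ)))
      (radial 1 ε h) = 0 := by
    rw [planeInt_congr 6 (ContDiff.sum fun A' _ => hR A') contDiff_const (Q' := fun _ => 0) ?_ hp,
      planeInt_zero 6 hp]
    intro τ
    rw [← symbol_eq_zero A h (fun l => ((τ : E3) l : ℂ)) (fun A' => Q A' τ) (h0 τ) (h1 τ)]
    refine Finset.sum_congr rfl fun A' _ => ?_
    simp only [a, c, Fin.sum_univ_three]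
    ring
  rw [planeInt_sum 6 _ hR hp] at key
  have e : ∀ A', Z A A' (fun h => planeInt 5 (Q A') (radial 1 ε h)) h =
      -10 * planeInt 6 (fun τ => a A' * Q A' τ + ∑ l, c A' l * ((τ l : ℂ) * Q A' τ))
        (radial 1 ε h) := by
    intro A'
    rw [planeInt_add 6 (haq A') (ContDiff.sum fun l _ => hcq A' l) hp,
      planeInt_sum 6 _ (hcq A') hp, planeInt_const_mul 6 (hQ A') _ hp, Z_eq]
    simp only [planeInt_const_mul 6 (contDiff_coord_mul _ (hQ A')) _ hp, Y_planeInt 5 (hQ A') hε,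
      a, c, Fin.sum_univ_three, Fin.sum_univ_four]
    push_cast
    ring
  simp only [e, ← Finset.mul_sum, key, mul_zero]

variable {k : ℕ}

/-- The adjoint of the `l`-th row of the regularized kernel at the inverse point, up to a
constant. -/
noncomputable def rowFn (k : ℕ) (ε : ℝ) (l : Fin (k + 1)) (h : H) : V k :=
  WithLp.toLp 2 fun j : Fin (k + 1) => planeInt 5 (ent k j l) (radial 1 ε h)

theorem isKCF_rowFn {ε : ℝ} (hε : 0 < ε) (l : Fin (k + 1)) : IsKCF (rowFn k ε l) := by
  refine isKCF_of_smooth (fun j => contDiff_planeInt_radial_one 5 (contDiff_ent k j l) hε)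
    fun i A h => ?_
  have hs := fun τ => ent_succ (k := k) i.2 (Nat.lt_succ_iff.1 l.2) τ
  have := sum_Z_planeInt_eq_zero (Q := ![ent k i l, ent k (i + 1) l])
    (fun A => by fin_cases A <;> exact contDiff_ent k _ l) (fun τ => (hs τ).2.symm)
    (fun τ => (hs τ).1) hε A h
  rw [Fin.sum_univ_two] at this
  exact this

theorem conj_planeInt (m : ℕ) {Q : E3 → ℂ} (hQ : Continuous Q) {p : ℝ × E3} (hp : p ∈ upper) :
    (starRingEnd ℂ) (planeInt m Q p) =
      planeInt m (fun τ => (starRingEnd ℂ) (Q τ)) (p.1, -p.2) := by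
  have hp' : (p.1, -p.2) ∈ upper := mem_upper.2 (mem_upper.1 hp)
  rw [planeInt_eq m hQ hp, planeInt_eq m (Q := fun τ => (starRingEnd ℂ) (Q τ))
    (continuous_conj.comp hQ) hp', ← integral_conj]
  refine integral_congr_ae (Eventually.of_forall fun τ => ?_)
  simp [phase, inner_neg_right]

theorem conj_rowFn {ε : ℝ} (hε : 0 < ε) (l j : Fin (k + 1)) (h : H) :
    (starRingEnd ℂ) (rowFn k ε l h j) = ker 5 (ent k l j) 1 ε h := by
  have h1 := conj_planeInt 5 (contDiff_ent (n := 0) k j l).continuous (radial_one_mem_upper hε h)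
  simp only [conj_ent] at h1
  exact h1

theorem memLp_rowFn {ε : ℝ} (hε : 0 < ε) (l : Fin (k + 1)) : MemLp (rowFn k ε l) 2 volume := by
  have h1 : ∀ j : Fin (k + 1), MemLp (fun h => rowFn k ε l h j) 2 volume := fun j => by
    have h2 := (memLp_ker (m := 5) (by norm_num) (contDiff_ent k l j) one_pos hε).star
    refine h2.congr_norm
      (contDiff_planeInt_radial_one 5 (contDiff_ent k j l) hε).continuous.aestronglyMeasurable
      (Eventually.of_forall fun h => ?_)
    rw [Pi.star_apply, norm_star, ← conj_rowFn hε, RCLike.norm_conj]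
  have e : rowFn k ε l = fun h => ∑ j, ContinuousLinearMap.toSpanSingleton ℂ
      (EuclideanSpace.single j 1 : V k) (rowFn k ε l h j) := by
    ext h i
    simp [Pi.single_apply]
  rw [e]
  exact memLp_finsetSum _ fun j _ => ContinuousLinearMap.comp_memLp' _ (h1 j)

theorem IsKCF.congr_ae {f g : H → V k} (hf : IsKCF f) (h : f =ᵐ[volume] g) : IsKCF g := by
  intro φ hφ i A
  rw [← hf φ hφ i A, pairing, pairing, neg_inj]
  refine integral_congr_ae ?_
  filter_upwards [h] with w hw
  rw [hw]

/-- Functions orthogonal to the Cauchy-Fueter functions are annihilated by the regularized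
kernel. -/
theorem conv_regK_eq_zero {u : L2H k} (hu : u ∈ (kCF k)ᗮ) {ε : ℝ} (hε : 0 < ε) (h : H) :
    conv u (regK k ε) h = 0 := by
  ext l
  rw [conv_regK_apply (Lp.memLp u) hε]
  have hm : MemLp (fun w => rowFn k ε l (gmul (ginv h) w)) 2 volume :=
    memLp_comp_gmul_left (memLp_rowFn hε l) (ginv h)
  have hΨ : hm.toLp _ ∈ kCF k :=
    ((isKCF_rowFn hε l).comp_gmul (ginv h)).congr_ae hm.coeFn_toLp.symm
  have h0 := (Submodule.mem_orthogonal _ _).1 hu _ hΨ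
  rw [L2.inner_def] at h0
  have h1 : ∫ w, ⟪hm.toLp _ w, u w⟫_ℂ =
      ∫ w, ∑ j : Fin (k + 1), u w j * ker 5 (ent k l j) 1 ε (gmul (ginv h) w) := by
    refine integral_congr_ae ?_
    filter_upwards [hm.coeFn_toLp] with w hw
    rw [hw, PiLp.inner_apply]
    refine Finset.sum_congr rfl fun j _ => ?_
    rw [← conj_rowFn hε]
    rfl
  have h2 : ∫ w, ∑ j : Fin (k + 1), u w j * ker 5 (ent k l j) 1 ε (gmul (ginv h) w) =
      ∑ j : Fin (k + 1), corr (fun h => u h j) (ker 5 (ent k l j) 1 ε) h := by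
    rw [← integral_gmul_left h]
    simp only [ginv_gmul_cancel]
    exact integral_finsetSum _ fun j _ => integrable_corr (memLp_coord (Lp.memLp u) j)
      (memLp_ker (by norm_num) (contDiff_ent k l j) one_pos hε) h
  rw [← h2, ← h1, h0]
  simp

/-- Convolution with the regularized kernel factors through the Szegő projection. -/
theorem conv_regK_szegoProjection (g : L2H k) {ε : ℝ} (hε : 0 < ε) (h : H) :
    conv g (regK k ε) h = conv (szegoProjection k g) (regK k ε) h := by
  have hu : g - szegoProjection k g ∈ (kCF k)ᗮ :=
    Submodule.sub_starProjection_mem_orthogonal g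
  have h0 := conv_regK_eq_zero hu hε h
  have hg := convAt_regK (Lp.memLp g) hε h
  have hP := convAt_regK (Lp.memLp (szegoProjection k g)) hε h
  rw [← sub_eq_zero, ← h0]
  unfold conv
  rw [← integral_sub hg hP]
  refine integral_congr_ae ?_
  filter_upwards [Lp.coeFn_sub g (szegoProjection k g)] with w hw
  rw [hw, Pi.sub_apply, map_sub]

theorem szegoProjection_mem (g : L2H k) : IsKCF (szegoProjection k g : H → V k) :=
  Submodule.starProjection_apply_mem (kCF k) g

theorem conv_regK_ae_eq (hk : 1 ≤ k) (g : L2H k) {ε : ℝ} (hε : 0 < ε) :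
    conv g (regK k ε) =ᵐ[volume] poisMean ε (szegoProjection k g) := by
  have h := (szegoProjection_mem g).conv_regK_ae_eq hk hε
  filter_upwards [h] with q hq
  rw [conv_regK_szegoProjection g hε, hq]

end QHeis

namespace QHeis

/-! ### The boundary kernel off the support -/

variable {k : ℕ}

/-- Near a point off the support of `g`, the regularized integrands are dominated uniformly in the
regularization parameter. -/
theorem exists_conv_bound {U : Set H} (hU : IsOpen U) {h : H} (hh : h ∈ U) :
    ∃ C, 0 ≤ C ∧ ∀ w ∉ U, gmul (ginv w) h ≠ 0 ∧
      ∀ ε, 0 ≤ ε → ‖regK k ε (gmul (ginv w) h)‖ ≤ C * (wt (gmul (ginv h) w) ^ 5)⁻¹ := by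
  obtain ⟨C, hC0, hC⟩ := norm_kernelMat_le k
  have hcont : Continuous fun v : H => gmul h (ginv v) :=
    continuous_gmul continuous_const continuous_neg
  have h0 : gmul h (ginv 0) = h := by
    rw [ginv_eq_neg, neg_zero, gmul_zero]
  have hnhds : (fun v : H => gmul h (ginv v)) ⁻¹' U ∈ 𝓝 (0 : H) :=
    (hU.preimage hcont).mem_nhds (by rw [Set.mem_preimage, h0]; exact hh)
  obtain ⟨ρ, hρ, hball⟩ := Metric.mem_nhds_iff.1 hnhds
  -- A ball of radius `ρ` contains the set where `‖y‖² + ‖s‖ < δ`.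
  let δ := min ρ (ρ ^ 2)
  have hδ : 0 < δ := by positivity
  refine ⟨C * ((δ / (1 + δ)) ^ 5)⁻¹, by positivity, fun w hw => ?_⟩
  set v := gmul (ginv w) h with hv
  have hvw : ginv v = gmul (ginv h) w := by
    rw [hv, ginv_gmul_eq, ginv_eq_neg, ginv_eq_neg, neg_neg]
  have hlow : δ ≤ ‖v.1‖ ^ 2 + ‖v.2‖ := by
    by_contra! hlt
    apply hw
    have hmem : v ∈ Metric.ball (0 : H) ρ := by
      rw [mem_ball_zero_iff, Prod.norm_def, max_lt_iff]
      have h1 : ‖v.1‖ ^ 2 < ρ ^ 2 :=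
        lt_of_lt_of_le (by linarith [norm_nonneg v.2]) (min_le_right ρ (ρ ^ 2))
      have h2 : ‖v.2‖ < ρ :=
        lt_of_lt_of_le (by linarith [sq_nonneg ‖v.1‖]) (min_le_left ρ (ρ ^ 2))
      exact ⟨lt_of_pow_lt_pow_left₀ 2 hρ.le h1, h2⟩
    have := hball hmem
    rwa [Set.mem_preimage, hvw, gmul_ginv_cancel] at this
  have hv0 : v ≠ 0 := by
    intro h0
    rw [h0] at hlow
    simp at hlow
    linarith
  refine ⟨hv0, fun ε hε => ?_⟩
  rw [← hvw, wt_ginv]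
  have hmem : radial 1 ε v ∈ bdUpper := by
    rcases hε.eq_or_lt with rfl | hε
    · exact radial_mem_bdUpper hv0
    · exact upper_subset_bdUpper (radial_one_mem_upper hε v)
  refine (hC _ hmem).trans ?_
  rw [mul_assoc, ← mul_inv, ← mul_pow]
  have hwt := wt_pos v
  have hle : δ / (1 + δ) * wt v ≤ (radial 1 ε v).1 + ‖(radial 1 ε v).2‖ := by
    rw [div_mul_eq_mul_div, div_le_iff₀ (by positivity)]
    simp only [radial, wt]
    nlinarith
  gcongr

theorem tendsto_regK {h : H} (hh : h ≠ 0) :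
    Tendsto (fun ε => regK k ε h) (𝓝[>] 0) (𝓝 (regK k 0 h)) := by
  have h1 : ContinuousWithinAt (kernelMat k) bdUpper (radial 1 0 h) :=
    continuousOn_kernelMat k _ (radial_mem_bdUpper hh)
  refine h1.tendsto.comp (tendsto_nhdsWithin_iff.2 ⟨?_, ?_⟩)
  · have : Continuous fun ε => radial 1 ε h := by unfold radial; fun_prop
    exact (this.tendsto 0).mono_left nhdsWithin_le_nhds
  · filter_upwards [self_mem_nhdsWithin] with ε hε
    exact upper_subset_bdUpper (radial_one_mem_upper hε h)

/-- Off the support of `g` the convolution with the boundary kernel converges absolutely, and it is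
the limit of the regularized convolutions. -/
theorem conv_boundary {g : H → V k} (hg : MemLp g 2 volume) {U : Set H} (hU : IsOpen U)
    (hgU : ∀ᵐ w : H, w ∈ U → g w = 0) {h : H} (hh : h ∈ U) {ε : ℕ → ℝ}
    (hε : Tendsto ε atTop (𝓝[>] 0)) (hε0 : ∀ n, 0 < ε n) :
    ConvAt g (regK k 0) h ∧
      Tendsto (fun n => conv g (regK k (ε n)) h) atTop (𝓝 (conv g (regK k 0) h)) := by
  obtain ⟨C, hC0, hC⟩ := exists_conv_bound (k := k) hU hh
  have hw : MemLp (fun w => (wt (gmul (ginv h) w) ^ 5)⁻¹) 2 volume :=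
    memLp_comp_gmul_left (memLp_wt_inv_pow (m := 5) (by norm_num)) (ginv h)
  have hi : Integrable fun w => C * (wt (gmul (ginv h) w) ^ 5)⁻¹ * ‖g w‖ :=
    (hw.const_mul C).integrable_mul hg.norm
  have hbound : ∀ e, 0 ≤ e → ∀ᵐ w, ‖regK k e (gmul (ginv w) h) (g w)‖ ≤
      C * (wt (gmul (ginv h) w) ^ 5)⁻¹ * ‖g w‖ := by
    intro e he
    filter_upwards [hgU] with w hw
    by_cases hwU : w ∈ U
    · rw [hw hwU]
      simp
    · exact (ContinuousLinearMap.le_opNorm _ _).trans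
        (mul_le_mul_of_nonneg_right ((hC w hwU).2 e he) (norm_nonneg _))
  have hlim : ∀ᵐ w, Tendsto (fun n => regK k (ε n) (gmul (ginv w) h) (g w)) atTop
      (𝓝 (regK k 0 (gmul (ginv w) h) (g w))) := by
    filter_upwards [hgU] with w hw
    by_cases hwU : w ∈ U
    · rw [hw hwU]
      simp
    · have h1 := (tendsto_regK (k := k) (hC w hwU).1).comp hε
      exact ((ContinuousLinearMap.apply ℂ (V k) (g w)).continuous.tendsto _).comp h1
  have hm : ∀ n, AEStronglyMeasurable (fun w => regK k (ε n) (gmul (ginv w) h) (g w)) volume :=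
    fun n => (convAt_regK hg (hε0 n) h).1
  exact ⟨hi.mono' (aestronglyMeasurable_of_tendsto_ae atTop hm hlim) (hbound 0 le_rfl),
    tendsto_integral_of_dominated_convergence _ hm hi (fun n => hbound _ (hε0 n).le) hlim⟩

/-- The Szegő projection is given by the boundary kernel off the support. -/
theorem szegoProjection_eq_conv (hk : 1 ≤ k) (g : L2H k) {U : Set H} (hU : IsOpen U)
    (hgU : ∀ᵐ w : H, w ∈ U → g w = 0) :
    ∀ᵐ h : H, h ∈ U → ConvAt g (regK k 0) h ∧ szegoProjection k g h = conv g (regK k 0) h := by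
  let ε : ℕ → ℝ := fun n => 1 / ((n : ℝ) + 1)
  have hε0 : ∀ n, 0 < ε n := fun n => Nat.one_div_pos_of_nat
  have hε : Tendsto ε atTop (𝓝 0) := tendsto_one_div_add_atTop_nhds_zero_nat
  have hε' : Tendsto ε atTop (𝓝[>] 0) :=
    tendsto_nhdsWithin_iff.2 ⟨hε, Eventually.of_forall hε0⟩
  have hL := (tendsto_poisMean (szegoProjection k g)).comp hε
  -- Convergence in `L²` gives almost everywhere convergence along a subsequence.
  obtain ⟨ns, hns, hae⟩ := (tendstoInMeasure_of_tendsto_Lp hL).exists_seq_tendsto_ae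
  have hconv := ae_all_iff.2 fun n => conv_regK_ae_eq hk g (hε0 (ns n))
  filter_upwards [hae, hconv] with h h1 h2 hh
  obtain ⟨h3, h4⟩ := conv_boundary (Lp.memLp g) hU hgU hh (hε'.comp hns.tendsto_atTop)
    fun n => hε0 (ns n)
  refine ⟨h3, tendsto_nhds_unique h1 (h4.congr fun n => ?_)⟩
  exact h2 n

theorem memLp_conv_regK (hk : 1 ≤ k) (g : L2H k) {ε : ℝ} (hε : 0 < ε) :
    MemLp (conv g (regK k ε)) 2 volume :=
  (memLp_congr_ae (conv_regK_ae_eq hk g hε)).2 (Lp.memLp _)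

/-- The regularized convolutions are the Poisson means of the Szegő projection, hence converge to it
in `L²`. -/
theorem tendsto_eLpNorm_conv_regK (hk : 1 ≤ k) (g : L2H k) :
    Tendsto (fun ε : ℝ => eLpNorm (fun h => conv g (regK k ε) h - szegoProjection k g h) 2 volume)
      (𝓝[>] 0) (𝓝 0) := by
  have h1 : Tendsto (fun ε => ‖poisMean ε (szegoProjection k g) - szegoProjection k g‖ₑ)
      (𝓝[>] 0) (𝓝 0) := by
    have := ((tendsto_poisMean (szegoProjection k g)).sub_const (szegoProjection k g)).enorm
    rw [sub_self, enorm_zero] at this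
    exact this.mono_left nhdsWithin_le_nhds
  refine h1.congr' ?_
  filter_upwards [self_mem_nhdsWithin] with ε hε
  rw [Lp.enorm_def]
  refine eLpNorm_congr_ae ?_
  filter_upwards [conv_regK_ae_eq hk g hε,
    Lp.coeFn_sub (poisMean ε (szegoProjection k g)) (szegoProjection k g)] with h h2 h3
  rw [h3, h2, Pi.sub_apply]

end QHeis

theorem mainTheorem10 (k : ℕ) (hk : 1 ≤ k) :
    (∀ (y : E4) (s : E3), y ≠ 0 → Integrable (kernelIntegrand k (‖y‖ ^ 2) s) sphereMeasure) ∧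
    ∃ S : H → V k →L[ℂ] V k,
      (∀ (y : E4) (s : E3), y ≠ 0 → S (y, s) = kernelIntegral k (‖y‖ ^ 2) s) ∧
      ContDiffOn ℝ ∞ S {0}ᶜ ∧
      (∀ (r : ℝ) (y : E4) (s : E3), 0 < r → (y, s) ≠ (0 : H) →
        S (r • y, r ^ 2 • s) = (((r ^ 10)⁻¹ : ℝ) : ℂ) • S (y, s)) ∧
      (∀ (g : L2H k) (U : Set H), IsOpen U → (∀ᵐ w : H, w ∈ U → g w = 0) →
        ∀ᵐ h : H, h ∈ U → ConvAt g S h ∧ szegoProjection k g h = conv g S h) ∧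
      (∀ g : L2H k,
        (∀ ε : ℝ, 0 < ε →
          (∀ h : H, ConvAt g (fun p => kernelIntegral k (‖p.1‖ ^ 2 + ε) p.2) h) ∧
          MemLp (conv g fun p => kernelIntegral k (‖p.1‖ ^ 2 + ε) p.2) 2 volume) ∧
        Tendsto (fun ε : ℝ => eLpNorm
            (fun h => conv g (fun p => kernelIntegral k (‖p.1‖ ^ 2 + ε) p.2) h
              - szegoProjection k g h) 2 volume)
          (𝓝[>] 0) (𝓝 0)) := by
  refine ⟨fun y s hy => integrable_kernelIntegrand hk (by positivity) s,
    regK k 0, fun y s hy => ?_, contDiffOn_kernelMat_radial k, fun r y s hr hys => ?_,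
    fun g U hU hgU => szegoProjection_eq_conv hk g hU hgU, fun g => ⟨fun ε hε => ?_, ?_⟩⟩
  · rw [kernelIntegral_eq hk (by positivity), regK, radial, one_mul, add_zero]
  · have h1 : radial 1 0 (r • y, r ^ 2 • s) = (r ^ 2) • radial 1 0 (y, s) := by
      simp [radial, norm_smul, mul_pow]
    rw [regK, h1, kernelMat_smul (by positivity) (radial_mem_bdUpper hys), ← pow_mul]
    rfl
  · rw [kernelIntegral_eq_regK hk hε]
    exact ⟨fun h => convAt_regK (Lp.memLp g) hε h, memLp_conv_regK hk g hε⟩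
  · refine (tendsto_eLpNorm_conv_regK hk g).congr' ?_
    filter_upwards [self_mem_nhdsWithin] with ε hε
    rw [kernelIntegral_eq_regK hk hε]
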